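/- Let $N\ge 3$, let $\Omega\subset\mathbb R^N$ be a bounded domain with smooth boundary, and let $X=L^2(\Omega)$ (complex valued). Let $A=-\Delta$ be the negative Laplacian on $X$ with homogeneous Dirichlet boundary conditions, i.e. $D(A)=H^2(\Omega)\cap H^1_0(\Omega)$ (equivalently, $u\in D(A)$ and $Au=h$ iff $u\in H_0^1(\Omega)$, $h\in X$ and $\int_\Omega\nabla u\cdot\nabla v\,dx=\int_\Omega hv\,dx$ for all $v\in H^1_0(\Omega)$). Let $A^{1/2}$ be the nonnegative self-adjoint square root of $A$, let $X^{1}=D(A)$, and let $X^{1/2}=D(A^{1/2})$ carry the graph norm. Put $$Y_0=X^{1/2}\times X\times X^{1/2}\times X,\qquad Y_1=X^{1}\times X^{1/2}\times X^{1}\times X^{1/2}.$$ Let $\eta>0$. For $\varepsilon\in[0,1]$ let $a_\varepsilon\in C^1(\mathbb R)$ satisfy $0<\alpha_0\le a_\varepsilon(t)\le\alpha_1$, $|a_\varepsilon'(t)|\le b_0$ and $|a_\varepsilon(t)-a_\varepsilon(s)|\le C|t-s|^\beta$ for all $t,s\in\mathbb R$, with constants $\alpha_0,\alpha_1,b_0,C>0$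 and $\beta\in(0,1]$ independent of $\varepsilon$, and assume $\|a_\varepsilon-a_0\|_{L^\infty(\mathbb R)}\to0$ as $\varepsilon\to0^+$. Let $f\in C^1(\mathbb R)$ be real valued with $\limsup_{|s|\to\infty}f(s)/s\le0$ and $|f'(s)|\le c(1+|s|^{\rho-1})$ for all $s\in\mathbb R$, where $c>0$ and $\frac{N-1}{N-2}\le\rho<\frac{N}{N-2}$. Let $u^*\in D(A)$ be a real-valued solution of $-\Delta u^*+u^*=f(u^*)$ in $\Omega$, $u^*=0$ on $\partial\Omega$. For $\varepsilon\in[0,1]$ and $t\in\mathbb R$ let $\tilde{\mathcal A}_\varepsilon(t)$ be the operator in $Y_0$ given by $$\tilde{\mathcal A}_\varepsilon(t)=\begin{bmatrix}0&-I&0&0\\ A+I-f'(u^*)&\eta A^{1/2}&0&a_\varepsilon(t)A^{1/2}\\ 0&0&0&-I\\ 0&-a_\varepsilon(t)A^{1/2}&A&\eta A^{1/2}\end{bmatrix}.$$ Then, for each fixed $t\in\mathbb R$, the following holds. For every $\varepsilon\in[0,1]$ the operator $\tilde{\mathcal A}_\varepsilon(t)$ is defined exactly on $Y_1$, and $-\tilde{\mathcal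 A}_\varepsilon(t)$ generates an analytic semigroup $\{e^{-s\tilde{\mathcal A}_\varepsilon(t)}:s\ge0\}\subset\mathcal L(Y_0)$. Moreover, $$\big\|e^{-s\tilde{\mathcal A}_\varepsilon(t)}-e^{-s\tilde{\mathcal A}_0(t)}\big\|_{\mathcal L(Y_0)}\to0\qquad\text{as }\varepsilon\to0^+,$$ uniformly for $s$ in compact subsets of $\mathbb R_+=[0,\infty)$. -/

import Mathlib

open MeasureTheory Filter Topology
open scoped NNReal ENNReal ContDiff InnerProductSpace

noncomputable section

namespace KGZ

/-! ### Operators associated with closed forms, and their square roots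

Let `T` be a closed, densely defined operator from a Hilbert space `H` to a Hilbert space `K`, and
let `V ⊆ H × K` be its graph. -/

section Operators

variable {H K : Type} [NormedAddCommGroup H] [InnerProductSpace ℂ H] [CompleteSpace H]
  [NormedAddCommGroup K] [InnerProductSpace ℂ K]

/-- The graph of the nonnegative self-adjoint operator `A = T* T` associated with the form
`⟪T v, T u⟫`: `u ∈ D(A)` and `A u = h` iff `u ∈ D(T)` and `⟪T v, T u⟫ = ⟪v, h⟫` for all
`v ∈ D(T)`. -/
def formOperator (V : Submodule ℂ (WithLp 2 (H × K))) : Submodule ℂ (H × H) where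
  carrier := {p | ∃ w ∈ V, w.fst = p.1 ∧ ∀ v ∈ V, ⟪v.snd, w.snd⟫_ℂ = ⟪v.fst, p.2⟫_ℂ}
  zero_mem' := ⟨0, zero_mem _, by simp, by simp⟩
  add_mem' := by
    rintro p q ⟨w, hw, h1, h2⟩ ⟨w', hw', h1', h2'⟩
    refine ⟨w + w', add_mem hw hw', by simp [h1, h1'], fun v hv => ?_⟩
    simp [h2 v hv, h2' v hv]
  smul_mem' := by
    rintro c p ⟨w, hw, h1, h2⟩
    refine ⟨c • w, Submodule.smul_mem _ c hw, by simp [h1], fun v hv => ?_⟩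
    simp [h2 v hv]

/-- The embedding `J` of `D(T)`, with its graph norm, into `H`. -/
def formEmbedding (V : Submodule ℂ (WithLp 2 (H × K))) : V →L[ℂ] H :=
  (WithLp.fstL 2 ℂ H K) ∘L V.subtypeL

/-- The bounded operator `R = (I + A)⁻¹ = J J*`. -/
def formResolvent (V : Submodule ℂ (WithLp 2 (H × K))) [CompleteSpace V] : H →L[ℂ] H :=
  formEmbedding V ∘L (formEmbedding V).adjoint

/-- `R` is the inverse of `I + A`. -/
theorem mem_formOperator_iff (V : Submodule ℂ (WithLp 2 (H × K))) [CompleteSpace V] (u h : H) :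
    (u, h) ∈ formOperator V ↔ formResolvent V (u + h) = u := by
  set q : V := (formEmbedding V).adjoint (u + h) with hq
  have key : ∀ v : V, ⟪v.1.fst, q.1.fst⟫_ℂ + ⟪v.1.snd, q.1.snd⟫_ℂ
      = ⟪v.1.fst, u⟫_ℂ + ⟪v.1.fst, h⟫_ℂ := fun v => by
    have := (formEmbedding V).adjoint_inner_right v (u + h)
    rw [← hq] at this
    rw [← inner_add_right]
    exact this
  have hR : formResolvent V (u + h) = q.1.fst := rfl
  rw [hR]
  constructor
  · rintro ⟨w, hw, h1, h2⟩
    have : q = ⟨w, hw⟩ := by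
      refine ext_inner_left ℂ fun v => ?_
      have e1 : ⟪v, q⟫_ℂ = ⟪v.1.fst, q.1.fst⟫_ℂ + ⟪v.1.snd, q.1.snd⟫_ℂ := rfl
      have e2 : ⟪v, (⟨w, hw⟩ : V)⟫_ℂ = ⟪v.1.fst, w.fst⟫_ℂ + ⟪v.1.snd, w.snd⟫_ℂ := rfl
      have e3 : ⟪v.1.snd, w.snd⟫_ℂ = ⟪v.1.fst, h⟫_ℂ := h2 v.1 v.2
      rw [e1, e2, key, e3, h1]
    rw [this]
    exact h1
  · intro e
    refine ⟨q.1, q.2, e, fun v hv => ?_⟩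
    have := key ⟨v, hv⟩
    rw [e] at this
    exact add_left_cancel this

/-- For a nonnegative self-adjoint operator `A` with `R = (I + A)⁻¹`, the graph of `A^{1/2}`,
which in the functional calculus of `R` is `(I - R)^{1/2} R^{-1/2}`. -/
def sqrtGraph (R : H →L[ℂ] H) : Submodule ℂ (WithLp 2 (H × H)) :=
  LinearMap.range ((WithLp.linearEquiv 2 ℂ (H × H)).symm.toLinearMap ∘ₗ
    ((CFC.sqrt R).toLinearMap.prod (CFC.sqrt (1 - R)).toLinearMap))

theorem mem_sqrtGraph {R : H →L[ℂ] H} {p : WithLp 2 (H × H)} :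
    p ∈ sqrtGraph R ↔ ∃ x : H, CFC.sqrt R x = p.fst ∧ CFC.sqrt (1 - R) x = p.snd := by
  constructor
  · rintro ⟨x, rfl⟩
    exact ⟨x, rfl, rfl⟩
  · rintro ⟨x, h1, h2⟩
    refine ⟨x, ?_⟩
    apply (WithLp.linearEquiv 2 ℂ (H × H)).injective
    exact Prod.ext h1 h2

theorem sqrt_relations {R : H →L[ℂ] H} (h0 : 0 ≤ R) (h1 : R ≤ 1) :
    (∀ x, CFC.sqrt R (CFC.sqrt R x) = R x) ∧
    (∀ x, CFC.sqrt (1 - R) (CFC.sqrt (1 - R) x) = x - R x) ∧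
    (∀ x, CFC.sqrt (1 - R) (CFC.sqrt R x) = CFC.sqrt R (CFC.sqrt (1 - R) x)) := by
  have h2 : 0 ≤ 1 - R := sub_nonneg.2 h1
  have hc : Commute R (1 - R) := (Commute.one_right R).sub_right (Commute.refl R)
  have hs : Commute (CFC.sqrt R) (CFC.sqrt (1 - R)) := by
    rw [CFC.sqrt_eq_cfc, CFC.sqrt_eq_cfc]
    exact ((hc.cfc_nnreal _).symm.cfc_nnreal _).symm
  refine ⟨fun x => ?_, fun x => ?_, fun x => ?_⟩
  · exact congrArg (fun T : H →L[ℂ] H => T x) (CFC.sqrt_mul_sqrt_self R h0)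
  · exact congrArg (fun T : H →L[ℂ] H => T x) (CFC.sqrt_mul_sqrt_self (1 - R) h2)
  · exact congrArg (fun T : H →L[ℂ] H => T x) hs.eq.symm

/-- The square of `A^{1/2}` is `A`, that is, the relation `(I + A)⁻¹ (u + h) = u`. -/
theorem sqrtGraph_sq {R : H →L[ℂ] H} (h0 : 0 ≤ R) (h1 : R ≤ 1) (u h : H) :
    (∃ z, WithLp.toLp 2 (u, z) ∈ sqrtGraph R ∧ WithLp.toLp 2 (z, h) ∈ sqrtGraph R) ↔
      R (u + h) = u := by
  obtain ⟨r1, r2, r3⟩ := sqrt_relations h0 h1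
  simp only [mem_sqrtGraph]
  constructor
  · rintro ⟨z, ⟨p, hp1, hp2⟩, ⟨q, hq1, hq2⟩⟩
    dsimp at hp1 hp2 hq1 hq2
    have e1 : CFC.sqrt R (CFC.sqrt R p + CFC.sqrt (1 - R) q) = p := by
      rw [map_add, r1, ← r3, hq1, ← hp2, r2]; abel
    have e2 : CFC.sqrt (1 - R) (CFC.sqrt R p + CFC.sqrt (1 - R) q) = q := by
      rw [map_add, r2, r3, hp2, ← hq1, r1]; abel
    rw [← hp1, ← hq2, ← r1, e1]
  · intro e
    refine ⟨CFC.sqrt (1 - R) (CFC.sqrt R (u + h)), ⟨CFC.sqrt R (u + h), ?_, rfl⟩,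
      ⟨CFC.sqrt (1 - R) (u + h), (r3 _).symm, ?_⟩⟩
    · exact (r1 _).trans e
    · rw [r2, e]; simp

/-- `A^{1/2}` is nonnegative and self-adjoint. -/
theorem sqrtGraph_selfAdjoint {R : H →L[ℂ] H} (h0 : 0 ≤ R) (h1 : R ≤ 1) :
    (∀ p ∈ sqrtGraph R, 0 ≤ (⟪p.fst, p.snd⟫_ℂ).re) ∧
    ∀ v w : H, WithLp.toLp 2 (v, w) ∈ sqrtGraph R ↔
      ∀ p ∈ sqrtGraph R, ⟪v, p.snd⟫_ℂ = ⟪w, p.fst⟫_ℂ := by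
  obtain ⟨r1, r2, r3⟩ := sqrt_relations h0 h1
  have s1 : ∀ x y, ⟪CFC.sqrt R x, y⟫_ℂ = ⟪x, CFC.sqrt R y⟫_ℂ :=
    ((ContinuousLinearMap.nonneg_iff_isPositive _).1 (CFC.sqrt_nonneg R)).isSymmetric
  have s2 : ∀ x y, ⟪CFC.sqrt (1 - R) x, y⟫_ℂ = ⟪x, CFC.sqrt (1 - R) y⟫_ℂ :=
    ((ContinuousLinearMap.nonneg_iff_isPositive _).1 (CFC.sqrt_nonneg (1 - R))).isSymmetric
  refine ⟨?_, fun v w => ⟨?_, fun hv => ?_⟩⟩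
  · intro p hp
    obtain ⟨x, hx1, hx2⟩ := mem_sqrtGraph.1 hp
    have hc : Commute (CFC.sqrt R) (CFC.sqrt (1 - R)) := by
      ext x; exact (r3 x).symm
    have hpos := (ContinuousLinearMap.nonneg_iff_isPositive _).1
      (hc.mul_nonneg (CFC.sqrt_nonneg R) (CFC.sqrt_nonneg (1 - R)))
    rw [← hx1, ← hx2, s1]
    exact hpos.re_inner_nonneg_right x
  · intro hm p hp
    obtain ⟨x, hx1, hx2⟩ := mem_sqrtGraph.1 hm
    obtain ⟨y, hy1, hy2⟩ := mem_sqrtGraph.1 hp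
    dsimp at hx1 hx2
    rw [← hx1, ← hx2, ← hy1, ← hy2, s1, s2, r3]
  · have e : CFC.sqrt (1 - R) v = CFC.sqrt R w := by
      refine ext_inner_right ℂ fun x => ?_
      rw [s1, s2]
      exact hv (WithLp.toLp 2 (CFC.sqrt R x, CFC.sqrt (1 - R) x))
        (mem_sqrtGraph.2 ⟨x, rfl, rfl⟩)
    refine mem_sqrtGraph.2 ⟨CFC.sqrt R v + CFC.sqrt (1 - R) w, ?_, ?_⟩
    · rw [map_add, r1, ← r3, ← e, r2]; simp
    · rw [map_add, r2, r3, e, r1]; simp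

theorem formResolvent_nonneg_le_one (V : Submodule ℂ (WithLp 2 (H × K))) [CompleteSpace V] :
    0 ≤ formResolvent V ∧ formResolvent V ≤ 1 := by
  set J := formEmbedding V with hJ
  have hJle : ∀ w : V, ‖J w‖ ≤ ‖w‖ := fun w => by
    have h : ‖w.1.fst‖ ^ 2 ≤ ‖w.1‖ ^ 2 := by
      rw [WithLp.prod_norm_sq_eq_of_L2]
      linarith [sq_nonneg ‖w.1.snd‖]
    exact le_of_sq_le_sq h (norm_nonneg _)
  have hpos : (formResolvent V).IsPositive := ContinuousLinearMap.isPositive_self_comp_adjoint J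
  refine ⟨(ContinuousLinearMap.nonneg_iff_isPositive _).2 hpos, ?_⟩
  have hin : ∀ x, ⟪formResolvent V x, x⟫_ℂ = ⟪J.adjoint x, J.adjoint x⟫_ℂ := fun x =>
    (J.adjoint_inner_right (J.adjoint x) x).symm
  have hle : ∀ x, ‖J.adjoint x‖ ≤ ‖x‖ := fun x => by
    have h : ‖J.adjoint x‖ ^ 2 ≤ ‖J.adjoint x‖ * ‖x‖ := by
      rw [← inner_self_eq_norm_sq (𝕜 := ℂ), ← hin]
      exact (re_inner_le_norm (𝕜 := ℂ) _ _).trans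
        (mul_le_mul_of_nonneg_right (hJle _) (norm_nonneg _))
    rcases (norm_nonneg (J.adjoint x)).eq_or_lt with h0 | h0
    · rw [← h0]; exact norm_nonneg x
    · rw [sq] at h
      exact le_of_mul_le_mul_left h h0
  rw [ContinuousLinearMap.le_def, ContinuousLinearMap.isPositive_def]
  refine ⟨(ContinuousLinearMap.isPositive_one (𝕜 := ℂ) (E := H)).isSymmetric.sub
    hpos.isSymmetric, fun x => ?_⟩
  rw [ContinuousLinearMap.reApplyInnerSelf_apply, sub_apply, inner_sub_left,
    hin, map_sub, one_apply_eq_self, inner_self_eq_norm_sq, sub_nonneg]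
  refine (inner_self_eq_norm_sq (𝕜 := ℂ) (E := V) (J.adjoint x)).le.trans ?_
  exact pow_le_pow_left₀ (norm_nonneg _) (hle x) 2

/-- The graph of `A^{1/2}`. -/
def sqrtFormOperator (V : Submodule ℂ (WithLp 2 (H × K))) [CompleteSpace V] :
    Submodule ℂ (WithLp 2 (H × H)) :=
  sqrtGraph (formResolvent V)

/-- `A^{1/2} A^{1/2} = A`. -/
theorem sqrtFormOperator_sq (V : Submodule ℂ (WithLp 2 (H × K))) [CompleteSpace V] (u h : H) :
    (∃ z, WithLp.toLp 2 (u, z) ∈ sqrtFormOperator V ∧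
      WithLp.toLp 2 (z, h) ∈ sqrtFormOperator V) ↔ (u, h) ∈ formOperator V := by
  rw [mem_formOperator_iff]
  exact sqrtGraph_sq (formResolvent_nonneg_le_one V).1 (formResolvent_nonneg_le_one V).2 u h

/-- `A^{1/2}` is nonnegative and self-adjoint. -/
theorem sqrtFormOperator_selfAdjoint (V : Submodule ℂ (WithLp 2 (H × K))) [CompleteSpace V] :
    (∀ p ∈ sqrtFormOperator V, 0 ≤ (⟪p.fst, p.snd⟫_ℂ).re) ∧
    ∀ v w : H, WithLp.toLp 2 (v, w) ∈ sqrtFormOperator V ↔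
      ∀ p ∈ sqrtFormOperator V, ⟪v, p.snd⟫_ℂ = ⟪w, p.fst⟫_ℂ :=
  sqrtGraph_selfAdjoint (formResolvent_nonneg_le_one V).1 (formResolvent_nonneg_le_one V).2

/-- `A^{1/2}` is single-valued, as `D(T)` is dense. -/
theorem sqrtFormOperator_single_valued (V : Submodule ℂ (WithLp 2 (H × K))) [CompleteSpace V]
    (hd : ∀ x : H, (∀ w ∈ V, ⟪w.fst, x⟫_ℂ = 0) → x = 0) {p : WithLp 2 (H × H)}
    (hp : p ∈ sqrtFormOperator V) (h0 : p.fst = 0) : p.snd = 0 := by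
  obtain ⟨x, hx1, hx2⟩ := mem_sqrtGraph.1 hp
  obtain ⟨hR0, hR1⟩ := formResolvent_nonneg_le_one V
  obtain ⟨r1, -, -⟩ := sqrt_relations hR0 hR1
  set J := formEmbedding V with hJ
  have hRx : J (J.adjoint x) = 0 := by
    have := r1 x
    rw [hx1, h0, map_zero] at this
    exact this.symm
  have hin : ∀ w, ⟪w, J.adjoint x⟫_ℂ = ⟪J w, x⟫_ℂ := fun w => J.adjoint_inner_right w x
  have hQx : J.adjoint x = 0 := by
    rw [← inner_self_eq_zero (𝕜 := ℂ), hin, hRx, inner_zero_left]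
  have hx : ∀ w ∈ V, ⟪w.fst, x⟫_ℂ = 0 := fun w hw => by
    have := hin ⟨w, hw⟩
    rw [hQx, inner_zero_right] at this
    exact this.symm
  rw [← hx2, hd x hx, map_zero]

end Operators

/-! ### Bounded smooth domains and the space `X = L²(Ω)` -/

/-- `Ω` is a bounded domain (open, connected, non-empty) with smooth boundary: near each
boundary point, `Ω` is the sublevel set `{ψ < 0}` of a smooth function without critical point. -/
structure IsBoundedSmoothDomain {N : ℕ} (Ω : Set (EuclideanSpace ℝ (Fin N))) : Prop where
  isOpen : IsOpen Ω
  isConnected : IsConnected Ω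
  isBounded : Bornology.IsBounded Ω
  smooth_boundary : ∀ x ∈ frontier Ω, ∃ U : Set (EuclideanSpace ℝ (Fin N)), IsOpen U ∧ x ∈ U ∧
    ∃ ψ : EuclideanSpace ℝ (Fin N) → ℝ, ContDiffOn ℝ ∞ ψ U ∧ (∀ y ∈ U, fderiv ℝ ψ y ≠ 0) ∧
      ψ x = 0 ∧ Ω ∩ U = {y ∈ U | ψ y < 0}

/-- `X = L²(Ω)`, complex valued. -/
abbrev X {N : ℕ} (Ω : Set (EuclideanSpace ℝ (Fin N))) : Type :=
  Lp ℂ 2 (volume.restrict Ω)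

/-! ### The space `H¹₀(Ω)` -/

/-- The pairs `(φ, ∇φ)` in `L²(Ω) × L²(Ω)^N`, with `φ` smooth and compactly supported in `Ω`. -/
def testGradients {N : ℕ} (Ω : Set (EuclideanSpace ℝ (Fin N))) :
    Submodule ℂ (WithLp 2 (X Ω × PiLp 2 (fun _ : Fin N => X Ω))) where
  carrier := {p | ∃ φ : EuclideanSpace ℝ (Fin N) → ℂ,
    ContDiff ℝ ∞ φ ∧ HasCompactSupport φ ∧ tsupport φ ⊆ Ω ∧
    (p.fst : EuclideanSpace ℝ (Fin N) → ℂ) =ᵐ[volume.restrict Ω] φ ∧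
    ∀ i, (p.snd i : EuclideanSpace ℝ (Fin N) → ℂ) =ᵐ[volume.restrict Ω]
      fun x => fderiv ℝ φ x (EuclideanSpace.single i 1)}
  zero_mem' := by
    refine ⟨0, contDiff_const, HasCompactSupport.zero, by simp [tsupport], ?_, fun i => ?_⟩
    · exact Lp.coeFn_zero _ _ _
    · filter_upwards [Lp.coeFn_zero ℂ 2 (volume.restrict Ω)] with x hx
      simpa using hx
  add_mem' := by
    rintro p q ⟨φ, h1, h2, h3, h4, h5⟩ ⟨ψ, k1, k2, k3, k4, k5⟩
    refine ⟨φ + ψ, h1.add k1, h2.add k2,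
      (tsupport_add φ ψ).trans (Set.union_subset h3 k3), ?_, fun i => ?_⟩
    · filter_upwards [Lp.coeFn_add p.fst q.fst, h4, k4] with x e1 e2 e3
      simpa [e2, e3] using e1
    · filter_upwards [Lp.coeFn_add (p.snd i) (q.snd i), h5 i, k5 i] with x e1 e2 e3
      rw [fderiv_add (h1.differentiable (by simp) x) (k1.differentiable (by simp) x)]
      simpa [e2, e3] using e1
  smul_mem' := by
    rintro c p ⟨φ, h1, h2, h3, h4, h5⟩
    refine ⟨c • φ, contDiff_const.smul h1, h2.smul_left (f := fun _ => c),
      (tsupport_smul_subset_right (fun _ => c) φ).trans h3, ?_, fun i => ?_⟩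
    · filter_upwards [Lp.coeFn_smul c p.fst, h4] with x e1 e2
      simpa [e2] using e1
    · filter_upwards [Lp.coeFn_smul c (p.snd i), h5 i] with x e1 e2
      rw [fderiv_const_smul (h1.differentiable (by simp) x)]
      simpa [e2] using e1

/-- `H¹₀(Ω)`, the closure of `C_c^∞(Ω)` in the `H¹`-norm. Its elements are the pairs `(u, ∇u)`,
and its inner product is that of `H¹(Ω)`. -/
def H10 {N : ℕ} (Ω : Set (EuclideanSpace ℝ (Fin N))) :
    Submodule ℂ (WithLp 2 (X Ω × PiLp 2 (fun _ : Fin N => X Ω))) :=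
  (testGradients Ω).topologicalClosure

instance {N : ℕ} (Ω : Set (EuclideanSpace ℝ (Fin N))) : CompleteSpace (H10 Ω) :=
  inferInstanceAs (CompleteSpace (testGradients Ω).topologicalClosure)

/-- `C_c^∞(Ω)`, hence `H¹₀(Ω)`, is dense in `L²(Ω)`. -/
theorem eq_zero_of_orthogonal_H10 {N : ℕ} {Ω : Set (EuclideanSpace ℝ (Fin N))} (hΩ : IsOpen Ω)
    (x : X Ω) (hx : ∀ w ∈ H10 Ω, ⟪w.fst, x⟫_ℂ = 0) : x = 0 := by
  have hae : ∀ᵐ y ∂(volume.restrict Ω), y ∈ Ω → x y = 0 := by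
    refine hΩ.ae_eq_zero_of_integral_contDiff_smul_eq_zero ?_ fun g hg1 hg2 hg3 => ?_
    · exact ((Lp.memLp x).locallyIntegrable (by norm_num)).locallyIntegrableOn _
    · have hc1 : ContDiff ℝ ∞ (fun y => (g y : ℂ)) := Complex.ofRealCLM.contDiff.comp hg1
      have hc2 : HasCompactSupport (fun y => (g y : ℂ)) :=
        hg2.comp_left (g := fun r : ℝ => (r : ℂ)) (by simp)
      have hc3 : tsupport (fun y => (g y : ℂ)) ⊆ Ω :=
        (closure_mono (fun y hy => by
          simp only [Function.mem_support, ne_eq, Complex.ofReal_eq_zero] at hy ⊢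
          exact hy)).trans hg3
      have m0 : MemLp (fun y => (g y : ℂ)) 2 (volume.restrict Ω) :=
        hc1.continuous.memLp_of_hasCompactSupport hc2
      have m1 : ∀ i : Fin N, MemLp
          (fun y => fderiv ℝ (fun y => (g y : ℂ)) y (EuclideanSpace.single i 1)) 2
          (volume.restrict Ω) := fun i =>
        ((hc1.continuous_fderiv (by simp)).clm_apply
          continuous_const).memLp_of_hasCompactSupport (hc2.fderiv_apply (𝕜 := ℝ) _)
      let p : WithLp 2 (X Ω × PiLp 2 (fun _ : Fin N => X Ω)) :=
        WithLp.toLp 2 (m0.toLp _, WithLp.toLp 2 fun i => (m1 i).toLp _)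
      have hp : p ∈ H10 Ω := Submodule.le_topologicalClosure _
        ⟨_, hc1, hc2, hc3, m0.coeFn_toLp, fun i => (m1 i).coeFn_toLp⟩
      have h := hx p hp
      have h' : ⟪m0.toLp _, x⟫_ℂ = 0 := h
      rw [L2.inner_def] at h'
      rw [← h']
      refine integral_congr_ae ?_
      filter_upwards [m0.coeFn_toLp] with y hy
      rw [hy]
      simp [mul_comm]
  refine (Lp.eq_zero_iff_ae_eq_zero).2 ?_
  filter_upwards [hae, self_mem_ae_restrict hΩ.measurableSet] with y h1 h2 using h1 h2

/-! ### The Dirichlet Laplacian `A` and its square root -/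

/-- The graph of the negative Dirichlet Laplacian `A = -Δ` on `L²(Ω)`: `u ∈ D(A)` and `A u = h`
iff `u ∈ H¹₀(Ω)`, `h ∈ L²(Ω)` and `∫ ∇u · ∇v = ∫ h v` for every `v ∈ H¹₀(Ω)`. (When `∂Ω` is smooth
and `Ω` is bounded, `D(A)` is `H²(Ω) ∩ H¹₀(Ω)` by elliptic regularity.) -/
def laplacian {N : ℕ} (Ω : Set (EuclideanSpace ℝ (Fin N))) : Submodule ℂ (X Ω × X Ω) :=
  formOperator (H10 Ω)

/-- `X^{1/2} = D(A^{1/2})` with its graph norm `(‖u‖² + ‖A^{1/2}u‖²)^{1/2}`, realized as the graph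
of `A^{1/2}`: its elements are the pairs `(u, A^{1/2}u)`. -/
def XHalf {N : ℕ} (Ω : Set (EuclideanSpace ℝ (Fin N))) : Submodule ℂ (WithLp 2 (X Ω × X Ω)) :=
  sqrtFormOperator (H10 Ω)

/-- The pairs in `XHalf Ω` are determined by their first entry. -/
theorem XHalf_single_valued {N : ℕ} {Ω : Set (EuclideanSpace ℝ (Fin N))} (hΩ : IsOpen Ω)
    {p : WithLp 2 (X Ω × X Ω)} (hp : p ∈ XHalf Ω) (h0 : p.fst = 0) : p.snd = 0 :=
  sqrtFormOperator_single_valued (H10 Ω) (eq_zero_of_orthogonal_H10 hΩ) hp h0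

/-! ### The linearized operator -/

/-- The phase space `Y₀ = X^{1/2} × X × X^{1/2} × X` (with the maximum norm, which is equivalent to
the sum and to the Euclidean norm of the four norms). -/
def Y0 {N : ℕ} (Ω : Set (EuclideanSpace ℝ (Fin N))) : Type :=
  XHalf Ω × X Ω × XHalf Ω × X Ω

instance {N : ℕ} (Ω : Set (EuclideanSpace ℝ (Fin N))) : NormedAddCommGroup (Y0 Ω) :=
  inferInstanceAs (NormedAddCommGroup (XHalf Ω × X Ω × XHalf Ω × X Ω))

instance {N : ℕ} (Ω : Set (EuclideanSpace ℝ (Fin N))) : NormedSpace ℂ (Y0 Ω) :=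
  inferInstanceAs (NormedSpace ℂ (XHalf Ω × X Ω × XHalf Ω × X Ω))

/-- `e* = (u, 0, 0, 0)` is an equilibrium: `u ∈ D(A)` is real valued and `-Δu + u = f(u)`. -/
def IsEquilibrium {N : ℕ} (Ω : Set (EuclideanSpace ℝ (Fin N))) (f : ℝ → ℝ) (u : X Ω) : Prop :=
  (∀ᵐ x ∂(volume.restrict Ω), (u x).im = 0) ∧
  ∃ h : X Ω, (u, h) ∈ laplacian Ω ∧
    ∀ᵐ x ∂(volume.restrict Ω), h x + u x = ((f (u x).re : ℝ) : ℂ)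

/-- The domain `Y₁ = X¹ × X^{1/2} × X¹ × X^{1/2}`, as a subset of `Y₀`. -/
def Y1 {N : ℕ} (Ω : Set (EuclideanSpace ℝ (Fin N))) : Set (Y0 Ω) :=
  {W | (∃ h, (W.1.1.fst, h) ∈ laplacian Ω) ∧ (∃ p ∈ XHalf Ω, p.fst = W.2.1) ∧
    (∃ h, (W.2.2.1.1.fst, h) ∈ laplacian Ω) ∧ (∃ p ∈ XHalf Ω, p.fst = W.2.2.2)}

/-- The linearization `Ã` at `u*`, with the coefficients `η` and `a = a_ε(t)`:
`linearized Ω f η u* a W Z` says that `W = (u, v, w, z)` lies in the domain of `Ã` and that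
`Z = Ã W`, where
`Ã (u, v, w, z) = (-v, (A + I - f'(u*)) u + η A^{1/2} v + a A^{1/2} z,
  -z, -a A^{1/2} v + A w + η A^{1/2} z)`.
Here `Au`, `Bv`, `Aw`, `Bz`, `m` stand for `A u`, `A^{1/2} v`, `A w`, `A^{1/2} z`, `f'(u*) u`. -/
def linearized {N : ℕ} (Ω : Set (EuclideanSpace ℝ (Fin N))) (f : ℝ → ℝ) (η : ℝ) (ustar : X Ω)
    (a : ℝ) (W Z : Y0 Ω) : Prop :=
  ∃ Au Bv Aw Bz m : X Ω,
    (W.1.1.fst, Au) ∈ laplacian Ω ∧ WithLp.toLp 2 (W.2.1, Bv) ∈ XHalf Ω ∧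
    (W.2.2.1.1.fst, Aw) ∈ laplacian Ω ∧ WithLp.toLp 2 (W.2.2.2, Bz) ∈ XHalf Ω ∧
    (∀ᵐ x ∂(volume.restrict Ω), m x = ((deriv f (ustar x).re : ℝ) : ℂ) * W.1.1.fst x) ∧
    Z.1.1.fst = -W.2.1 ∧
    Z.2.1 = Au + W.1.1.fst - m + (η : ℂ) • Bv + (a : ℂ) • Bz ∧
    Z.2.2.1.1.fst = -W.2.2.2 ∧
    Z.2.2.2 = -((a : ℂ) • Bv) + Aw + (η : ℂ) • Bz

/-! ### Semigroups -/

/-- `T` is a strongly continuous semigroup of bounded linear operators on `Y`. -/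
structure IsC0Semigroup {Y : Type} [NormedAddCommGroup Y] [NormedSpace ℂ Y]
    (T : ℝ≥0 → Y →L[ℂ] Y) : Prop where
  zero : T 0 = 1
  add : ∀ s t, T (s + t) = T s ∘L T t
  strong : ∀ y, Tendsto (fun s => T s y) (𝓝[>] 0) (𝓝 y)

/-- The open sector `{z ≠ 0 : |arg z| < θ}`. -/
def sector (θ : ℝ) : Set ℂ := {z | z ≠ 0 ∧ |z.arg| < θ}

/-- `T` is an analytic semigroup: it extends to a holomorphic semigroup on an open sector around
the positive half-line, which is strongly continuous at `0`. -/
structure IsAnalyticSemigroup {Y : Type} [NormedAddCommGroup Y] [NormedSpace ℂ Y]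
    (T : ℝ≥0 → Y →L[ℂ] Y) : Prop extends IsC0Semigroup T where
  analytic : ∃ θ : ℝ, 0 < θ ∧ θ ≤ Real.pi / 2 ∧ ∃ S : ℂ → Y →L[ℂ] Y,
    (∀ s : ℝ≥0, 0 < s → S (s : ℂ) = T s) ∧ DifferentiableOn ℂ S (sector θ) ∧
    (∀ z ∈ sector θ, ∀ w ∈ sector θ, S (z + w) = S z ∘L S w) ∧
    ∀ y, Tendsto (fun z => S z y) (𝓝[sector θ] 0) (𝓝 y)

/-- `-G` is the infinitesimal generator of `T`, where `G y z` means `y ∈ D(G)` and `G y = z`. -/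
def IsGeneratedByNeg {Y : Type} [NormedAddCommGroup Y] [NormedSpace ℂ Y]
    (T : ℝ≥0 → Y →L[ℂ] Y) (G : Y → Y → Prop) : Prop :=
  ∀ y z, G y z ↔ Tendsto (fun s : ℝ≥0 => ((s : ℂ)⁻¹) • (T s y - y)) (𝓝[>] 0) (𝓝 (-z))

end KGZ

end

/-! Put R = (I + A)⁻¹; then 0 ≤ R ≤ 1 and R is injective. Since ‖R^{1/2}x‖² + ‖(I - R)^{1/2}x‖² =
‖x‖², the operator R^{1/2} maps X isometrically onto X^{1/2} with its graph norm, so applying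
R^{-1/2} to the first and third components identifies Y₀ with X⁴ (`phaseSpaceEquiv`). The square
root of A differs from R^{-1/2} by a bounded operator: A^{1/2} = R^{-1/2} - D with D = R^{1/2}(I +
(I - R)^{1/2})⁻¹. In the coordinates of X⁴ the linearized operator with coupling b = a_ε(t)
therefore becomes N(b) R^{-1/2} - P(b), where N(b) is a constant 4 × 4 matrix and P(b) is bounded
and affine in b (`linearization_iff`).

The only entry of P(b) that needs analysis is multiplication by f'(u*) composed with R^{1/2}. The
subcritical growth of f and u* ∈ H¹₀ ⊂ L^{2N/(N-2)} place f'(u*) in L^N. Since R^{1/2} maps X into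
L^{2N/(N-2)}, Hölder's inequality closes the estimate (`exists_mul_deriv_operator`).

The combinations v ± iz decouple N(b) into two 2 × 2 blocks with characteristic polynomials σ² - (η
∓ ib)σ + 1. The two roots are inverse to each other and their sum has real part η > 0, so both lie
in the open right half-plane. The discriminant has imaginary part ∓2ηb ≠ 0, so the roots are
distinct and depend continuously on b. Hence N(b) is diagonalizable, continuously in b, and -N(b)
R^{-1/2} generates a conjugate of diag(exp(-zσᵢ R^{-1/2})), given by the functional calculus of R.
From x e^{-x} ≤ 1 one gets ‖exp(-sσ R^{-1/2}) - exp(-sσ' R^{-1/2})‖ ≤ |σ - σ'|/m whenever Re σ, Re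
σ' ≥ m > 0, uniformly in s > 0 (`eventually_norm_matSemigroup_sub_le`).

The bounded part is added through the Dyson–Phillips series, which converges locally uniformly on
the sector and so stays holomorphic. Duhamel's formula and Grönwall's inequality give the semigroup
law, and also continuous dependence on the unperturbed semigroup and on P
(`norm_dysonSeries_sub_dysonSeries_le`). Since a_ε(t) → a_0(t), this is the asserted convergence for
the constructed semigroups. Any C₀-semigroup with the same generator coincides with the constructed
one (`IsC0Semigroup.eq_of_isGeneratedByNeg`), so the convergence holds for every choice of the
semigroups. -/

namespace KGZ

/-! ### Sectors -/

section Sector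

variable {θ : ℝ}

/-- Re z = ‖z‖ cos|arg z| and the cosine decreases strictly on [0, π]. In this form, and with cos θ
≥ 0, openness and stability under sums are immediate. -/
theorem mem_sector_iff (h0 : 0 < θ) (h1 : θ ≤ Real.pi) {z : ℂ} :
    z ∈ sector θ ↔ ‖z‖ * Real.cos θ < z.re := by
  by_cases hz : z = 0
  · simp [sector, hz]
  have hn : 0 < ‖z‖ := norm_pos_iff.2 hz
  have hre : z.re = ‖z‖ * Real.cos |z.arg| := by
    rw [Real.cos_abs, Complex.norm_mul_cos_arg]
  rw [hre, mul_lt_mul_iff_right₀ hn]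
  simp only [sector, Set.mem_ofPred_eq, ne_eq, hz, not_false_eq_true, true_and]
  exact (Real.strictAntiOn_cos.lt_iff_gt ⟨h0.le, h1⟩ ⟨abs_nonneg _, Complex.abs_arg_le_pi z⟩).symm

variable (h0 : 0 < θ) (h1 : θ ≤ Real.pi / 2)
include h0 h1

theorem mem_sector_iff' {z : ℂ} : z ∈ sector θ ↔ ‖z‖ * Real.cos θ < z.re :=
  mem_sector_iff h0 (h1.trans (by linarith [Real.pi_pos]))

theorem cos_nonneg_of_sector : 0 ≤ Real.cos θ :=
  Real.cos_nonneg_of_mem_Icc ⟨by linarith, h1⟩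

theorem isOpen_sector : IsOpen (sector θ) := by
  have : sector θ = {z : ℂ | ‖z‖ * Real.cos θ < z.re} := Set.ext fun z => mem_sector_iff' h0 h1
  rw [this]
  exact isOpen_lt (by fun_prop) Complex.continuous_re

theorem add_mem_sector {z w : ℂ} (hz : z ∈ sector θ) (hw : w ∈ sector θ) : z + w ∈ sector θ := by
  rw [mem_sector_iff' h0 h1] at *
  have := mul_le_mul_of_nonneg_right (norm_add_le z w) (cos_nonneg_of_sector h0 h1)
  rw [Complex.add_re]
  linarith

theorem smul_mem_sector {z : ℂ} (hz : z ∈ sector θ) {r : ℝ} (hr : 0 < r) :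
    (r : ℂ) * z ∈ sector θ := by
  rw [mem_sector_iff' h0 h1] at *
  rw [norm_mul, Complex.norm_real, Real.norm_of_nonneg hr.le, Complex.re_ofReal_mul, mul_assoc]
  exact mul_lt_mul_of_pos_left hz hr

omit h1 in
theorem ofReal_mem_sector {r : ℝ} (hr : 0 < r) : (r : ℂ) ∈ sector θ := by
  refine ⟨by exact_mod_cast hr.ne', ?_⟩
  rwa [Complex.arg_ofReal_of_nonneg hr.le, abs_zero]

theorem convex_sector : Convex ℝ (sector θ) := by
  rw [convex_iff_forall_pos]
  intro z hz w hw a b ha hb _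
  have := add_mem_sector h0 h1 (smul_mem_sector h0 h1 hz ha) (smul_mem_sector h0 h1 hw hb)
  simpa using this

end Sector

/-! ### Parameter integrals of holomorphic functions -/

/-- For holomorphic integrands a uniform bound on the functions suffices: Cauchy's estimate turns it
into a local bound on the derivatives, which dominates the differentiated integral. -/
theorem differentiableOn_integral_of_bounded {α E : Type*} [MeasurableSpace α]
    [NormedAddCommGroup E] [NormedSpace ℂ E] [CompleteSpace E] {μ : Measure α} [IsFiniteMeasure μ]
    {U : Set ℂ} (hU : IsOpen U) {F : ℂ → α → E} {C : ℝ}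
    (hd : ∀ᵐ a ∂μ, DifferentiableOn ℂ (fun z => F z a) U)
    (hm : ∀ z ∈ U, AEStronglyMeasurable (F z) μ)
    (hb : ∀ᵐ a ∂μ, ∀ z ∈ U, ‖F z a‖ ≤ C) :
    DifferentiableOn ℂ (fun z => ∫ a, F z a ∂μ) U := by
  intro z hz
  obtain ⟨ρ, hρ, hball⟩ := Metric.isOpen_iff.1 hU z hz
  have hsub : ∀ w ∈ Metric.ball z (ρ / 2), Metric.closedBall w (ρ / 4) ⊆ U := fun w hw => by
    refine (Metric.closedBall_subset_ball' ?_).trans hball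
    have := Metric.mem_ball.1 hw
    linarith
  have hder : ∀ᵐ a ∂μ, ∀ w ∈ Metric.ball z (ρ / 2),
      HasDerivAt (fun z => F z a) (deriv (fun z => F z a) w) w := by
    filter_upwards [hd] with a ha w hw
    exact (ha.differentiableAt (hU.mem_nhds
      (hsub w hw (Metric.mem_closedBall_self (by positivity))))).hasDerivAt
  have hz2 : z ∈ Metric.ball z (ρ / 2) := Metric.mem_ball_self (by positivity)
  have hUn : U ∈ 𝓝 z := hU.mem_nhds hz
  refine (hasDerivAt_integral_of_dominated_loc_of_deriv_le (𝕜 := ℂ)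
    (F' := fun w a => deriv (fun z => F z a) w) (bound := fun _ => C / (ρ / 4))
    (Metric.ball_mem_nhds z (half_pos hρ)) ?_ ?_ ?_ ?_ (integrable_const _)
    hder).2.differentiableAt.differentiableWithinAt
  · filter_upwards [hUn] with w hw using hm w hw
  · exact Integrable.of_bound (hm z hz) C (hb.mono fun a ha => ha z hz)
  -- The derivative is measurable in the parameter as a pointwise limit of difference quotients; the
  -- steps (ρ/4)/(n+1) keep z + h n in the ball of radius ρ inside U.
  · set h : ℕ → ℂ := fun n => (ρ / 2 / 2 : ℝ) * (1 / ((n : ℝ) + 1) : ℝ) with hh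
    have hpos : ∀ n : ℕ, (0 : ℝ) < 1 / ((n : ℝ) + 1) := fun n => by positivity
    have hne : ∀ n, h n ≠ 0 := fun n => by
      rw [hh]
      exact mul_ne_zero (by exact_mod_cast (by positivity : ρ / 2 / 2 ≠ 0))
        (by exact_mod_cast (hpos n).ne')
    have hlim : Tendsto h atTop (𝓝 0) := by
      have := (tendsto_one_div_add_atTop_nhds_zero_nat (𝕜 := ℝ))
      have h2 := ((Complex.continuous_ofReal.tendsto 0).comp this).const_mul ((ρ / 2 / 2 : ℝ) : ℂ)
      simpa [hh] using h2
    have hlim' : Tendsto h atTop (𝓝[≠] 0) :=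
      tendsto_nhdsWithin_iff.2 ⟨hlim, Eventually.of_forall hne⟩
    refine aestronglyMeasurable_of_tendsto_ae atTop
      (f := fun n a => (h n)⁻¹ • (F (z + h n) a - F z a)) (fun n => ?_) ?_
    · refine AEStronglyMeasurable.const_smul (AEStronglyMeasurable.sub (hm _ (hball ?_)) (hm z hz)) _
      rw [Metric.mem_ball, dist_eq_norm, add_sub_cancel_left, hh, norm_mul, Complex.norm_real,
        Complex.norm_real, Real.norm_of_nonneg (by positivity), Real.norm_of_nonneg (hpos n).le]
      have : 1 / ((n : ℝ) + 1) ≤ 1 := by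
        rw [div_le_one (by positivity)]
        linarith [(Nat.cast_nonneg n : (0 : ℝ) ≤ n)]
      nlinarith
    · filter_upwards [hder] with a ha
      exact (hasDerivAt_iff_tendsto_slope_zero.1 (ha z hz2)).comp hlim'
  -- Cauchy's estimate on the circle of radius ρ/4 about w, which lies in U because w is within ρ/2
  -- of z.
  · filter_upwards [hd, hb] with a ha hba w hw
    refine Complex.norm_deriv_le_of_forall_mem_sphere_norm_le (by positivity) ?_ fun x hx =>
      hba x (hsub w hw (Metric.sphere_subset_closedBall hx))
    refine DifferentiableOn.diffContOnCl ?_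
    rw [closure_ball w (by positivity)]
    exact ha.mono (hsub w hw)

theorem setIntegral_Ioo_pow (n : ℕ) : ∫ r in Set.Ioo (0 : ℝ) 1, r ^ n = 1 / ((n : ℝ) + 1) := by
  rw [← integral_Ioc_eq_integral_Ioo, ← intervalIntegral.integral_of_le zero_le_one, integral_pow]
  simp

/-! ### Holomorphic semigroups -/

section Semigroups

variable {Y : Type*} [NormedAddCommGroup Y] [NormedSpace ℂ Y]

/-- `T` is a holomorphic semigroup on the sector of half-angle `θ`, bounded by `M`. -/
structure IsBoundedHolomorphicSemigroup (θ M : ℝ) (T : ℂ → Y →L[ℂ] Y) : Prop where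
  angle_pos : 0 < θ
  angle_le : θ ≤ Real.pi / 2
  differentiableOn : DifferentiableOn ℂ T (sector θ)
  add : ∀ z ∈ sector θ, ∀ w ∈ sector θ, T (z + w) = T z ∘L T w
  tendsto : ∀ y, Tendsto (fun z => T z y) (𝓝[sector θ] 0) (𝓝 y)
  norm_le : ∀ z ∈ sector θ, ‖T z‖ ≤ M

/-- The terms of the Dyson–Phillips series. -/
noncomputable def dysonTerm (T : ℂ → Y →L[ℂ] Y) (P : Y →L[ℂ] Y) : ℕ → ℂ → Y →L[ℂ] Y
  | 0, z => T z
  | n + 1, z => ∫ r in Set.Ioo (0 : ℝ) 1,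
      z • (T (((1 - r : ℝ) : ℂ) * z) ∘L P ∘L dysonTerm T P n ((r : ℂ) * z))

/-- The sum of the Dyson–Phillips series. -/
noncomputable def dysonSeries (T : ℂ → Y →L[ℂ] Y) (P : Y →L[ℂ] Y) (z : ℂ) : Y →L[ℂ] Y :=
  ∑' n, dysonTerm T P n z

variable {θ M : ℝ} {T : ℂ → Y →L[ℂ] Y} (hT : IsBoundedHolomorphicSemigroup θ M T)
include hT

theorem IsBoundedHolomorphicSemigroup.bound_nonneg : 0 ≤ M :=
  (norm_nonneg _).trans (hT.norm_le _ (ofReal_mem_sector hT.angle_pos one_pos))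

theorem IsBoundedHolomorphicSemigroup.smul_mem {z : ℂ} (hz : z ∈ sector θ) {r : ℝ} (hr : 0 < r) :
    (r : ℂ) * z ∈ sector θ :=
  smul_mem_sector hT.angle_pos hT.angle_le hz hr

theorem IsBoundedHolomorphicSemigroup.one_sub_smul_mem {z : ℂ} (hz : z ∈ sector θ) {r : ℝ}
    (hr : r ∈ Set.Ioo (0 : ℝ) 1) : ((1 - r : ℝ) : ℂ) * z ∈ sector θ :=
  hT.smul_mem hz (sub_pos.2 hr.2)

theorem IsBoundedHolomorphicSemigroup.isOpen_sector : IsOpen (sector θ) :=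
  KGZ.isOpen_sector hT.angle_pos hT.angle_le

/-- The integrand of the Duhamel formula is continuous. -/
theorem IsBoundedHolomorphicSemigroup.continuousOn_duhamel (P : Y →L[ℂ] Y) {S : ℂ → Y →L[ℂ] Y}
    (hS : ContinuousOn S (sector θ)) {z : ℂ} (hz : z ∈ sector θ) :
    ContinuousOn (fun r : ℝ => z • (T (((1 - r : ℝ) : ℂ) * z) ∘L P ∘L S ((r : ℂ) * z)))
      (Set.Ioo 0 1) := by
  have h1 : ContinuousOn (fun r : ℝ => T (((1 - r : ℝ) : ℂ) * z)) (Set.Ioo 0 1) :=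
    hT.differentiableOn.continuousOn.comp (by fun_prop) fun r hr => hT.one_sub_smul_mem hz hr
  have h2 : ContinuousOn (fun r : ℝ => S ((r : ℂ) * z)) (Set.Ioo 0 1) :=
    hS.comp (by fun_prop) fun r hr => hT.smul_mem hz hr.1
  exact (h1.clm_comp (continuousOn_const.clm_comp h2)).const_smul z

theorem IsBoundedHolomorphicSemigroup.norm_duhamel_le (P A : Y →L[ℂ] Y) {z : ℂ}
    (hz : z ∈ sector θ) {r : ℝ} (hr : r ∈ Set.Ioo (0 : ℝ) 1) :
    ‖z • (T (((1 - r : ℝ) : ℂ) * z) ∘L P ∘L A)‖ ≤ ‖z‖ * (M * (‖P‖ * ‖A‖)) := by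
  rw [norm_smul]
  refine mul_le_mul_of_nonneg_left ((ContinuousLinearMap.opNorm_comp_le _ _).trans ?_)
    (norm_nonneg z)
  exact mul_le_mul (hT.norm_le _ (hT.one_sub_smul_mem hz hr))
    (ContinuousLinearMap.opNorm_comp_le _ _) (norm_nonneg _) hT.bound_nonneg

variable [CompleteSpace Y] (P : Y →L[ℂ] Y)

/-- The recursion is the convolution ∫₀^z T(z - w) P Tₙ(w) dw along the segment w = rz, so that all
times stay in the sector and the interval of integration is fixed. The factorial comes from ∫₀¹ rⁿ
dr = 1/(n+1). Holomorphy and bound are proved together, as the bound dominates the next integral. -/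
theorem dysonTerm_spec (n : ℕ) : DifferentiableOn ℂ (dysonTerm T P n) (sector θ) ∧
    ∀ z ∈ sector θ, ‖dysonTerm T P n z‖ ≤ M * ((M * ‖P‖ * ‖z‖) ^ n / n.factorial) := by
  have hM := hT.bound_nonneg
  induction n with
  | zero => exact ⟨hT.differentiableOn, fun z hz => by simpa [dysonTerm] using hT.norm_le z hz⟩
  | succ n ih =>
    obtain ⟨ihd, ihb⟩ := ih
    have hbound : ∀ r ∈ Set.Ioo (0 : ℝ) 1, ∀ z ∈ sector θ,
        ‖z • (T (((1 - r : ℝ) : ℂ) * z) ∘L P ∘L dysonTerm T P n ((r : ℂ) * z))‖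
          ≤ M * ((M * ‖P‖ * ‖z‖) ^ (n + 1) / n.factorial) * r ^ n := fun r hr z hz => by
      refine (hT.norm_duhamel_le P _ hz hr).trans ?_
      have h := ihb _ (hT.smul_mem hz hr.1)
      rw [norm_mul, Complex.norm_real, Real.norm_of_nonneg hr.1.le] at h
      calc ‖z‖ * (M * (‖P‖ * ‖dysonTerm T P n ((r : ℂ) * z)‖))
          ≤ ‖z‖ * (M * (‖P‖ * (M * ((M * ‖P‖ * (r * ‖z‖)) ^ n / n.factorial)))) := by gcongr
        _ = _ := by rw [mul_pow, mul_pow, mul_pow, pow_succ]; ring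
    refine ⟨fun z hz => ?_, fun z hz => ?_⟩
    -- The integrand is bounded uniformly in z only on bounded subsets of the sector, hence the
    -- intersection with a ball.
    · set U := sector θ ∩ Metric.ball 0 (‖z‖ + 1) with hUdef
      have hU : IsOpen U := hT.isOpen_sector.inter Metric.isOpen_ball
      have hzU : z ∈ U := ⟨hz, by simp⟩
      have hd : DifferentiableOn ℂ (dysonTerm T P (n + 1)) U := by
        refine differentiableOn_integral_of_bounded
          (C := M * ((M * ‖P‖ * (‖z‖ + 1)) ^ (n + 1) / n.factorial)) hU ?_ ?_ ?_
        · filter_upwards [ae_restrict_mem measurableSet_Ioo] with r hr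
          refine DifferentiableOn.mono ?_ Set.inter_subset_left
          have h1 : DifferentiableOn ℂ (fun z : ℂ => T (((1 - r : ℝ) : ℂ) * z)) (sector θ) :=
            hT.differentiableOn.comp (differentiableOn_id.const_mul _)
              fun w hw => hT.one_sub_smul_mem hw hr
          have h2 : DifferentiableOn ℂ (fun z : ℂ => dysonTerm T P n ((r : ℂ) * z)) (sector θ) :=
            ihd.comp (differentiableOn_id.const_mul _) fun w hw => hT.smul_mem hw hr.1
          exact differentiableOn_id.smul (h1.clm_comp ((differentiableOn_const P).clm_comp h2))
        · intro w hw
          exact (hT.continuousOn_duhamel P ihd.continuousOn hw.1).aestronglyMeasurable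
            measurableSet_Ioo
        · filter_upwards [ae_restrict_mem measurableSet_Ioo] with r hr w hw
          refine (hbound r hr w hw.1).trans ?_
          have hw2 : ‖w‖ ≤ ‖z‖ + 1 := (mem_ball_zero_iff.1 hw.2).le
          calc M * ((M * ‖P‖ * ‖w‖) ^ (n + 1) / n.factorial) * r ^ n
              ≤ M * ((M * ‖P‖ * (‖z‖ + 1)) ^ (n + 1) / n.factorial) * 1 := by
                have h1 : r ^ n ≤ 1 := pow_le_one₀ hr.1.le hr.2.le
                have h2 : 0 ≤ r ^ n := pow_nonneg hr.1.le n
                gcongr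
            _ = _ := mul_one _
      exact (hd.differentiableAt (hU.mem_nhds hzU)).differentiableWithinAt
    · have hint : Integrable (fun r : ℝ => M * ((M * ‖P‖ * ‖z‖) ^ (n + 1) / n.factorial) * r ^ n)
          (volume.restrict (Set.Ioo 0 1)) :=
        ((by fun_prop : Continuous fun r : ℝ => M * ((M * ‖P‖ * ‖z‖) ^ (n + 1) / n.factorial)
          * r ^ n).integrableOn_Icc (a := 0) (b := 1)).mono_set Set.Ioo_subset_Icc_self
      refine (norm_integral_le_of_norm_le hint ?_).trans ?_
      · filter_upwards [ae_restrict_mem measurableSet_Ioo] with r hr using hbound r hr z hz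
      · rw [integral_const_mul, setIntegral_Ioo_pow, Nat.factorial_succ]
        push_cast
        apply le_of_eq
        field_simp

end Semigroups

/-! ### The sum of the Dyson–Phillips series -/

/-- An iterated form of Grönwall's inequality. -/
theorem le_of_le_add_mul_setIntegral {φ : ℝ → ℝ} {τ B C δ : ℝ} (hC : 0 ≤ C)
    (hm : ∀ s ∈ Set.Ioc 0 τ, AEStronglyMeasurable (fun r => φ (r * s))
      (volume.restrict (Set.Ioo 0 1)))
    (h0 : ∀ s ∈ Set.Ioc 0 τ, 0 ≤ φ s) (hB : ∀ s ∈ Set.Ioc 0 τ, φ s ≤ B)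
    (h : ∀ s ∈ Set.Ioc 0 τ, φ s ≤ δ + C * s * ∫ r in Set.Ioo (0 : ℝ) 1, φ (r * s)) :
    ∀ s ∈ Set.Ioc 0 τ, φ s ≤ δ * Real.exp (C * s) := by
  -- Substituting the inequality into itself n times, starting from the crude bound B, leaves a
  -- partial sum of the exponential series and a remainder that tends to 0.
  have key : ∀ n : ℕ, ∀ s ∈ Set.Ioc 0 τ,
      φ s ≤ δ * ∑ k ∈ Finset.range n, (C * s) ^ k / k.factorial
        + B * ((C * s) ^ n / n.factorial) := by
    intro n
    induction n with
    | zero => intro s hs; simpa using hB s hs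
    | succ n ih =>
      intro s hs
      have hmem : ∀ r ∈ Set.Ioo (0 : ℝ) 1, r * s ∈ Set.Ioc 0 τ := fun r hr =>
        ⟨mul_pos hr.1 hs.1, (mul_le_of_le_one_left hs.1.le hr.2.le).trans hs.2⟩
      have hi1 : ∀ (k : ℕ) (c : ℝ), Integrable (fun r : ℝ => c * r ^ k)
          (volume.restrict (Set.Ioo 0 1)) := fun k c =>
        ((by fun_prop : Continuous fun r : ℝ => c * r ^ k).integrableOn_Icc
          (a := 0) (b := 1)).mono_set Set.Ioo_subset_Icc_self
      have hint : Integrable (fun r => φ (r * s)) (volume.restrict (Set.Ioo 0 1)) := by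
        refine Integrable.of_bound (hm s hs) B ?_
        filter_upwards [ae_restrict_mem measurableSet_Ioo] with r hr
        rw [Real.norm_of_nonneg (h0 _ (hmem r hr))]
        exact hB _ (hmem r hr)
      have hle : ∫ r in Set.Ioo (0 : ℝ) 1, φ (r * s) ≤ ∫ r in Set.Ioo (0 : ℝ) 1,
          (∑ k ∈ Finset.range n, δ * ((C * s) ^ k / k.factorial) * r ^ k
            + B * ((C * s) ^ n / n.factorial) * r ^ n) := by
        refine integral_mono_ae hint ((integrable_finsetSum _ fun k _ => hi1 k _).add (hi1 n _)) ?_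
        filter_upwards [ae_restrict_mem measurableSet_Ioo] with r hr
        refine (ih _ (hmem r hr)).trans (le_of_eq ?_)
        rw [Finset.mul_sum]
        congr 1
        · refine Finset.sum_congr rfl fun k _ => ?_
          rw [show C * (r * s) = r * (C * s) by ring, mul_pow]; ring
        · rw [show C * (r * s) = r * (C * s) by ring, mul_pow]; ring
      rw [integral_add (integrable_finsetSum _ fun k _ => hi1 k _) (hi1 n _),
        integral_finsetSum _ fun k _ => hi1 k _] at hle
      simp only [integral_const_mul, setIntegral_Ioo_pow] at hle
      refine (h s hs).trans ?_
      have hCs : 0 ≤ C * s := mul_nonneg hC hs.1.le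
      refine (add_le_add_right (mul_le_mul_of_nonneg_left hle hCs) δ).trans (le_of_eq ?_)
      rw [Finset.sum_range_succ', mul_add, mul_add, Finset.mul_sum, Finset.mul_sum, ← add_assoc,
        add_comm δ]
      simp only [pow_zero, Nat.factorial_zero, Nat.cast_one, div_one, mul_one]
      congr 1
      · congr 1
        refine Finset.sum_congr rfl fun k _ => ?_
        rw [Nat.factorial_succ]; push_cast; field_simp; ring
      · rw [Nat.factorial_succ]; push_cast; field_simp; ring
  intro s hs
  have h1 : Tendsto (fun n => ∑ k ∈ Finset.range n, (C * s) ^ k / k.factorial) atTop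
      (𝓝 (Real.exp (C * s))) := by
    have := (NormedSpace.expSeries_div_hasSum_exp (C * s)).tendsto_sum_nat
    rwa [← Real.exp_eq_exp_ℝ] at this
  have h2 : Tendsto (fun n : ℕ => (C * s) ^ n / n.factorial) atTop (𝓝 0) :=
    FloorSemiring.tendsto_pow_div_factorial_atTop _
  have h3 := (h1.const_mul δ).add (h2.const_mul B)
  rw [mul_zero, add_zero] at h3
  exact ge_of_tendsto' h3 fun n => key n s hs

section Semigroups

variable {Y : Type*} [NormedAddCommGroup Y] [NormedSpace ℂ Y] [CompleteSpace Y]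
  {θ M : ℝ} {T : ℂ → Y →L[ℂ] Y} (hT : IsBoundedHolomorphicSemigroup θ M T) (P : Y →L[ℂ] Y)
include hT

theorem summable_norm_dysonTerm {z : ℂ} (hz : z ∈ sector θ) :
    Summable fun n => ‖dysonTerm T P n z‖ :=
  Summable.of_nonneg_of_le (fun _ => norm_nonneg _) (fun n => (dysonTerm_spec hT P n).2 z hz)
    ((Real.summable_pow_div_factorial _).mul_left M)

theorem norm_dysonSeries_le {z : ℂ} (hz : z ∈ sector θ) :
    ‖dysonSeries T P z‖ ≤ M * Real.exp (M * ‖P‖ * ‖z‖) := by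
  refine tsum_of_norm_bounded ?_ fun n => (dysonTerm_spec hT P n).2 z hz
  rw [Real.exp_eq_exp_ℝ]
  exact (NormedSpace.expSeries_div_hasSum_exp _).mul_left M

/-- The factorial bounds make the series converge uniformly on bounded subsets of the sector. -/
theorem differentiableOn_dysonSeries : DifferentiableOn ℂ (dysonSeries T P) (sector θ) := by
  intro z hz
  set U := sector θ ∩ Metric.ball 0 (‖z‖ + 1) with hUdef
  have hU : IsOpen U := hT.isOpen_sector.inter Metric.isOpen_ball
  have hM := hT.bound_nonneg
  refine (DifferentiableOn.differentiableAt (s := U) ?_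
    (hU.mem_nhds ⟨hz, by simp⟩)).differentiableWithinAt
  refine Complex.differentiableOn_tsum_of_summable_norm
    ((Real.summable_pow_div_factorial (M * ‖P‖ * (‖z‖ + 1))).mul_left M)
    (fun n => (dysonTerm_spec hT P n).1.mono Set.inter_subset_left) hU fun n w hw => ?_
  refine ((dysonTerm_spec hT P n).2 w hw.1).trans ?_
  have hw2 : ‖w‖ ≤ ‖z‖ + 1 := (mem_ball_zero_iff.1 hw.2).le
  gcongr

/-- The Duhamel formula. -/
theorem dysonSeries_eq {z : ℂ} (hz : z ∈ sector θ) :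
    dysonSeries T P z = T z + ∫ r in Set.Ioo (0 : ℝ) 1,
      z • (T (((1 - r : ℝ) : ℂ) * z) ∘L P ∘L dysonSeries T P ((r : ℂ) * z)) := by
  have hM := hT.bound_nonneg
  have hs : Summable fun n => dysonTerm T P n z := (summable_norm_dysonTerm hT P hz).of_norm
  rw [dysonSeries, hs.tsum_eq_zero_add]
  refine congrArg₂ _ rfl (HasSum.tsum_eq ?_)
  refine hasSum_integral_of_dominated_convergence
    (fun n _ => ‖z‖ * (M * (‖P‖ * (M * ((M * ‖P‖ * ‖z‖) ^ n / n.factorial))))) (fun n => ?_)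
    (fun n => ?_) ?_ (integrable_const _) ?_
  · exact (hT.continuousOn_duhamel P (dysonTerm_spec hT P n).1.continuousOn hz).aestronglyMeasurable
      measurableSet_Ioo
  · filter_upwards [ae_restrict_mem measurableSet_Ioo] with r hr
    refine (hT.norm_duhamel_le P _ hz hr).trans ?_
    have h := (dysonTerm_spec hT P n).2 _ (hT.smul_mem hz hr.1)
    rw [norm_mul, Complex.norm_real, Real.norm_of_nonneg hr.1.le] at h
    have h2 : M * ((M * ‖P‖ * (r * ‖z‖)) ^ n / n.factorial)
        ≤ M * ((M * ‖P‖ * ‖z‖) ^ n / n.factorial) := by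
      have h0 := hr.1
      gcongr
      exact mul_le_of_le_one_left (norm_nonneg z) hr.2.le
    have h3 := h.trans h2
    gcongr
  · exact Eventually.of_forall fun r => (((Real.summable_pow_div_factorial _).mul_left M).mul_left
      ‖P‖).mul_left M |>.mul_left ‖z‖
  · filter_upwards [ae_restrict_mem measurableSet_Ioo] with r hr
    have h : HasSum (fun n => dysonTerm T P n ((r : ℂ) * z)) (dysonSeries T P ((r : ℂ) * z)) :=
      (summable_norm_dysonTerm hT P (hT.smul_mem hz hr.1)).of_norm.hasSum
    let L : (Y →L[ℂ] Y) →L[ℂ] (Y →L[ℂ] Y) :=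
      z • (ContinuousLinearMap.compL ℂ Y Y Y (T (((1 - r : ℝ) : ℂ) * z) ∘L P))
    exact h.mapL L

/-- Duhamel's formula shows that the perturbation costs O(‖z‖) in operator norm, so the strong limit
at 0 is inherited from T. -/
theorem norm_dysonSeries_sub_le {z : ℂ} (hz : z ∈ sector θ) :
    ‖dysonSeries T P z - T z‖ ≤ ‖z‖ * (M * (‖P‖ * (M * Real.exp (M * ‖P‖ * ‖z‖)))) := by
  have hM := hT.bound_nonneg
  rw [dysonSeries_eq hT P hz, add_sub_cancel_left]
  refine (norm_integral_le_of_norm_le_const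
    (C := ‖z‖ * (M * (‖P‖ * (M * Real.exp (M * ‖P‖ * ‖z‖))))) ?_).trans ?_
  · filter_upwards [ae_restrict_mem measurableSet_Ioo] with r hr
    refine (hT.norm_duhamel_le P _ hz hr).trans ?_
    have h := norm_dysonSeries_le hT P (hT.smul_mem hz hr.1)
    rw [norm_mul, Complex.norm_real, Real.norm_of_nonneg hr.1.le] at h
    have h2 : M * Real.exp (M * ‖P‖ * (r * ‖z‖)) ≤ M * Real.exp (M * ‖P‖ * ‖z‖) := by
      have h0 := hr.1
      gcongr
      exact mul_le_of_le_one_left (norm_nonneg z) hr.2.le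
    have h3 := h.trans h2
    gcongr
  · simp

end Semigroups

/-! ### The perturbed semigroup -/

theorem smul_setIntegral_Ioo_comp_mul {E : Type*} [NormedAddCommGroup E] [NormedSpace ℝ E]
    (f : ℝ → E) (s : ℝ) : s • ∫ r in Set.Ioo (0 : ℝ) 1, f (r * s) = ∫ x in 0..s, f x := by
  rw [← integral_Ioc_eq_integral_Ioo, ← intervalIntegral.integral_of_le zero_le_one,
    intervalIntegral.smul_integral_comp_mul_right, zero_mul, one_mul]

theorem intervalIntegrable_of_continuousOn_Ioo_of_norm_le {E : Type*} [NormedAddCommGroup E]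
    {f : ℝ → E} {a b C : ℝ} (hab : a ≤ b) (hf : ContinuousOn f (Set.Ioo a b))
    (hC : ∀ x ∈ Set.Ioo a b, ‖f x‖ ≤ C) : IntervalIntegrable f volume a b := by
  rw [intervalIntegrable_iff_integrableOn_Ioo_of_le hab]
  exact IntegrableOn.of_bound (by simp) (hf.aestronglyMeasurable measurableSet_Ioo) C
    ((ae_restrict_iff' measurableSet_Ioo).2 (Eventually.of_forall hC))

/-- The identity theorem: the sector is connected and the positive half-line accumulates at 1. -/
theorem eqOn_sector_of_eqOn_ofReal {E : Type*} [NormedAddCommGroup E] [NormedSpace ℂ E]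
    [CompleteSpace E] {θ : ℝ} (h0 : 0 < θ) (h1 : θ ≤ Real.pi / 2) {f g : ℂ → E}
    (hf : DifferentiableOn ℂ f (sector θ)) (hg : DifferentiableOn ℂ g (sector θ))
    (h : ∀ s : ℝ, 0 < s → f s = g s) : Set.EqOn f g (sector θ) := by
  have hU := isOpen_sector h0 h1
  refine (hf.analyticOnNhd hU).eqOn_of_preconnected_of_frequently_eq (hg.analyticOnNhd hU)
    (convex_sector h0 h1).isPreconnected (ofReal_mem_sector h0 one_pos) ?_
  have ht : Tendsto (fun s : ℝ => (s : ℂ)) (𝓝[>] 1) (𝓝[≠] ((1 : ℝ) : ℂ)) := by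
    refine tendsto_nhdsWithin_iff.2 ⟨(Complex.continuous_ofReal.tendsto 1).mono_left
      nhdsWithin_le_nhds, ?_⟩
    filter_upwards [self_mem_nhdsWithin] with s hs
    have hs' : (1 : ℝ) < s := hs
    simpa using hs'.ne'
  refine ht.frequently (Eventually.frequently ?_)
  filter_upwards [self_mem_nhdsWithin] with s hs
  exact h s (one_pos.trans hs)

section Semigroups

variable {Y : Type*} [NormedAddCommGroup Y] [NormedSpace ℂ Y] [CompleteSpace Y]
  {θ M : ℝ} {T : ℂ → Y →L[ℂ] Y} (hT : IsBoundedHolomorphicSemigroup θ M T) (P : Y →L[ℂ] Y)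
include hT

omit hT [CompleteSpace Y] in
theorem setIntegral_duhamel_eq (S : ℂ → Y →L[ℂ] Y) (s : ℝ) :
    ∫ r in Set.Ioo (0 : ℝ) 1, (s : ℂ) • (T (((1 - r : ℝ) : ℂ) * s) ∘L P ∘L S ((r : ℂ) * s))
      = ∫ x in 0..s, T ((s - x : ℝ) : ℂ) ∘L P ∘L S x := by
  rw [← smul_setIntegral_Ioo_comp_mul, ← integral_smul]
  refine setIntegral_congr_fun measurableSet_Ioo fun r _ => ?_
  simp only [Complex.coe_smul]
  push_cast
  rw [sub_mul, one_mul]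

omit [CompleteSpace Y] in
theorem intervalIntegrable_duhamel {S : ℂ → Y →L[ℂ] Y} {a b c C : ℝ} (hab : a ≤ b) (hbc : b ≤ c)
    (hS : ContinuousOn (fun x : ℝ => S x) (Set.Ioo a b)) (hC : ∀ x ∈ Set.Ioo a b, ‖S x‖ ≤ C) :
    IntervalIntegrable (fun x : ℝ => T ((c - x : ℝ) : ℂ) ∘L P ∘L S x) volume a b := by
  have hmem : ∀ x ∈ Set.Ioo a b, ((c - x : ℝ) : ℂ) ∈ sector θ := fun x hx =>
    ofReal_mem_sector hT.angle_pos (sub_pos.2 (hx.2.trans_le hbc))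
  refine intervalIntegrable_of_continuousOn_Ioo_of_norm_le (C := M * (‖P‖ * C)) hab ?_ ?_
  · have h1 : ContinuousOn (fun x : ℝ => T ((c - x : ℝ) : ℂ)) (Set.Ioo a b) :=
      hT.differentiableOn.continuousOn.comp (by fun_prop) hmem
    exact h1.clm_comp (continuousOn_const.clm_comp hS)
  · intro x hx
    have hM := hT.bound_nonneg
    refine (ContinuousLinearMap.opNorm_comp_le _ _).trans ?_
    refine mul_le_mul (hT.norm_le _ (hmem x hx)) ?_ (norm_nonneg _) hM
    exact (ContinuousLinearMap.opNorm_comp_le _ _).trans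
      (mul_le_mul_of_nonneg_left (hC x hx) (norm_nonneg _))

/-- The defect F(x) = S(x + t) - S(x)S(t) solves the homogeneous Volterra equation F(x) = ∫₀ˣ T(x -
y) P F(y) dy, and Grönwall's inequality with zero initial term forces F = 0. -/
theorem dysonSeries_add_ofReal {s t : ℝ} (hs : 0 < s) (ht : 0 < t) :
    dysonSeries T P ((s : ℂ) + t) = dysonSeries T P s ∘L dysonSeries T P t := by
  set S := dysonSeries T P with hSdef
  have hM := hT.bound_nonneg
  have mem : ∀ {x : ℝ}, 0 < x → (x : ℂ) ∈ sector θ := fun hx => ofReal_mem_sector hT.angle_pos hx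
  have hSc : ContinuousOn (fun x : ℝ => S x) (Set.Ioi 0) :=
    (differentiableOn_dysonSeries hT P).continuousOn.comp (by fun_prop) fun x hx => mem hx
  have hSb : ∀ {x τ : ℝ}, 0 < x → x ≤ τ → ‖S x‖ ≤ M * Real.exp (M * ‖P‖ * τ) := fun hx hxτ => by
    refine (norm_dysonSeries_le hT P (mem hx)).trans ?_
    rw [Complex.norm_real, Real.norm_of_nonneg hx.le]
    gcongr
  have duh : ∀ x : ℝ, 0 < x → S x = T x + ∫ y in 0..x, T ((x - y : ℝ) : ℂ) ∘L P ∘L S y :=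
    fun x hx => by
      rw [← setIntegral_duhamel_eq P S x]
      exact dysonSeries_eq hT P (mem hx)
  let F : ℂ → Y →L[ℂ] Y := fun x => S (x + t) - S x ∘L S t
  have hSt : ContinuousOn (fun x : ℝ => S (x + t)) (Set.Ioi 0) := by
    have : ContinuousOn (fun x : ℝ => S ((x + t : ℝ) : ℂ)) (Set.Ioi 0) :=
      hSc.comp (f := fun x : ℝ => x + t) (by fun_prop) fun x hx => add_pos hx ht
    simpa using this
  have hFc : ContinuousOn (fun x : ℝ => F x) (Set.Ioi 0) :=
    hSt.sub (hSc.clm_comp continuousOn_const)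
  have volterra : ∀ x : ℝ, 0 < x → F x = ∫ y in 0..x, T ((x - y : ℝ) : ℂ) ∘L P ∘L F y := by
    intro x hx
    have i1 : IntervalIntegrable (fun y : ℝ => T ((x + t - y : ℝ) : ℂ) ∘L P ∘L S y) volume 0 t :=
      intervalIntegrable_duhamel hT P ht.le (by linarith) (hSc.mono fun y hy => hy.1)
        fun y hy => hSb hy.1 hy.2.le
    have i2 : IntervalIntegrable (fun y : ℝ => T ((x + t - y : ℝ) : ℂ) ∘L P ∘L S y) volume
        t (x + t) :=
      intervalIntegrable_duhamel hT P (by linarith) le_rfl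
        (hSc.mono fun y hy => ht.trans hy.1) fun y hy => hSb (ht.trans hy.1) hy.2.le
    have i3 : IntervalIntegrable (fun y : ℝ => T ((t - y : ℝ) : ℂ) ∘L P ∘L S y) volume 0 t :=
      intervalIntegrable_duhamel hT P ht.le le_rfl (hSc.mono fun y hy => hy.1)
        fun y hy => hSb hy.1 hy.2.le
    have i4 : IntervalIntegrable (fun y : ℝ => T ((x - y : ℝ) : ℂ) ∘L P ∘L S y) volume 0 x :=
      intervalIntegrable_duhamel hT P hx.le le_rfl (hSc.mono fun y hy => hy.1)
        fun y hy => hSb hy.1 hy.2.le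
    have i5 : IntervalIntegrable (fun y : ℝ => T ((x - y : ℝ) : ℂ) ∘L P ∘L S (y + t)) volume 0 x :=
      intervalIntegrable_duhamel hT P (S := fun y => S (y + t))
        (C := M * Real.exp (M * ‖P‖ * (x + t))) hx.le le_rfl (hSt.mono fun y hy => hy.1)
        fun y hy => by
          have := hSb (x := y + t) (τ := x + t) (add_pos hy.1 ht) (by linarith [hy.2])
          simpa using this
    -- On [0, t] the semigroup law lets T(x) be pulled out of the Duhamel integral for S(x + t); on
    -- [t, x + t] a shift by t turns the rest into the integral for y ↦ S(y + t).
    have e1 : ∫ y in 0..t, T ((x + t - y : ℝ) : ℂ) ∘L P ∘L S y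
        = T x ∘L ∫ y in 0..t, T ((t - y : ℝ) : ℂ) ∘L P ∘L S y := by
      have := ContinuousLinearMap.intervalIntegral_comp_comm
        (ContinuousLinearMap.compL ℂ Y Y Y (T x)) i3
      refine Eq.trans ?_ this
      refine intervalIntegral.integral_congr_Ioo_of_le ht.le fun y hy => ?_
      have h := hT.add _ (mem hx) _ (mem (sub_pos.2 hy.2))
      simp only [ContinuousLinearMap.compL_apply]
      have hxy : T ((x + t - y : ℝ) : ℂ) = T x ∘L T ((t - y : ℝ) : ℂ) := by
        rw [← h]
        congr 1
        push_cast
        ring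
      rw [hxy]
      rfl
    have e2 : ∫ y in t..(x + t), T ((x + t - y : ℝ) : ℂ) ∘L P ∘L S y
        = ∫ y in 0..x, T ((x - y : ℝ) : ℂ) ∘L P ∘L S (y + t) := by
      have := intervalIntegral.integral_comp_add_right (a := 0) (b := x)
        (fun y : ℝ => T ((x + t - y : ℝ) : ℂ) ∘L P ∘L S y) t
      rw [zero_add] at this
      rw [← this]
      refine intervalIntegral.integral_congr fun y _ => ?_
      rw [add_sub_add_right_eq_sub, Complex.ofReal_add]
    have e3 : (∫ y in 0..x, T ((x - y : ℝ) : ℂ) ∘L P ∘L S y) ∘L S t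
        = ∫ y in 0..x, T ((x - y : ℝ) : ℂ) ∘L P ∘L (S y ∘L S t) := by
      have := ContinuousLinearMap.intervalIntegral_comp_comm
        ((ContinuousLinearMap.compL ℂ Y Y Y).flip (S t)) i4
      exact this.symm
    have i6 : IntervalIntegrable (fun y : ℝ => T ((x - y : ℝ) : ℂ) ∘L P ∘L (S y ∘L S t))
        volume 0 x :=
      intervalIntegrable_duhamel hT P (S := fun y => S y ∘L S t)
        (C := M * Real.exp (M * ‖P‖ * x) * ‖S t‖) hx.le le_rfl
        ((hSc.clm_comp continuousOn_const).mono fun y hy => hy.1) fun y hy =>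
          (ContinuousLinearMap.opNorm_comp_le _ _).trans
            (mul_le_mul_of_nonneg_right (hSb hy.1 hy.2.le) (norm_nonneg _))
    have h1 : S ((x : ℂ) + t) = T x ∘L S t
        + ∫ y in 0..x, T ((x - y : ℝ) : ℂ) ∘L P ∘L S (y + t) := by
      have h := duh (x + t) (add_pos hx ht)
      rw [← intervalIntegral.integral_add_adjacent_intervals i1 i2, e1, e2] at h
      rw [Complex.ofReal_add] at h
      rw [h, hT.add _ (mem hx) _ (mem ht), ← add_assoc, ← ContinuousLinearMap.comp_add, ← duh t ht]
    show S ((x : ℂ) + t) - S x ∘L S t = _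
    rw [h1, duh x hx, ContinuousLinearMap.add_comp, e3, add_sub_add_left_eq_sub,
      ← intervalIntegral.integral_sub i5 i6]
    refine intervalIntegral.integral_congr fun y _ => ?_
    simp only [F, ContinuousLinearMap.comp_sub]
  have hFb : ∀ x ∈ Set.Ioc 0 s, ‖F x‖ ≤ M * Real.exp (M * ‖P‖ * (s + t))
      + M * Real.exp (M * ‖P‖ * s) * ‖S t‖ := fun x hx => by
    refine (norm_sub_le _ _).trans (add_le_add ?_ ?_)
    · have := hSb (x := x + t) (τ := s + t) (add_pos hx.1 ht) (by linarith [hx.2])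
      simpa using this
    · exact (ContinuousLinearMap.opNorm_comp_le _ _).trans
        (mul_le_mul_of_nonneg_right (hSb hx.1 hx.2) (norm_nonneg _))
  have hF0 := le_of_le_add_mul_setIntegral (φ := fun x : ℝ => ‖F x‖) (τ := s) (δ := 0)
    (C := M * ‖P‖) (B := M * Real.exp (M * ‖P‖ * (s + t)) + M * Real.exp (M * ‖P‖ * s) * ‖S t‖)
    (by positivity)
    (fun x hx => by
      refine ContinuousOn.aestronglyMeasurable ?_ measurableSet_Ioo
      exact (hFc.comp (f := fun r : ℝ => r * x) (by fun_prop) fun r hr => mul_pos hr.1 hx.1).norm)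
    (fun x _ => norm_nonneg _) hFb
    (fun x hx => by
      have hi : IntervalIntegrable (fun y : ℝ => M * ‖P‖ * ‖F y‖) volume 0 x :=
        (intervalIntegrable_of_continuousOn_Ioo_of_norm_le hx.1.le
          (hFc.norm.mono fun y hy => hy.1) fun y hy => by
            rw [norm_norm]; exact hFb y ⟨hy.1, hy.2.le.trans hx.2⟩).const_mul _
      rw [zero_add, mul_assoc, ← smul_eq_mul (a := x), smul_setIntegral_Ioo_comp_mul
        (fun x : ℝ => ‖F x‖), ← intervalIntegral.integral_const_mul, volterra x hx.1]
      refine intervalIntegral.norm_integral_le_of_norm_le hx.1.le ?_ hi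
      rw [← ae_restrict_iff' measurableSet_Ioc, ← restrict_Ioo_eq_restrict_Ioc]
      filter_upwards [ae_restrict_mem measurableSet_Ioo] with y hy
      refine (ContinuousLinearMap.opNorm_comp_le _ _).trans ?_
      rw [mul_assoc]
      exact mul_le_mul (hT.norm_le _ (mem (sub_pos.2 hy.2)))
        (ContinuousLinearMap.opNorm_comp_le _ _) (norm_nonneg _) hM)
    s ⟨hs, le_rfl⟩
  rw [zero_mul] at hF0
  exact sub_eq_zero.1 (norm_le_zero_iff.1 hF0)

/-- The identity theorem extends the law from positive real times, one variable at a time. -/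
theorem dysonSeries_add {z w : ℂ} (hz : z ∈ sector θ) (hw : w ∈ sector θ) :
    dysonSeries T P (z + w) = dysonSeries T P z ∘L dysonSeries T P w := by
  set S := dysonSeries T P with hSdef
  have hd := differentiableOn_dysonSeries hT P
  have hadd : ∀ v ∈ sector θ, DifferentiableOn ℂ (fun z => S (z + v)) (sector θ) := fun v hv =>
    hd.comp (by fun_prop) fun z hz => add_mem_sector hT.angle_pos hT.angle_le hz hv
  have h1 : ∀ t : ℝ, 0 < t → ∀ z ∈ sector θ, S (z + t) = S z ∘L S t := fun t ht =>
    eqOn_sector_of_eqOn_ofReal hT.angle_pos hT.angle_le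
      (hadd t (ofReal_mem_sector hT.angle_pos ht))
      (hd.clm_comp (differentiableOn_const _)) fun s hs => dysonSeries_add_ofReal hT P hs ht
  rw [add_comm]
  refine eqOn_sector_of_eqOn_ofReal (f := fun w => S (w + z)) (g := fun w => S z ∘L S w)
    hT.angle_pos hT.angle_le (hadd z hz)
    ((differentiableOn_const _).clm_comp hd) (fun t ht => ?_) hw
  rw [add_comm]
  exact h1 t ht z hz

theorem tendsto_dysonSeries (y : Y) :
    Tendsto (fun z => dysonSeries T P z y) (𝓝[sector θ] 0) (𝓝 y) := by
  have h : Tendsto (fun z => (dysonSeries T P z - T z) y) (𝓝[sector θ] 0) (𝓝 0) := by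
    have hc : Continuous fun z : ℂ =>
        ‖z‖ * (M * (‖P‖ * (M * Real.exp (M * ‖P‖ * ‖z‖)))) * ‖y‖ := by fun_prop
    have h0 := (hc.tendsto 0).mono_left (nhdsWithin_le_nhds (s := sector θ))
    rw [norm_zero, zero_mul, zero_mul] at h0
    refine squeeze_zero_norm' ?_ h0
    filter_upwards [self_mem_nhdsWithin] with z hz
    exact (ContinuousLinearMap.le_opNorm _ _).trans
      (mul_le_mul_of_nonneg_right (norm_dysonSeries_sub_le hT P hz) (norm_nonneg _))
  have := h.add (hT.tendsto y)
  rw [zero_add] at this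
  simpa using this

/-- The quotient equals ∫₀¹ T((1 - r)s) P S(rs) y dr, whose integrand tends to P y by strong
continuity of both families. This is what adds P to the generator without changing the domain. -/
theorem tendsto_dysonSeries_sub (y : Y) :
    Tendsto (fun s : ℝ≥0 => ((s : ℂ)⁻¹) • (dysonSeries T P s y - T s y)) (𝓝[>] 0) (𝓝 (P y)) := by
  set S := dysonSeries T P with hSdef
  have hM := hT.bound_nonneg
  have mem : ∀ {x : ℝ}, 0 < x → (x : ℂ) ∈ sector θ := fun hx => ofReal_mem_sector hT.angle_pos hx
  have hlim : ∀ c : ℝ, 0 < c →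
      Tendsto (fun s : ℝ≥0 => (c : ℂ) * s) (𝓝[>] 0) (𝓝[sector θ] 0) := fun c hc => by
    refine tendsto_nhdsWithin_iff.2 ⟨?_, ?_⟩
    · have : Continuous fun s : ℝ≥0 => (c : ℂ) * s := by fun_prop
      simpa using (this.tendsto 0).mono_left nhdsWithin_le_nhds
    · filter_upwards [self_mem_nhdsWithin] with s hs
      exact hT.smul_mem (mem (NNReal.coe_pos.2 hs)) hc
  have hev : ∀ᶠ s : ℝ≥0 in 𝓝[>] 0, ((s : ℂ)⁻¹) • (S s y - T s y)
      = ∫ r in Set.Ioo (0 : ℝ) 1, T (((1 - r : ℝ) : ℂ) * s) (P (S ((r : ℂ) * s) y)) := by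
    filter_upwards [self_mem_nhdsWithin] with s hs
    have hs0 : (0 : ℝ) < s := NNReal.coe_pos.2 hs
    have hsc : (s : ℂ) ≠ 0 := by exact_mod_cast hs0.ne'
    have hint : Integrable (fun r : ℝ => T (((1 - r : ℝ) : ℂ) * s) ∘L P ∘L S ((r : ℂ) * s))
        (volume.restrict (Set.Ioo 0 1)) := by
      have hcont : ContinuousOn
          (fun r : ℝ => T (((1 - r : ℝ) : ℂ) * s) ∘L P ∘L S ((r : ℂ) * s)) (Set.Ioo 0 1) :=
        ((hT.continuousOn_duhamel P (differentiableOn_dysonSeries hT P).continuousOn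
          (mem hs0)).const_smul (s : ℂ)⁻¹).congr fun r _ => by
            simp only [Pi.smul_apply]
            rw [smul_smul, inv_mul_cancel₀ hsc, one_smul]
      refine Integrable.of_bound (hcont.aestronglyMeasurable measurableSet_Ioo)
        (M * (‖P‖ * (M * Real.exp (M * ‖P‖ * s)))) ?_
      filter_upwards [ae_restrict_mem measurableSet_Ioo] with r hr
      refine (ContinuousLinearMap.opNorm_comp_le _ _).trans
        (mul_le_mul (hT.norm_le _ (hT.one_sub_smul_mem (mem hs0) hr))
          ((ContinuousLinearMap.opNorm_comp_le _ _).trans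
            (mul_le_mul_of_nonneg_left ?_ (norm_nonneg _))) (norm_nonneg _) hM)
      refine (norm_dysonSeries_le hT P (hT.smul_mem (mem hs0) hr.1)).trans ?_
      rw [norm_mul, Complex.norm_real, Complex.norm_real, Real.norm_of_nonneg hr.1.le,
        Real.norm_of_nonneg hs0.le]
      gcongr
      exact mul_le_of_le_one_left hs0.le hr.2.le
    have h := dysonSeries_eq hT P (mem hs0)
    rw [integral_smul] at h
    have h2 := DFunLike.congr_fun h y
    simp only [add_apply, smul_apply] at h2
    rw [ContinuousLinearMap.integral_apply hint] at h2
    rw [hSdef, h2, add_sub_cancel_left, smul_smul, inv_mul_cancel₀ hsc, one_smul]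
    rfl
  rw [tendsto_congr' hev]
  have hPy : P y = ∫ _ in Set.Ioo (0 : ℝ) 1, P y := by simp
  rw [hPy]
  refine tendsto_integral_filter_of_dominated_convergence
    (fun _ => M * (‖P‖ * (M * Real.exp (M * ‖P‖ * 1) * ‖y‖))) ?_ ?_ (integrable_const _) ?_
  · filter_upwards [self_mem_nhdsWithin] with s hs
    have hs0 : (0 : ℝ) < s := NNReal.coe_pos.2 hs
    refine ContinuousOn.aestronglyMeasurable ?_ measurableSet_Ioo
    have h1 : ContinuousOn (fun r : ℝ => T (((1 - r : ℝ) : ℂ) * s)) (Set.Ioo 0 1) :=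
      hT.differentiableOn.continuousOn.comp (by fun_prop)
        fun r hr => hT.one_sub_smul_mem (mem hs0) hr
    have h2 : ContinuousOn (fun r : ℝ => S ((r : ℂ) * s)) (Set.Ioo 0 1) :=
      (differentiableOn_dysonSeries hT P).continuousOn.comp (by fun_prop)
        fun r hr => hT.smul_mem (mem hs0) hr.1
    exact h1.clm_apply (P.continuous.comp_continuousOn (h2.clm_apply continuousOn_const))
  · have h1 : ∀ᶠ s : ℝ≥0 in 𝓝[>] 0, s < 1 := nhdsWithin_le_nhds (Iio_mem_nhds one_pos)
    filter_upwards [self_mem_nhdsWithin, h1] with s hs hs1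
    have hs0 : (0 : ℝ) < s := NNReal.coe_pos.2 hs
    filter_upwards [ae_restrict_mem measurableSet_Ioo] with r hr
    refine (ContinuousLinearMap.le_of_opNorm_le _ (hT.norm_le _
      (hT.one_sub_smul_mem (mem hs0) hr)) _).trans ?_
    refine mul_le_mul_of_nonneg_left ((P.le_opNorm _).trans
      (mul_le_mul_of_nonneg_left ?_ (norm_nonneg _))) hM
    refine (ContinuousLinearMap.le_opNorm _ _).trans (mul_le_mul_of_nonneg_right ?_ (norm_nonneg _))
    refine (norm_dysonSeries_le hT P (hT.smul_mem (mem hs0) hr.1)).trans ?_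
    rw [norm_mul, Complex.norm_real, Complex.norm_real, Real.norm_of_nonneg hr.1.le,
      Real.norm_of_nonneg hs0.le]
    have : r * (s : ℝ) ≤ 1 := mul_le_one₀ hr.2.le hs0.le (by exact_mod_cast hs1.le)
    gcongr
  · filter_upwards [ae_restrict_mem measurableSet_Ioo] with r hr
    have h1 : Tendsto (fun s : ℝ≥0 => P (S ((r : ℂ) * s) y)) (𝓝[>] 0) (𝓝 (P y)) :=
      (P.continuous.tendsto y).comp ((tendsto_dysonSeries hT P y).comp (hlim r hr.1))
    have h2 : Tendsto (fun s : ℝ≥0 => T (((1 - r : ℝ) : ℂ) * s) (P y)) (𝓝[>] 0) (𝓝 (P y)) :=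
      (hT.tendsto (P y)).comp (hlim (1 - r) (sub_pos.2 hr.2))
    have h3 : Tendsto (fun s : ℝ≥0 => T (((1 - r : ℝ) : ℂ) * s) (P (S ((r : ℂ) * s) y) - P y))
        (𝓝[>] 0) (𝓝 0) := by
      have h4 : Tendsto (fun s : ℝ≥0 => M * ‖P (S ((r : ℂ) * s) y) - P y‖) (𝓝[>] 0) (𝓝 0) := by
        have := (tendsto_iff_norm_sub_tendsto_zero.1 h1).const_mul M
        rwa [mul_zero] at this
      refine squeeze_zero_norm' ?_ h4
      filter_upwards [self_mem_nhdsWithin] with s hs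
      exact ContinuousLinearMap.le_of_opNorm_le _ (hT.norm_le _
        (hT.one_sub_smul_mem (mem (NNReal.coe_pos.2 hs)) hr)) _
    have := h3.add h2
    rw [zero_add] at this
    simpa using this

/-- Continuous dependence of the perturbed semigroup on the semigroup and on the perturbation. -/
theorem norm_dysonSeries_sub_dysonSeries_le {θ' : ℝ} {T' : ℂ → Y →L[ℂ] Y}
    (hT' : IsBoundedHolomorphicSemigroup θ' M T') (P' : Y →L[ℂ] Y) {p κ τ : ℝ}
    (hP : ‖P‖ ≤ p) (hP' : ‖P'‖ ≤ p) (hκ : ∀ s ∈ Set.Ioc (0 : ℝ) τ, ‖T s - T' s‖ ≤ κ)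
    (hPP' : ‖P - P'‖ ≤ κ) {s : ℝ} (hs : s ∈ Set.Ioc 0 τ) :
    ‖dysonSeries T P s - dysonSeries T' P' s‖
      ≤ (κ + τ * (κ * (p * (M * Real.exp (M * p * τ))) + M * (κ * (M * Real.exp (M * p * τ)))))
        * Real.exp (M * p * s) := by
  set S := dysonSeries T P with hSdef
  set S' := dysonSeries T' P' with hSdef'
  have hM := hT.bound_nonneg
  have hp : 0 ≤ p := (norm_nonneg _).trans hP
  have hκ0 : 0 ≤ κ := (norm_nonneg _).trans hPP'
  have hτ : 0 ≤ τ := hs.1.le.trans hs.2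
  -- The two families may live on different sectors; only real times, common to all sectors, are
  -- compared.
  have mem : ∀ {x : ℝ}, 0 < x → (x : ℂ) ∈ sector θ := fun hx => ofReal_mem_sector hT.angle_pos hx
  have mem' : ∀ {x : ℝ}, 0 < x → (x : ℂ) ∈ sector θ' :=
    fun hx => ofReal_mem_sector hT'.angle_pos hx
  have hSc : ContinuousOn (fun x : ℝ => S x) (Set.Ioi 0) :=
    (differentiableOn_dysonSeries hT P).continuousOn.comp (by fun_prop) fun x hx => mem hx
  have hSc' : ContinuousOn (fun x : ℝ => S' x) (Set.Ioi 0) :=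
    (differentiableOn_dysonSeries hT' P').continuousOn.comp (by fun_prop) fun x hx => mem' hx
  set E := M * Real.exp (M * p * τ) with hE
  have hE0 : 0 ≤ E := by positivity
  have hSb : ∀ {x : ℝ}, x ∈ Set.Ioc 0 τ → ‖S x‖ ≤ E := fun {x} hx => by
    refine (norm_dysonSeries_le hT P (mem hx.1)).trans ?_
    rw [Complex.norm_real, Real.norm_of_nonneg hx.1.le]
    have h2 := hx.2
    have h1 := hx.1.le
    rw [hE]
    gcongr
  have hSb' : ∀ {x : ℝ}, x ∈ Set.Ioc 0 τ → ‖S' x‖ ≤ E := fun {x} hx => by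
    refine (norm_dysonSeries_le hT' P' (mem' hx.1)).trans ?_
    rw [Complex.norm_real, Real.norm_of_nonneg hx.1.le]
    have h2 := hx.2
    have h1 := hx.1.le
    rw [hE]
    gcongr
  have hdc : ContinuousOn (fun x : ℝ => ‖S x - S' x‖) (Set.Ioi 0) := (hSc.sub hSc').norm
  refine le_of_le_add_mul_setIntegral (φ := fun x : ℝ => ‖S x - S' x‖) (τ := τ) (B := E + E)
    (by positivity) (fun x hx => ?_) (fun x _ => norm_nonneg _)
    (fun x hx => (norm_sub_le _ _).trans (add_le_add (hSb hx) (hSb' hx))) (fun x hx => ?_) s hs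
  · exact (hdc.comp (f := fun r : ℝ => r * x) (by fun_prop)
      fun r hr => mul_pos hr.1 hx.1).aestronglyMeasurable measurableSet_Ioo
  · have hi : IntervalIntegrable (fun y : ℝ => ‖S y - S' y‖) volume 0 x :=
      intervalIntegrable_of_continuousOn_Ioo_of_norm_le (C := E + E) hx.1.le
        (hdc.mono fun y hy => hy.1) fun y hy => by
          rw [norm_norm]
          have hy' : y ∈ Set.Ioc 0 τ := ⟨hy.1, hy.2.le.trans hx.2⟩
          exact (norm_sub_le _ _).trans (add_le_add (hSb hy') (hSb' hy'))
    have i1 : IntervalIntegrable (fun y : ℝ => T ((x - y : ℝ) : ℂ) ∘L P ∘L S y) volume 0 x :=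
      intervalIntegrable_duhamel hT P hx.1.le le_rfl (hSc.mono fun y hy => hy.1)
        fun y hy => hSb ⟨hy.1, hy.2.le.trans hx.2⟩
    have i2 : IntervalIntegrable (fun y : ℝ => T' ((x - y : ℝ) : ℂ) ∘L P' ∘L S' y) volume 0 x :=
      intervalIntegrable_duhamel hT' P' hx.1.le le_rfl (hSc'.mono fun y hy => hy.1)
        fun y hy => hSb' ⟨hy.1, hy.2.le.trans hx.2⟩
    have d1 := dysonSeries_eq hT P (mem hx.1)
    have d2 := dysonSeries_eq hT' P' (mem' hx.1)
    rw [setIntegral_duhamel_eq P _ x] at d1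
    rw [setIntegral_duhamel_eq P' _ x] at d2
    rw [mul_assoc, ← smul_eq_mul (a := x), smul_setIntegral_Ioo_comp_mul
      (fun x : ℝ => ‖S x - S' x‖), ← intervalIntegral.integral_const_mul]
    rw [hSdef, hSdef', d1, d2, add_sub_add_comm, ← intervalIntegral.integral_sub i1 i2, add_assoc]
    refine (norm_add_le _ _).trans (add_le_add (hκ x hx) ?_)
    set c := κ * (p * E) + M * (κ * E) with hc
    have hc0 : 0 ≤ c := by positivity
    refine (intervalIntegral.norm_integral_le_of_norm_le (g := fun y => c + M * p * ‖S y - S' y‖)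
      hx.1.le ?_ (intervalIntegrable_const.add (hi.const_mul _))).trans ?_
    · rw [← ae_restrict_iff' measurableSet_Ioc, ← restrict_Ioo_eq_restrict_Ioc]
      filter_upwards [ae_restrict_mem measurableSet_Ioo] with y hy
      have hy' : y ∈ Set.Ioc 0 τ := ⟨hy.1, hy.2.le.trans hx.2⟩
      have hxy : x - y ∈ Set.Ioc 0 τ := ⟨sub_pos.2 hy.2, by linarith [hy.1, hx.2]⟩
      -- Telescoping: the first two terms are O(κ), and the last contains S - S' again and feeds
      -- Grönwall's inequality.
      have split : T ((x - y : ℝ) : ℂ) ∘L P ∘L S y - T' ((x - y : ℝ) : ℂ) ∘L P' ∘L S' y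
          = (T ((x - y : ℝ) : ℂ) - T' ((x - y : ℝ) : ℂ)) ∘L P ∘L S y
            + T' ((x - y : ℝ) : ℂ) ∘L (P - P') ∘L S y
            + T' ((x - y : ℝ) : ℂ) ∘L P' ∘L (S y - S' y) := by
        simp only [ContinuousLinearMap.sub_comp, ContinuousLinearMap.comp_sub]
        abel
      have hcomp : ∀ {A B D : Y →L[ℂ] Y} {α β γ : ℝ}, ‖A‖ ≤ α → ‖B‖ ≤ β → ‖D‖ ≤ γ →
          ‖A ∘L B ∘L D‖ ≤ α * (β * γ) := fun {A B D α β γ} hA hB hD =>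
        (ContinuousLinearMap.opNorm_comp_le _ _).trans (mul_le_mul hA
          ((ContinuousLinearMap.opNorm_comp_le _ _).trans (mul_le_mul hB hD (norm_nonneg _)
            ((norm_nonneg _).trans hB))) (norm_nonneg _) ((norm_nonneg _).trans hA))
      have hTn' := hT'.norm_le _ (mem' hxy.1)
      rw [split]
      refine (norm_add₃_le).trans ?_
      refine add_le_add (add_le_add (hcomp (hκ _ hxy) hP (hSb hy'))
        (hcomp hTn' hPP' (hSb hy'))) ?_
      rw [mul_assoc]
      exact hcomp hTn' hP' le_rfl
    · rw [intervalIntegral.integral_add intervalIntegrable_const (hi.const_mul _),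
        intervalIntegral.integral_const, sub_zero, smul_eq_mul]
      exact add_le_add (mul_le_mul_of_nonneg_right hx.2 hc0) le_rfl

end Semigroups

/-! ### Strongly continuous semigroups and their generators -/

theorem nhds_zero_nnreal : 𝓝 (0 : ℝ≥0) = 𝓝[>] 0 ⊔ pure 0 := by
  have h : (Set.univ : Set ℝ≥0) = insert 0 (Set.Ioi 0) := by
    ext x
    simp only [Set.mem_univ, Set.mem_insert_iff, Set.mem_Ioi, true_iff]
    exact (eq_or_ne x 0).imp_right pos_iff_ne_zero.2
  rw [← nhdsWithin_univ, h, nhdsWithin_insert, sup_comm]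

theorem tendsto_toNNReal_sub (r : ℝ) :
    Tendsto (fun x : ℝ => (x - r).toNNReal) (𝓝[>] r) (𝓝[>] 0) := by
  refine tendsto_nhdsWithin_iff.2 ⟨?_, ?_⟩
  · have hc : Continuous fun x : ℝ => (x - r).toNNReal := by fun_prop
    have h := (hc.tendsto r).mono_left (nhdsWithin_le_nhds (s := Set.Ioi r))
    rwa [sub_self, Real.toNNReal_zero] at h
  · filter_upwards [self_mem_nhdsWithin] with x hx
    exact Real.toNNReal_pos.2 (sub_pos.2 hx)

section C0

variable {Y : Type} [NormedAddCommGroup Y] [NormedSpace ℂ Y]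

namespace IsC0Semigroup

variable {S : ℝ≥0 → Y →L[ℂ] Y} (hS : IsC0Semigroup S)
include hS

theorem tendsto_zero (y : Y) : Tendsto (fun s => S s y) (𝓝 0) (𝓝 y) := by
  rw [nhds_zero_nnreal]
  refine (hS.strong y).sup ?_
  rw [tendsto_pure_left]
  intro s hs
  rw [hS.zero]
  exact mem_of_mem_nhds hs

variable [CompleteSpace Y]

/-- Otherwise there are times sₙ → 0 with ‖S(sₙ)‖ > n, against the uniform boundedness principle,
since every orbit converges along sₙ. -/
theorem exists_norm_le_near_zero : ∃ δ : ℝ≥0, 0 < δ ∧ ∃ C : ℝ, ∀ s ≤ δ, ‖S s‖ ≤ C := by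
  by_contra! hcon
  have hpos : ∀ n : ℕ, (0 : ℝ≥0) < 1 / ((n : ℝ≥0) + 1) := fun n => by positivity
  choose s hs1 hs2 using fun n : ℕ => hcon (1 / ((n : ℝ≥0) + 1)) (hpos n) n
  have hs0 : Tendsto s atTop (𝓝 0) :=
    tendsto_of_tendsto_of_tendsto_of_le_of_le tendsto_const_nhds
      (tendsto_one_div_add_atTop_nhds_zero_nat (𝕜 := ℝ≥0)) (fun _ => bot_le) hs1
  obtain ⟨C, hC⟩ := banach_steinhaus (g := fun n => S (s n)) fun y => by
    obtain ⟨B, hB⟩ := (((hS.tendsto_zero y).comp hs0).norm).bddAbove_range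
    exact ⟨B, fun n => hB ⟨n, rfl⟩⟩
  obtain ⟨n, hn⟩ := exists_nat_gt C
  exact absurd ((hs2 n).trans_le (hC n)) (not_lt.2 hn.le)

theorem exists_norm_le (τ : ℝ≥0) : ∃ C : ℝ, 0 ≤ C ∧ ∀ s ≤ τ, ‖S s‖ ≤ C := by
  obtain ⟨δ, hδ, C, hC⟩ := hS.exists_norm_le_near_zero
  have hC0 : 0 ≤ C := (norm_nonneg _).trans (hC 0 bot_le)
  have key : ∀ n : ℕ, ∃ B : ℝ, 0 ≤ B ∧ ∀ s ≤ n * δ, ‖S s‖ ≤ B := by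
    intro n
    induction n with
    | zero => exact ⟨C, hC0, fun s hs => hC s (hs.trans (by simp))⟩
    | succ n ih =>
      obtain ⟨B, hB0, hB⟩ := ih
      refine ⟨B * C, mul_nonneg hB0 hC0, fun s hs => ?_⟩
      -- Peels off a step of length min(s, δ); the remaining time s - δ, truncated at 0, falls under
      -- the induction hypothesis.
      rw [← tsub_add_min (a := s) (b := δ), hS.add]
      refine (ContinuousLinearMap.opNorm_comp_le _ _).trans
        (mul_le_mul (hB _ ?_) (hC _ (min_le_right _ _)) (norm_nonneg _) hB0)
      rw [tsub_le_iff_right]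
      refine hs.trans (le_of_eq ?_)
      push_cast
      ring
  obtain ⟨n, hn⟩ := exists_nat_gt (τ / δ)
  obtain ⟨B, hB0, hB⟩ := key n
  exact ⟨B, hB0, fun s hs => hB s (hs.trans ((div_le_iff₀ hδ).1 hn.le))⟩

theorem continuous_apply (y : Y) : Continuous fun s => S s y := by
  refine continuous_iff_continuousAt.2 fun t => ?_
  obtain ⟨C, hC0, hC⟩ := hS.exists_norm_le (t + 1)
  rw [ContinuousAt, tendsto_iff_norm_sub_tendsto_zero]
  -- With truncated subtraction (s - t) + (t - s) is |s - t|, which treats both one-sided limits at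
  -- once.
  have h1 : Tendsto (fun s : ℝ≥0 => C * ‖S ((s - t) + (t - s)) y - y‖) (𝓝 t) (𝓝 0) := by
    have hc : Continuous fun s : ℝ≥0 => (s - t) + (t - s) := by fun_prop
    have h2 := hc.tendsto t
    rw [tsub_self, add_zero] at h2
    have h3 := (tendsto_iff_norm_sub_tendsto_zero.1 ((hS.tendsto_zero y).comp h2)).const_mul C
    rwa [mul_zero] at h3
  refine squeeze_zero_norm' ?_ h1
  filter_upwards [Iio_mem_nhds (lt_add_one t)] with s hs
  rw [norm_norm]
  have step : ∀ a b : ℝ≥0, a ≤ b → a ≤ t + 1 → ‖S b y - S a y‖ ≤ C * ‖S (b - a) y - y‖ :=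
    fun a b hab ha => by
      have : S b y = S a (S (b - a) y) := by
        conv_lhs => rw [← add_tsub_cancel_of_le hab, hS.add]
        rfl
      rw [this, ← map_sub]
      exact ContinuousLinearMap.le_of_opNorm_le _ (hC a ha) _
  rcases le_total s t with h | h
  · rw [tsub_eq_zero_of_le h, zero_add, norm_sub_rev]
    exact step s t h (le_of_lt hs)
  · rw [tsub_eq_zero_of_le h, add_zero]
    exact step t s h le_self_add

theorem tendsto_apply {ι : Type*} {l : Filter ι} {g : ι → ℝ≥0} {t : ℝ≥0} {h : ι → Y} {y : Y}
    (hg : Tendsto g l (𝓝 t)) (hh : Tendsto h l (𝓝 y)) :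
    Tendsto (fun i => S (g i) (h i)) l (𝓝 (S t y)) := by
  obtain ⟨C, hC0, hC⟩ := hS.exists_norm_le (t + 1)
  have h1 : Tendsto (fun i => S (g i) y) l (𝓝 (S t y)) :=
    ((hS.continuous_apply y).tendsto t).comp hg
  have h2 : Tendsto (fun i => S (g i) (h i - y)) l (𝓝 0) := by
    have h3 : Tendsto (fun i => C * ‖h i - y‖) l (𝓝 0) := by
      have := (tendsto_iff_norm_sub_tendsto_zero.1 hh).const_mul C
      rwa [mul_zero] at this
    refine squeeze_zero_norm' ?_ h3
    filter_upwards [hg.eventually (Iio_mem_nhds (lt_add_one t))] with i hi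
    exact ContinuousLinearMap.le_of_opNorm_le _ (hC _ (le_of_lt hi)) _
  have := h1.add h2
  rw [add_zero] at this
  simpa using this

end IsC0Semigroup

/-- A generator determines its semigroup, when one of the semigroups is analytic. -/
theorem IsC0Semigroup.eq_of_isGeneratedByNeg [CompleteSpace Y] {S T : ℝ≥0 → Y →L[ℂ] Y}
    {G : Y → Y → Prop} (hS : IsC0Semigroup S) (hT : IsAnalyticSemigroup T)
    (hSG : IsGeneratedByNeg S G) (hTG : IsGeneratedByNeg T G) : S = T := by
  obtain ⟨θ, h0, h1, U, hU1, hU2, -, -⟩ := hT.analytic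
  have hT0 : IsC0Semigroup T := hT.toIsC0Semigroup
  -- Analyticity makes every orbit of T differentiable at positive times, so T(r)y lies in the
  -- domain of the generator for every y; no density of the domain is needed.
  have hder : ∀ y (r : ℝ), 0 < r → ∃ w, HasDerivAt (fun x : ℝ => T x.toNNReal y) w r :=
    fun y r hr => by
      have hU := (hU2.differentiableAt ((isOpen_sector h0 h1).mem_nhds
        (ofReal_mem_sector h0 hr))).hasDerivAt
      have h := HasDerivAt.scomp r hU (Complex.ofRealCLM.hasDerivAt (x := r))
      have h2 := ((ContinuousLinearMap.apply ℂ Y y).restrictScalars ℝ).hasFDerivAt.comp_hasDerivAt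
        r h
      refine ⟨_, h2.congr_of_eventuallyEq ?_⟩
      filter_upwards [Ioi_mem_nhds hr] with x hx
      have hx' : (0 : ℝ) < x := hx
      have := hU1 x.toNNReal (Real.toNNReal_pos.2 hx')
      rw [Real.coe_toNNReal x hx'.le] at this
      simp [← this]
  funext s
  rcases eq_or_ne s 0 with rfl | hs
  · rw [hS.zero, hT0.zero]
  have hs0 : (0 : ℝ) < s := NNReal.coe_pos.2 (pos_iff_ne_zero.2 hs)
  ext y
  -- The interpolation between S(s)y at r = 0 and T(s)y at r = s; its right derivative vanishes
  -- because S and T have the same generator.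
  let φ : ℝ → Y := fun r => S (s - r : ℝ).toNNReal (T r.toNNReal y)
  have hφc : Continuous φ := by
    refine continuous_iff_continuousAt.2 fun r => hS.tendsto_apply ?_ ?_
    · have : Continuous fun r : ℝ => (s - r : ℝ).toNNReal := by fun_prop
      exact this.tendsto r
    · exact ((hT0.continuous_apply y).comp continuous_real_toNNReal).tendsto r
  have hφd : ∀ r : ℝ, 0 < r → r < s → HasDerivWithinAt φ 0 (Set.Ici r) r := fun r hr hrs => by
    obtain ⟨w, hw⟩ := hder y r hr
    have hsl : Tendsto (fun x : ℝ => (x - r)⁻¹ • (T x.toNNReal y - T r.toNNReal y)) (𝓝[>] r)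
        (𝓝 w) := hasDerivWithinAt_iff_tendsto_slope' Set.self_notMem_Ioi |>.1 hw.hasDerivWithinAt
    have hTr : Tendsto (fun h : ℝ≥0 => ((h : ℂ)⁻¹) • (T h (T r.toNNReal y) - T r.toNNReal y))
        (𝓝[>] 0) (𝓝 w) := by
      have hadd : Tendsto (fun h : ℝ≥0 => r + (h : ℝ)) (𝓝[>] 0) (𝓝[>] r) := by
        refine tendsto_nhdsWithin_iff.2 ⟨?_, ?_⟩
        · have hc : Continuous fun h : ℝ≥0 => r + (h : ℝ) := by fun_prop
          have := (hc.tendsto 0).mono_left (nhdsWithin_le_nhds (s := Set.Ioi 0))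
          rwa [NNReal.coe_zero, add_zero] at this
        · filter_upwards [self_mem_nhdsWithin] with h hh
          exact lt_add_of_pos_right r (NNReal.coe_pos.2 hh)
      refine (hsl.comp hadd).congr fun h => ?_
      simp only [Function.comp_apply, add_sub_cancel_left]
      rw [add_comm r, Real.toNNReal_add h.coe_nonneg hr.le, Real.toNNReal_coe, hT0.add,
        ← Complex.coe_smul, Complex.ofReal_inv]
      rfl
    have hSr := (hSG _ (-w)).1 ((hTG (T r.toNNReal y) (-w)).2 (by rwa [neg_neg]))
    rw [neg_neg] at hSr
    rw [← hasDerivWithinAt_Ioi_iff_Ici,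
      hasDerivWithinAt_iff_tendsto_slope' Set.self_notMem_Ioi]
    -- At T(r)y the difference quotients of T and of S have the same limit. Their difference is
    -- mapped by S(s - x) to the slope of φ between r and x.
    have hbr : Tendsto (fun x : ℝ => (x - r)⁻¹ • (T x.toNNReal y - T r.toNNReal y)
        - (((x - r).toNNReal : ℂ)⁻¹) • (S (x - r).toNNReal (T r.toNNReal y) - T r.toNNReal y))
        (𝓝[>] r) (𝓝 0) := by
      have := hsl.sub (hSr.comp (tendsto_toNNReal_sub r))
      rwa [sub_self] at this
    have hg : Tendsto (fun x : ℝ => (s - x : ℝ).toNNReal) (𝓝[>] r) (𝓝 (s - r : ℝ).toNNReal) := by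
      have : Continuous fun r : ℝ => (s - r : ℝ).toNNReal := by fun_prop
      exact (this.tendsto r).mono_left nhdsWithin_le_nhds
    have hfin := hS.tendsto_apply hg hbr
    rw [map_zero] at hfin
    refine hfin.congr' ?_
    filter_upwards [Ioo_mem_nhdsGT hrs] with x hx
    have hxr : 0 ≤ x - r := (sub_pos.2 hx.1).le
    rw [Real.coe_toNNReal _ hxr, ← Complex.ofReal_inv, Complex.coe_smul, ← smul_sub,
      sub_sub_sub_cancel_right, slope_def_module]
    have hsplit : (s - r : ℝ).toNNReal = (s - x : ℝ).toNNReal + (x - r).toNNReal := by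
      rw [← Real.toNNReal_add (sub_pos.2 hx.2).le hxr]
      congr 1
      ring
    have : φ r = S (s - x : ℝ).toNNReal (S (x - r).toNNReal (T r.toNNReal y)) := by
      show S (s - r : ℝ).toNNReal (T r.toNNReal y) = _
      rw [hsplit, hS.add]
      rfl
    rw [this, ← map_sub, ← Complex.coe_smul, ← Complex.coe_smul, map_smul]
  have hconst : ∀ r : ℝ, 0 < r → r < s → φ s = φ r := fun r hr hrs =>
    constant_of_has_deriv_right_zero hφc.continuousOn
      (fun x hx => hφd x (hr.trans_le hx.1) hx.2) s ⟨hrs.le, le_rfl⟩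
  -- Differentiability is available only for r > 0, so the value at 0 is reached by continuity.
  have hlim : Tendsto φ (𝓝[>] 0) (𝓝 (φ 0)) := (hφc.tendsto 0).mono_left nhdsWithin_le_nhds
  have heq : φ s = φ 0 := by
    refine tendsto_nhds_unique (Tendsto.congr' ?_ tendsto_const_nhds) hlim
    filter_upwards [Ioo_mem_nhdsGT hs0] with r hr using hconst r hr.1 hr.2
  have e1 : φ s = T s y := by simp [φ, hS.zero]
  have e2 : φ 0 = S s y := by simp [φ, hT0.zero]
  rw [← e2, ← heq, e1]

/-! ### From holomorphic semigroups on sectors to analytic semigroups -/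

/-- The restriction of a holomorphic semigroup to the half-line. -/
noncomputable def realSemigroup (S : ℂ → Y →L[ℂ] Y) (s : ℝ≥0) : Y →L[ℂ] Y :=
  if s = 0 then 1 else S s

theorem realSemigroup_of_pos (S : ℂ → Y →L[ℂ] Y) {s : ℝ≥0} (hs : 0 < s) :
    realSemigroup S s = S s := if_neg hs.ne'

theorem realSemigroup_zero (S : ℂ → Y →L[ℂ] Y) : realSemigroup S 0 = 1 := if_pos rfl

/-- The sector omits 0, so the value of the family there carries no information; the restriction is
set to 1 at time 0, which the strong limit makes consistent. -/
theorem isAnalyticSemigroup_realSemigroup {S : ℂ → Y →L[ℂ] Y} {θ : ℝ} (h0 : 0 < θ)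
    (h1 : θ ≤ Real.pi / 2) (hd : DifferentiableOn ℂ S (sector θ))
    (hadd : ∀ z ∈ sector θ, ∀ w ∈ sector θ, S (z + w) = S z ∘L S w)
    (hlim : ∀ y, Tendsto (fun z => S z y) (𝓝[sector θ] 0) (𝓝 y)) :
    IsAnalyticSemigroup (realSemigroup S) where
  zero := realSemigroup_zero S
  add s t := by
    rcases eq_or_ne s 0 with rfl | hs
    · rw [zero_add, realSemigroup_zero]; rfl
    rcases eq_or_ne t 0 with rfl | ht
    · rw [add_zero, realSemigroup_zero]; rfl
    have hs' := pos_iff_ne_zero.2 hs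
    have ht' := pos_iff_ne_zero.2 ht
    rw [realSemigroup_of_pos S hs', realSemigroup_of_pos S ht',
      realSemigroup_of_pos S (add_pos hs' ht'), NNReal.coe_add, Complex.ofReal_add]
    exact hadd _ (ofReal_mem_sector h0 hs') _ (ofReal_mem_sector h0 ht')
  strong y := by
    have ht : Tendsto (fun s : ℝ≥0 => (s : ℂ)) (𝓝[>] 0) (𝓝[sector θ] 0) := by
      refine tendsto_nhdsWithin_iff.2 ⟨?_, ?_⟩
      · have hc : Continuous fun s : ℝ≥0 => (s : ℂ) := by fun_prop
        simpa using (hc.tendsto 0).mono_left (nhdsWithin_le_nhds (s := Set.Ioi 0))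
      · filter_upwards [self_mem_nhdsWithin] with s hs
        exact ofReal_mem_sector h0 (NNReal.coe_pos.2 hs)
    refine ((hlim y).comp ht).congr' ?_
    filter_upwards [self_mem_nhdsWithin] with s hs
    rw [realSemigroup_of_pos S hs]
    rfl
  analytic := ⟨θ, h0, h1, S, fun s hs => (realSemigroup_of_pos S hs).symm, hd, hadd, hlim⟩

theorem isGeneratedByNeg_realSemigroup {S : ℂ → Y →L[ℂ] Y} {G : Y → Y → Prop}
    (h : IsGeneratedByNeg (fun s : ℝ≥0 => S s) G) : IsGeneratedByNeg (realSemigroup S) G := by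
  intro y z
  rw [h y z]
  refine tendsto_congr' ?_
  filter_upwards [self_mem_nhdsWithin] with s hs
  rw [realSemigroup_of_pos S hs]

/-- The relation says z = (G - P)y on the domain of G: by `tendsto_dysonSeries_sub` the difference
quotients of the two families differ by a term converging to P y. -/
theorem isGeneratedByNeg_dysonSeries [CompleteSpace Y] {θ M : ℝ} {T : ℂ → Y →L[ℂ] Y}
    (hT : IsBoundedHolomorphicSemigroup θ M T) (P : Y →L[ℂ] Y) {G : Y → Y → Prop}
    (h : IsGeneratedByNeg (fun s : ℝ≥0 => T s) G) :
    IsGeneratedByNeg (fun s : ℝ≥0 => dysonSeries T P s) fun y z => G y (z + P y) := by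
  intro y z
  show G y (z + P y) ↔ _
  rw [h y (z + P y)]
  have hp := tendsto_dysonSeries_sub hT P y
  constructor
  · intro h1
    have h2 := h1.add hp
    rw [neg_add_rev, neg_add_cancel_comm] at h2
    refine h2.congr fun s => ?_
    rw [← smul_add, add_comm, sub_add_sub_cancel]
  · intro h1
    have h2 := h1.sub hp
    rw [← neg_add'] at h2
    refine h2.congr fun s => ?_
    rw [← smul_sub, sub_sub_sub_cancel_left]

theorem isGeneratedByNeg_conj {Z : Type} [NormedAddCommGroup Z] [NormedSpace ℂ Z] (e : Y ≃L[ℂ] Z)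
    {T : ℝ≥0 → Z →L[ℂ] Z} {G : Z → Z → Prop} (h : IsGeneratedByNeg T G) :
    IsGeneratedByNeg (fun s => (e.symm : Z →L[ℂ] Y) ∘L T s ∘L (e : Y →L[ℂ] Z))
      fun y z => G (e y) (e z) := by
  intro y z
  have heq : ∀ s : ℝ≥0, ((s : ℂ)⁻¹) • (((e.symm : Z →L[ℂ] Y) ∘L T s ∘L (e : Y →L[ℂ] Z)) y - y)
      = e.symm (((s : ℂ)⁻¹) • (T s (e y) - e y)) := fun s => by simp
  simp only [heq]
  show G (e y) (e z) ↔ _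
  rw [h (e y) (e z)]
  constructor
  · intro h1
    have := (e.symm.continuous.tendsto _).comp h1
    rwa [map_neg, e.symm_apply_apply] at this
  · intro h1
    have := (e.continuous.tendsto _).comp h1
    rw [map_neg] at this
    exact this.congr fun s => e.apply_symm_apply _

theorem IsBoundedHolomorphicSemigroup.conj {Y Z : Type*} [NormedAddCommGroup Y] [NormedSpace ℂ Y]
    [NormedAddCommGroup Z] [NormedSpace ℂ Z] (e : Y ≃L[ℂ] Z) {θ M : ℝ} {T : ℂ → Z →L[ℂ] Z}
    (hT : IsBoundedHolomorphicSemigroup θ M T) :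
    IsBoundedHolomorphicSemigroup θ
      (‖(e.symm : Z →L[ℂ] Y)‖ * (M * ‖(e : Y →L[ℂ] Z)‖))
      fun z => (e.symm : Z →L[ℂ] Y) ∘L T z ∘L (e : Y →L[ℂ] Z) where
  angle_pos := hT.angle_pos
  angle_le := hT.angle_le
  differentiableOn := (differentiableOn_const _).clm_comp
    (hT.differentiableOn.clm_comp (differentiableOn_const _))
  add z hz w hw := by
    rw [hT.add z hz w hw]
    ext y
    simp
  tendsto y := by
    have := (e.symm.continuous.tendsto _).comp (hT.tendsto (e y))
    rwa [e.symm_apply_apply] at this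
  norm_le z hz := (ContinuousLinearMap.opNorm_comp_le _ _).trans
    (mul_le_mul_of_nonneg_left ((ContinuousLinearMap.opNorm_comp_le _ _).trans
      (mul_le_mul_of_nonneg_right (hT.norm_le z hz) (norm_nonneg _))) (norm_nonneg _))

end C0

/-! ### Estimates for the exponential function -/

/-- The mean value inequality on the convex half-plane Re ≥ c, where the derivative of v ↦ e^{-v} is
at most e^{-c}. -/
theorem norm_exp_neg_sub_exp_neg_le {c : ℝ} {v v' : ℂ} (hv : c ≤ v.re) (hv' : c ≤ v'.re) :
    ‖Complex.exp (-v) - Complex.exp (-v')‖ ≤ Real.exp (-c) * ‖v - v'‖ := by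
  refine (convex_halfSpace_re_ge c).norm_image_sub_le_of_norm_hasDerivWithin_le (𝕜 := ℂ)
    (f := fun v => Complex.exp (-v)) (f' := fun v => -Complex.exp (-v)) (fun x _ => ?_)
    (fun x hx => ?_) hv' hv
  · simpa using ((hasDerivAt_neg x).cexp).hasDerivWithinAt
  · rw [norm_neg, Complex.norm_exp, Complex.neg_re]
    exact Real.exp_le_exp.2 (neg_le_neg hx)

theorem norm_exp_neg_sub_one_le {v : ℂ} (hv : 0 ≤ v.re) : ‖Complex.exp (-v) - 1‖ ≤ ‖v‖ := by
  have := norm_exp_neg_sub_exp_neg_le (c := 0) (v' := 0) hv le_rfl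
  simpa using this

/-- The mean value inequality for e^{-v} + v, whose derivative is at most ‖v‖ on the half-disc of
that radius. -/
theorem norm_exp_neg_sub_one_add_le {v : ℂ} (hv : 0 ≤ v.re) :
    ‖Complex.exp (-v) - 1 + v‖ ≤ ‖v‖ ^ 2 := by
  have hconv : Convex ℝ ({z : ℂ | 0 ≤ z.re} ∩ Metric.closedBall 0 ‖v‖) :=
    (convex_halfSpace_re_ge 0).inter (convex_closedBall 0 _)
  have h := hconv.norm_image_sub_le_of_norm_hasDerivWithin_le (𝕜 := ℂ) (C := ‖v‖)
    (f := fun v => Complex.exp (-v) + v) (f' := fun v => -Complex.exp (-v) + 1) (x := 0) (y := v)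
    (fun x _ => by
      have := ((hasDerivAt_neg x).cexp).add (hasDerivAt_id x)
      simpa using! this.hasDerivWithinAt)
    (fun x hx => by
      rw [← norm_neg, neg_add, neg_neg, ← sub_eq_add_neg]
      exact (norm_exp_neg_sub_one_le hx.1).trans (mem_closedBall_zero_iff.1 hx.2))
    ⟨le_refl (0 : ℝ), by simp⟩ ⟨hv, by simp⟩
  rw [sq]
  simpa [sub_add_eq_add_sub] using h

theorem norm_exp_neg_add_sub_le {v k : ℂ} :
    ‖Complex.exp (-(v + k)) - Complex.exp (-v) + k * Complex.exp (-v)‖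
      ≤ ‖k‖ ^ 2 * Real.exp (‖k‖ - v.re) := by
  have h := Complex.norm_exp_sub_sum_le_norm_mul_exp (-k) 2
  simp only [Finset.sum_range_succ, Finset.sum_range_zero, pow_zero, Nat.factorial_zero,
    Nat.cast_one, div_one, pow_one, Nat.factorial_one, zero_add, norm_neg] at h
  have e : Complex.exp (-(v + k)) - Complex.exp (-v) + k * Complex.exp (-v)
      = Complex.exp (-v) * (Complex.exp (-k) - (1 + -k)) := by
    rw [neg_add, Complex.exp_add]; ring
  rw [e, norm_mul, Complex.norm_exp, Complex.neg_re, sub_eq_add_neg ‖k‖, Real.exp_add]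
  calc Real.exp (-v.re) * ‖Complex.exp (-k) - (1 + -k)‖
      ≤ Real.exp (-v.re) * (‖k‖ ^ 2 * Real.exp ‖k‖) := by gcongr
    _ = _ := by ring

theorem mul_exp_neg_le_one {x : ℝ} : x * Real.exp (-x) ≤ 1 := by
  rw [Real.exp_neg, ← div_eq_mul_inv, div_le_one (Real.exp_pos x)]
  linarith [Real.add_one_le_exp x]

theorem sq_mul_exp_neg_le_two {x : ℝ} (hx : 0 ≤ x) : x ^ 2 * Real.exp (-x) ≤ 2 := by
  rw [Real.exp_neg, ← div_eq_mul_inv, div_le_iff₀ (Real.exp_pos x)]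
  have := Real.quadratic_le_exp_of_nonneg hx
  nlinarith

/-! ### Functional calculus of an operator `0 ≤ R ≤ 1` -/

section FunctionalCalculus

variable {H : Type} [NormedAddCommGroup H] [InnerProductSpace ℂ H] [CompleteSpace H]

/-- The operator `f(R)`. -/
noncomputable def opFun (R : H →L[ℂ] H) (f : ℝ → ℂ) : H →L[ℂ] H :=
  cfc (fun z : ℂ => f z.re) R

variable {R : H →L[ℂ] H} (h0 : 0 ≤ R) (h1 : R ≤ 1)
include h0 h1

/-- Only the values of f on [0, 1] matter for f(R). The point r = 0 may belong to the spectrum, so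
continuity there has to be checked for every function used. -/
theorem re_mem_Icc_of_mem_spectrum {z : ℂ} (hz : z ∈ spectrum ℂ R) :
    z = z.re ∧ z.re ∈ Set.Icc (0 : ℝ) 1 := by
  have hsa : IsSelfAdjoint R := IsSelfAdjoint.of_nonneg h0
  have hre := hsa.mem_spectrum_eq_re hz
  have hm : z.re ∈ spectrum ℝ R := by
    rw [← spectrum.algebraMap_mem_iff ℂ]
    rw [hre] at hz
    exact hz
  exact ⟨hre, spectrum_nonneg_of_nonneg h0 hm, (CFC.le_one_iff (R := ℝ) R).1 h1 _ hm⟩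

theorem continuousOn_comp_re {f : ℝ → ℂ} (hf : ContinuousOn f (Set.Icc 0 1)) :
    ContinuousOn (fun z : ℂ => f z.re) (spectrum ℂ R) :=
  hf.comp Complex.continuous_re.continuousOn fun _ hz => (re_mem_Icc_of_mem_spectrum h0 h1 hz).2

theorem opFun_congr {f g : ℝ → ℂ} (h : Set.EqOn f g (Set.Icc 0 1)) : opFun R f = opFun R g :=
  cfc_congr fun _ hz => h (re_mem_Icc_of_mem_spectrum h0 h1 hz).2

theorem norm_opFun_le {f : ℝ → ℂ} {c : ℝ} (hc : 0 ≤ c) (h : ∀ r ∈ Set.Icc (0 : ℝ) 1, ‖f r‖ ≤ c) :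
    ‖opFun R f‖ ≤ c :=
  norm_cfc_le hc fun _ hz => h _ (re_mem_Icc_of_mem_spectrum h0 h1 hz).2

theorem opFun_mul {f g : ℝ → ℂ} (hf : ContinuousOn f (Set.Icc 0 1))
    (hg : ContinuousOn g (Set.Icc 0 1)) :
    opFun R (fun r => f r * g r) = opFun R f ∘L opFun R g :=
  cfc_mul _ _ R (continuousOn_comp_re h0 h1 hf) (continuousOn_comp_re h0 h1 hg)

theorem opFun_sub {f g : ℝ → ℂ} (hf : ContinuousOn f (Set.Icc 0 1))
    (hg : ContinuousOn g (Set.Icc 0 1)) :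
    opFun R (fun r => f r - g r) = opFun R f - opFun R g :=
  cfc_sub _ _ R (continuousOn_comp_re h0 h1 hf) (continuousOn_comp_re h0 h1 hg)

theorem opFun_add {f g : ℝ → ℂ} (hf : ContinuousOn f (Set.Icc 0 1))
    (hg : ContinuousOn g (Set.Icc 0 1)) :
    opFun R (fun r => f r + g r) = opFun R f + opFun R g :=
  cfc_add R _ _ (continuousOn_comp_re h0 h1 hf) (continuousOn_comp_re h0 h1 hg)

theorem opFun_const_mul {f : ℝ → ℂ} (c : ℂ) (hf : ContinuousOn f (Set.Icc 0 1)) :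
    opFun R (fun r => c * f r) = c • opFun R f :=
  cfc_const_mul c _ R (continuousOn_comp_re h0 h1 hf)

omit h1 in
theorem opFun_one : opFun R (fun _ => 1) = 1 := cfc_const_one ℂ R

-- Uniqueness of the nonnegative square root. This ties the complex calculus to the `CFC.sqrt` in
-- the definition of A^{1/2}.
omit h1 in
theorem opFun_sqrt : opFun R (fun r => (√r : ℂ)) = CFC.sqrt R := by
  have hsa : IsSelfAdjoint R := IsSelfAdjoint.of_nonneg h0
  have e : opFun R (fun r => (√r : ℂ)) = cfc (fun r : ℝ => √r) R := (cfc_real_eq_complex _).symm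
  rw [e]
  refine (CFC.sqrt_unique ?_ (cfc_nonneg fun _ _ => Real.sqrt_nonneg _)).symm
  rw [← cfc_mul _ _ R]
  conv_rhs => rw [← cfc_id ℝ R]
  exact cfc_congr fun r hr => Real.mul_self_sqrt (spectrum_nonneg_of_nonneg h0 hr)

theorem opFun_sqrt_one_sub : opFun R (fun r => (√(1 - r) : ℂ)) = CFC.sqrt (1 - R) := by
  have hsa : IsSelfAdjoint R := IsSelfAdjoint.of_nonneg h0
  have e : opFun R (fun r => (√(1 - r) : ℂ)) = cfc (fun r : ℝ => √(1 - r)) R :=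
    (cfc_real_eq_complex fun r : ℝ => √(1 - r)).symm
  rw [e]
  refine (CFC.sqrt_unique ?_ (cfc_nonneg fun _ _ => Real.sqrt_nonneg _)).symm
  rw [← cfc_mul _ _ R]
  have e2 : cfc (fun r : ℝ => 1 - r) R = 1 - R := by
    rw [cfc_sub (fun _ : ℝ => (1 : ℝ)) (fun r => r) R, cfc_const_one ℝ R, cfc_id' ℝ R]
  rw [← e2]
  exact cfc_congr fun r hr =>
    Real.mul_self_sqrt (sub_nonneg.2 ((CFC.le_one_iff (R := ℝ) R).1 h1 _ hr))

end FunctionalCalculus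

/-! ### The semigroup generated by `-R^{-1/2}` -/

/-- The function `r ↦ exp(-w r^{-1/2})`, extended by `0`. -/
noncomputable def expInvSqrt (w : ℂ) (r : ℝ) : ℂ :=
  if r ≤ 0 then 0 else Complex.exp (-(w * ((√r)⁻¹ : ℝ)))

theorem expInvSqrt_of_pos (w : ℂ) {r : ℝ} (hr : 0 < r) :
    expInvSqrt w r = Complex.exp (-(w * ((√r)⁻¹ : ℝ))) := if_neg hr.not_ge

theorem expInvSqrt_of_nonpos (w : ℂ) {r : ℝ} (hr : r ≤ 0) : expInvSqrt w r = 0 := if_pos hr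

theorem continuousOn_Icc_of_norm_le_sqrt {f : ℝ → ℂ} {C : ℝ}
    (hf : ∀ r, 0 < r → ContinuousAt f r) (hC : ∀ r, 0 ≤ r → ‖f r‖ ≤ C * √r) :
    ContinuousOn f (Set.Icc 0 1) := by
  intro r hr
  rcases hr.1.eq_or_lt with rfl | hr0
  · have hf0 : f 0 = 0 := by simpa using hC 0 le_rfl
    rw [ContinuousWithinAt, hf0]
    have hc : Continuous fun r : ℝ => C * √r := by fun_prop
    have h := (hc.tendsto 0).mono_left (nhdsWithin_le_nhds (s := Set.Icc 0 1))
    rw [Real.sqrt_zero, mul_zero] at h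
    refine squeeze_zero_norm' ?_ h
    filter_upwards [self_mem_nhdsWithin] with x hx using hC x hx.1
  · exact (hf r hr0).continuousWithinAt

theorem continuousAt_expInvSqrt (w : ℂ) {r : ℝ} (hr : 0 < r) :
    ContinuousAt (expInvSqrt w) r := by
  have hs : √r ≠ 0 := (Real.sqrt_pos.2 hr).ne'
  have : ContinuousAt (fun r : ℝ => Complex.exp (-(w * ((√r)⁻¹ : ℝ)))) r := by fun_prop (disch := exact hs)
  refine this.congr ?_
  filter_upwards [Ioi_mem_nhds hr] with x hx using (expInvSqrt_of_pos w hx).symm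

theorem norm_expInvSqrt (w : ℂ) {r : ℝ} (hr : 0 < r) :
    ‖expInvSqrt w r‖ = Real.exp (-(w.re * (√r)⁻¹)) := by
  rw [expInvSqrt_of_pos w hr, Complex.norm_exp, Complex.neg_re, Complex.re_mul_ofReal]

/-- With x = Re w / √r, the bound x e^{-x} ≤ 1 gives decay of order √r at 0. -/
theorem continuousOn_expInvSqrt {w : ℂ} (hw : 0 < w.re) :
    ContinuousOn (expInvSqrt w) (Set.Icc 0 1) := by
  refine continuousOn_Icc_of_norm_le_sqrt (C := w.re⁻¹) (fun r hr => continuousAt_expInvSqrt w hr)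
    fun r hr => ?_
  rcases hr.eq_or_lt with rfl | hr
  · simp [expInvSqrt_of_nonpos w le_rfl]
  · rw [norm_expInvSqrt w hr]
    have hs : 0 < √r := Real.sqrt_pos.2 hr
    have := mul_exp_neg_le_one (x := w.re * (√r)⁻¹)
    calc Real.exp (-(w.re * (√r)⁻¹))
        = (w.re⁻¹ * √r) * (w.re * (√r)⁻¹ * Real.exp (-(w.re * (√r)⁻¹))) := by field_simp
      _ ≤ (w.re⁻¹ * √r) * 1 := by gcongr
      _ = _ := mul_one _

theorem continuousOn_inv_sqrt_mul_expInvSqrt {w : ℂ} (hw : 0 < w.re) :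
    ContinuousOn (fun r => ((√r)⁻¹ : ℝ) * expInvSqrt w r) (Set.Icc 0 1) := by
  refine continuousOn_Icc_of_norm_le_sqrt (C := 2 * (w.re⁻¹) ^ 2) (fun r hr => ?_) fun r hr => ?_
  · have hs : √r ≠ 0 := (Real.sqrt_pos.2 hr).ne'
    exact ContinuousAt.mul (by fun_prop (disch := exact hs)) (continuousAt_expInvSqrt w hr)
  rcases hr.eq_or_lt with rfl | hr
  · simp [expInvSqrt_of_nonpos w le_rfl]
  · have hs : 0 < √r := Real.sqrt_pos.2 hr
    rw [norm_mul, norm_expInvSqrt w hr, Complex.norm_real, Real.norm_of_nonneg (by positivity)]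
    have := sq_mul_exp_neg_le_two (x := w.re * (√r)⁻¹) (by positivity)
    calc (√r)⁻¹ * Real.exp (-(w.re * (√r)⁻¹))
        = ((w.re⁻¹) ^ 2 * √r) * ((w.re * (√r)⁻¹) ^ 2 * Real.exp (-(w.re * (√r)⁻¹))) := by field_simp
      _ ≤ ((w.re⁻¹) ^ 2 * √r) * 2 := by gcongr
      _ = _ := by ring

/-- With μ = r^{-1/2} the mean value inequality gives ‖w - w'‖ μ e^{-mμ}, and mμ e^{-mμ} ≤ 1 removes
r. The bound is unchanged when w, w' and m are all multiplied by s > 0, which later yields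
uniformity in time. -/
theorem norm_expInvSqrt_sub_le {m : ℝ} (hm : 0 < m) {w w' : ℂ} (hw : m ≤ w.re) (hw' : m ≤ w'.re)
    {r : ℝ} : ‖expInvSqrt w r - expInvSqrt w' r‖ ≤ m⁻¹ * ‖w - w'‖ := by
  rcases le_or_gt r 0 with hr | hr
  · rw [expInvSqrt_of_nonpos w hr, expInvSqrt_of_nonpos w' hr, sub_zero, norm_zero]
    positivity
  · have hs : 0 < (√r)⁻¹ := inv_pos.2 (Real.sqrt_pos.2 hr)
    rw [expInvSqrt_of_pos w hr, expInvSqrt_of_pos w' hr]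
    refine (norm_exp_neg_sub_exp_neg_le (c := m * (√r)⁻¹) ?_ ?_).trans ?_
    · rw [Complex.re_mul_ofReal]; gcongr
    · rw [Complex.re_mul_ofReal]; gcongr
    · rw [← sub_mul, norm_mul, Complex.norm_real, Real.norm_of_nonneg hs.le]
      have := mul_exp_neg_le_one (x := m * (√r)⁻¹)
      calc Real.exp (-(m * (√r)⁻¹)) * (‖w - w'‖ * (√r)⁻¹)
          = m⁻¹ * ‖w - w'‖ * (m * (√r)⁻¹ * Real.exp (-(m * (√r)⁻¹))) := by
            field_simp
        _ ≤ m⁻¹ * ‖w - w'‖ * 1 := by gcongr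
        _ = _ := mul_one _

theorem norm_expInvSqrt_add_sub_le {w h : ℂ} (hw : 0 < w.re) (hh : ‖h‖ ≤ w.re / 2) {r : ℝ} :
    ‖expInvSqrt (w + h) r - expInvSqrt w r + h * (((√r)⁻¹ : ℝ) * expInvSqrt w r)‖
      ≤ 8 * (w.re⁻¹) ^ 2 * ‖h‖ ^ 2 := by
  rcases le_or_gt r 0 with hr | hr
  · rw [expInvSqrt_of_nonpos w hr, expInvSqrt_of_nonpos (w + h) hr]
    simp only [sub_zero, mul_zero, add_zero, norm_zero]
    positivity
  · have hs : 0 < (√r)⁻¹ := inv_pos.2 (Real.sqrt_pos.2 hr)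
    rw [expInvSqrt_of_pos w hr, expInvSqrt_of_pos (w + h) hr, add_mul, ← mul_assoc]
    refine norm_exp_neg_add_sub_le.trans ?_
    rw [Complex.re_mul_ofReal, norm_mul, Complex.norm_real, Real.norm_of_nonneg hs.le]
    set μ := (√r)⁻¹ with hμ
    -- The restriction ‖h‖ ≤ Re w / 2 lets half of the decay absorb e^{‖h‖μ}; the other half
    -- controls μ², and 8 = 4 · 2 with the 2 from x² e^{-x} ≤ 2.
    have h1 : ‖h‖ * μ - w.re * μ ≤ -(w.re / 2 * μ) := by nlinarith
    have h2 := sq_mul_exp_neg_le_two (x := w.re / 2 * μ) (by positivity)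
    calc (‖h‖ * μ) ^ 2 * Real.exp (‖h‖ * μ - w.re * μ)
        ≤ (‖h‖ * μ) ^ 2 * Real.exp (-(w.re / 2 * μ)) := by gcongr
      _ = 4 * (w.re⁻¹) ^ 2 * ‖h‖ ^ 2 * ((w.re / 2 * μ) ^ 2 * Real.exp (-(w.re / 2 * μ))) := by
        field_simp
        ring
      _ ≤ 4 * (w.re⁻¹) ^ 2 * ‖h‖ ^ 2 * 2 := by gcongr
      _ = _ := by ring

section Semigroup

variable {H : Type} [NormedAddCommGroup H] [InnerProductSpace ℂ H] [CompleteSpace H]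

/-- The operator `exp(-w R^{-1/2})`. -/
noncomputable def expOp (R : H →L[ℂ] H) (w : ℂ) : H →L[ℂ] H := opFun R (expInvSqrt w)

variable {R : H →L[ℂ] H} (h0 : 0 ≤ R) (h1 : R ≤ 1)
include h0 h1

theorem norm_expOp_le {w : ℂ} (hw : 0 ≤ w.re) : ‖expOp R w‖ ≤ 1 := by
  refine norm_opFun_le h0 h1 zero_le_one fun r hr => ?_
  rcases hr.1.eq_or_lt with rfl | hr0
  · simp [expInvSqrt_of_nonpos w le_rfl]
  · rw [norm_expInvSqrt w hr0]
    exact Real.exp_le_one_iff.2 (neg_nonpos.2 (by positivity))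

theorem expOp_add {w w' : ℂ} (hw : 0 < w.re) (hw' : 0 < w'.re) :
    expOp R (w + w') = expOp R w ∘L expOp R w' := by
  rw [expOp, expOp, expOp, ← opFun_mul h0 h1 (continuousOn_expInvSqrt hw)
    (continuousOn_expInvSqrt hw')]
  refine opFun_congr h0 h1 fun r hr => ?_
  rcases hr.1.eq_or_lt with rfl | hr0
  · simp [expInvSqrt_of_nonpos _ le_rfl]
  · simp only [expInvSqrt_of_pos _ hr0]
    rw [add_mul, neg_add, Complex.exp_add]

theorem norm_expOp_sub_le {m : ℝ} (hm : 0 < m) {w w' : ℂ} (hw : m ≤ w.re) (hw' : m ≤ w'.re) :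
    ‖expOp R w - expOp R w'‖ ≤ m⁻¹ * ‖w - w'‖ := by
  rw [expOp, expOp, ← opFun_sub h0 h1 (continuousOn_expInvSqrt (hm.trans_le hw))
    (continuousOn_expInvSqrt (hm.trans_le hw'))]
  exact norm_opFun_le h0 h1 (by positivity) fun r _ => norm_expInvSqrt_sub_le hm hw hw'

/-- The second-order Taylor bound for the scalar exponentials is uniform in r, so the functional
calculus turns it into differentiability in operator norm. -/
theorem hasDerivAt_expOp {w : ℂ} (hw : 0 < w.re) :
    HasDerivAt (expOp R) (-opFun R fun r => ((√r)⁻¹ : ℝ) * expInvSqrt w r) w := by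
  rw [hasDerivAt_iff_isLittleO_nhds_zero]
  have hO : (fun h : ℂ => expOp R (w + h) - expOp R w
      - h • (-opFun R fun r => ((√r)⁻¹ : ℝ) * expInvSqrt w r)) =O[𝓝 0] fun h => ‖h‖ ^ 2 := by
    refine Asymptotics.IsBigO.of_bound (8 * (w.re⁻¹) ^ 2) ?_
    filter_upwards [Metric.ball_mem_nhds (0 : ℂ) (half_pos hw)] with h hh
    have hh' : ‖h‖ < w.re / 2 := mem_ball_zero_iff.1 hh
    have hre : 0 < (w + h).re := by
      have := (abs_le.1 (Complex.abs_re_le_norm h)).1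
      rw [Complex.add_re]
      linarith
    have c1 := continuousOn_expInvSqrt hre
    have c2 := continuousOn_expInvSqrt hw
    have c3 := continuousOn_inv_sqrt_mul_expInvSqrt hw
    have c4 : ContinuousOn (fun r => expInvSqrt (w + h) r - expInvSqrt w r) (Set.Icc 0 1) :=
      c1.sub c2
    have c5 : ContinuousOn (fun r => h * (((√r)⁻¹ : ℝ) * expInvSqrt w r)) (Set.Icc 0 1) :=
      continuousOn_const.mul c3
    rw [smul_neg, sub_neg_eq_add, expOp, expOp, ← opFun_sub h0 h1 c1 c2,
      ← opFun_const_mul h0 h1 h c3, ← opFun_add h0 h1 c4 c5]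
    rw [Real.norm_of_nonneg (by positivity)]
    exact norm_opFun_le h0 h1 (by positivity) fun r _ => norm_expInvSqrt_add_sub_le hw hh'.le
  refine hO.trans_isLittleO ?_
  have := Asymptotics.isLittleO_norm_pow_id (E' := ℂ) one_lt_two
  exact this

/-- With μ = r^{-1/2} this is |e^{-wμ} - 1| ≤ |w|μ divided by μ. It gives convergence to the
identity on the range of R^{1/2}. -/
theorem norm_expOp_sub_one_comp_sqrt_le {w : ℂ} (hw : 0 < w.re) :
    ‖(expOp R w - 1) ∘L CFC.sqrt R‖ ≤ ‖w‖ := by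
  have c1 := continuousOn_expInvSqrt hw
  have c2 : ContinuousOn (fun r : ℝ => (√r : ℂ)) (Set.Icc 0 1) := by fun_prop
  have c3 : ContinuousOn (fun r => expInvSqrt w r - 1) (Set.Icc 0 1) := c1.sub continuousOn_const
  rw [expOp, ← opFun_one h0, ← opFun_sub h0 h1 c1 continuousOn_const, ← opFun_sqrt h0,
    ← opFun_mul h0 h1 c3 c2]
  refine norm_opFun_le h0 h1 (norm_nonneg _) fun r hr => ?_
  rcases hr.1.eq_or_lt with rfl | hr0
  · simp
  · have hs : 0 < √r := Real.sqrt_pos.2 hr0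
    rw [norm_mul, expInvSqrt_of_pos w hr0, Complex.norm_real, Real.norm_of_nonneg hs.le]
    have hv : 0 ≤ (w * ((√r)⁻¹ : ℝ)).re := by rw [Complex.re_mul_ofReal]; positivity
    refine (mul_le_mul_of_nonneg_right (norm_exp_neg_sub_one_le hv) hs.le).trans (le_of_eq ?_)
    rw [norm_mul, Complex.norm_real, Real.norm_of_nonneg (by positivity)]
    field_simp

/-- The second-order Taylor bound divided by μ² = 1/r; it gives the derivative at 0 on the range of
R. -/
theorem norm_expOp_sub_one_comp_add_le {w : ℂ} (hw : 0 < w.re) :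
    ‖(expOp R w - 1) ∘L CFC.sqrt R ∘L CFC.sqrt R + w • CFC.sqrt R‖ ≤ ‖w‖ ^ 2 := by
  have c1 := continuousOn_expInvSqrt hw
  have c2 : ContinuousOn (fun r : ℝ => (√r : ℂ)) (Set.Icc 0 1) := by fun_prop
  have c3 : ContinuousOn (fun r => expInvSqrt w r - 1) (Set.Icc 0 1) := c1.sub continuousOn_const
  have c4 : ContinuousOn (fun r : ℝ => (√r : ℂ) * √r) (Set.Icc 0 1) := c2.mul c2
  have c5 : ContinuousOn (fun r : ℝ => (expInvSqrt w r - 1) * ((√r : ℂ) * √r)) (Set.Icc 0 1) :=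
    c3.mul c4
  have c6 : ContinuousOn (fun r : ℝ => w * (√r : ℂ)) (Set.Icc 0 1) := continuousOn_const.mul c2
  rw [expOp, ← opFun_one h0, ← opFun_sub h0 h1 c1 continuousOn_const, ← opFun_sqrt h0,
    ← opFun_mul h0 h1 c2 c2, ← opFun_mul h0 h1 c3 c4,
    ← opFun_const_mul h0 h1 w c2, ← opFun_add h0 h1 c5 c6]
  refine norm_opFun_le h0 h1 (by positivity) fun r hr => ?_
  rcases hr.1.eq_or_lt with rfl | hr0
  · simp only [Real.sqrt_zero, Complex.ofReal_zero, mul_zero, add_zero, norm_zero]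
    positivity
  · have hs : 0 < √r := Real.sqrt_pos.2 hr0
    have hsc : (√r : ℂ) ≠ 0 := by exact_mod_cast hs.ne'
    rw [expInvSqrt_of_pos w hr0]
    have hv : 0 ≤ (w * ((√r)⁻¹ : ℝ)).re := by rw [Complex.re_mul_ofReal]; positivity
    have e : (Complex.exp (-(w * ((√r)⁻¹ : ℝ))) - 1) * ((√r : ℂ) * √r) + w * √r
        = (Complex.exp (-(w * ((√r)⁻¹ : ℝ))) - 1 + w * ((√r)⁻¹ : ℝ)) * ((√r : ℂ) * √r) := by
      push_cast
      field_simp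
    rw [e, norm_mul, norm_mul, Complex.norm_real, Real.norm_of_nonneg hs.le]
    refine (mul_le_mul_of_nonneg_right (norm_exp_neg_sub_one_add_le hv) (by positivity)).trans
      (le_of_eq ?_)
    rw [norm_mul, Complex.norm_real, Real.norm_of_nonneg (by positivity)]
    field_simp

theorem expOp_sqrt_comm {w : ℂ} (hw : 0 < w.re) (x : H) :
    CFC.sqrt R (expOp R w x) = expOp R w (CFC.sqrt R x) := by
  have c1 := continuousOn_expInvSqrt hw
  have c2 : ContinuousOn (fun r : ℝ => (√r : ℂ)) (Set.Icc 0 1) := by fun_prop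
  have e1 := opFun_mul h0 h1 c1 c2
  have e2 := opFun_mul h0 h1 c2 c1
  simp only [mul_comm (√_ : ℂ)] at e2
  rw [opFun_sqrt h0] at e1 e2
  exact DFunLike.congr_fun (e2.symm.trans e1) x

-- Uniform boundedness reduces strong convergence to a dense set, here the range of L.
omit h0 h1 [CompleteSpace H] in
theorem tendsto_apply_of_denseRange {ι : Type*} {l : Filter ι} {A : ι → H →L[ℂ] H} {B L : H →L[ℂ] H}
    {C : ℝ} (hA : ∀ᶠ i in l, ‖A i‖ ≤ C) (hL : DenseRange L)
    (h : ∀ x, Tendsto (fun i => A i (L x)) l (𝓝 (B (L x)))) (y : H) :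
    Tendsto (fun i => A i y) l (𝓝 (B y)) := by
  rw [Metric.tendsto_nhds]
  intro ε hε
  set K : ℝ := |C| + ‖B‖ + 1 with hK
  have hK0 : 0 < K := by positivity
  obtain ⟨x, hx⟩ := hL.exists_dist_lt y (show 0 < ε / (2 * K) by positivity)
  filter_upwards [hA, Metric.tendsto_nhds.1 (h x) (ε / 2) (half_pos hε)] with i hi hi2
  have e : A i y - B y = A i (y - L x) - B (y - L x) + (A i (L x) - B (L x)) := by
    simp only [map_sub]; abel
  rw [dist_eq_norm] at hx hi2 ⊢
  rw [e]
  have b1 : ‖A i (y - L x)‖ ≤ |C| * ‖y - L x‖ :=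
    ContinuousLinearMap.le_of_opNorm_le _ (hi.trans (le_abs_self C)) _
  have b2 : ‖B (y - L x)‖ ≤ ‖B‖ * ‖y - L x‖ := B.le_opNorm _
  have b3 : K * ‖y - L x‖ ≤ ε / 2 := by
    have := mul_le_mul_of_nonneg_left hx.le hK0.le
    refine this.trans (le_of_eq ?_)
    field_simp
  have b4 : ‖A i (y - L x) - B (y - L x)‖ ≤ K * ‖y - L x‖ := by
    refine (norm_sub_le _ _).trans ((add_le_add b1 b2).trans ?_)
    rw [← add_mul]
    exact mul_le_mul_of_nonneg_right (by linarith) (norm_nonneg _)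
  calc ‖A i (y - L x) - B (y - L x) + (A i (L x) - B (L x))‖
      ≤ ‖A i (y - L x) - B (y - L x)‖ + ‖A i (L x) - B (L x)‖ := norm_add_le _ _
    _ < ε / 2 + ε / 2 := add_lt_add_of_le_of_lt (b4.trans b3) hi2
    _ = ε := add_halves ε

variable (hR : ∀ x, R x = 0 → x = 0)
include hR

theorem sqrt_injective : Function.Injective (CFC.sqrt R : H →L[ℂ] H) := by
  refine (injective_iff_map_eq_zero (CFC.sqrt R : H →L[ℂ] H)).2 fun x hx => hR x ?_
  rw [← (sqrt_relations h0 h1).1 x, hx, map_zero]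

/-- The orthogonal complement of the range of the symmetric operator R^{1/2} is its kernel, which is
trivial. -/
theorem denseRange_sqrt : DenseRange (CFC.sqrt R : H →L[ℂ] H) := by
  have hs : ∀ x y, ⟪CFC.sqrt R x, y⟫_ℂ = ⟪x, CFC.sqrt R y⟫_ℂ :=
    ((ContinuousLinearMap.nonneg_iff_isPositive _).1 (CFC.sqrt_nonneg R)).isSymmetric
  have : ((CFC.sqrt R : H →L[ℂ] H).range).topologicalClosure = ⊤ := by
    rw [Submodule.topologicalClosure_eq_top_iff, Submodule.eq_bot_iff]
    intro x hx
    refine sqrt_injective h0 h1 hR ?_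
    rw [map_zero, ← inner_self_eq_zero (𝕜 := ℂ), ← hs]
    exact (Submodule.mem_orthogonal _ _).1 hx _ ⟨_, rfl⟩
  intro x
  have hx : x ∈ (CFC.sqrt R : H →L[ℂ] H).range.topologicalClosure := this ▸ Submodule.mem_top
  exact hx

theorem tendsto_expOp (x : H) :
    Tendsto (fun w => expOp R w x) (𝓝[{w : ℂ | 0 < w.re}] 0) (𝓝 x) := by
  have hc : Tendsto (fun w : ℂ => ‖w‖) (𝓝[{w : ℂ | 0 < w.re}] 0) (𝓝 0) := by
    simpa using (continuous_norm.tendsto (0 : ℂ)).mono_left nhdsWithin_le_nhds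
  refine tendsto_apply_of_denseRange (B := 1) (C := 1) (L := CFC.sqrt R) ?_
    (denseRange_sqrt h0 h1 hR) (fun y => ?_) x
  · filter_upwards [self_mem_nhdsWithin] with w hw using norm_expOp_le h0 h1 (le_of_lt hw)
  · rw [tendsto_iff_norm_sub_tendsto_zero]
    have := hc.mul_const ‖y‖
    rw [zero_mul] at this
    refine squeeze_zero_norm' ?_ this
    filter_upwards [self_mem_nhdsWithin] with w hw
    rw [norm_norm]
    exact ContinuousLinearMap.le_of_opNorm_le _ (norm_expOp_sub_one_comp_sqrt_le h0 h1 hw) y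

/-- The generator of `exp(-s σ R^{-1/2})`. -/
theorem tendsto_expOp_sub_iff {σ : ℂ} (hσ : 0 < σ.re) (y z : H) :
    Tendsto (fun s : ℝ≥0 => ((s : ℂ)⁻¹) • (expOp R (σ * s) y - y)) (𝓝[>] 0) (𝓝 (-z)) ↔
      ∃ x, CFC.sqrt R x = y ∧ z = σ • x := by
  have hσ0 : σ ≠ 0 := fun h => by simp [h] at hσ
  have hre : ∀ s : ℝ≥0, 0 < s → 0 < (σ * s).re := fun s hs => by
    rw [Complex.re_mul_ofReal]; exact mul_pos hσ (NNReal.coe_pos.2 hs)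
  have hlim : ∀ x, Tendsto (fun s : ℝ≥0 => ((s : ℂ)⁻¹) • (expOp R (σ * s) (CFC.sqrt R x)
      - CFC.sqrt R x)) (𝓝[>] 0) (𝓝 (-(σ • x))) := by
    intro x
    -- On the range of R^{1/2} the difference quotients are bounded by ‖σ‖, so it is enough to
    -- compute their limit on the range of R.
    refine tendsto_apply_of_denseRange (C := ‖σ‖) (L := CFC.sqrt R) (B := -(σ • 1))
      (A := fun s : ℝ≥0 => ((s : ℂ)⁻¹) • ((expOp R (σ * s) - 1) ∘L CFC.sqrt R)) ?_
      (denseRange_sqrt h0 h1 hR) (fun y => ?_) x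
    · filter_upwards [self_mem_nhdsWithin] with s hs
      have hs0 : (0 : ℝ) < s := NNReal.coe_pos.2 hs
      rw [norm_smul, norm_inv, Complex.norm_real, Real.norm_of_nonneg hs0.le]
      have := norm_expOp_sub_one_comp_sqrt_le h0 h1 (hre s hs)
      rw [norm_mul, Complex.norm_real, Real.norm_of_nonneg hs0.le] at this
      rw [inv_mul_le_iff₀ hs0, mul_comm (s : ℝ)]
      exact this
    · rw [tendsto_iff_norm_sub_tendsto_zero]
      have hc : Tendsto (fun s : ℝ≥0 => (s : ℝ) * ‖σ‖ ^ 2 * ‖y‖) (𝓝[>] 0) (𝓝 0) := by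
        have hc : Continuous fun s : ℝ≥0 => (s : ℝ) * ‖σ‖ ^ 2 * ‖y‖ := by fun_prop
        simpa using (hc.tendsto 0).mono_left (nhdsWithin_le_nhds (s := Set.Ioi 0))
      refine squeeze_zero_norm' ?_ hc
      filter_upwards [self_mem_nhdsWithin] with s hs
      have hs0 : (0 : ℝ) < s := NNReal.coe_pos.2 hs
      have hsc : (s : ℂ) ≠ 0 := by exact_mod_cast hs0.ne'
      have b := ContinuousLinearMap.le_of_opNorm_le _
        (norm_expOp_sub_one_comp_add_le h0 h1 (hre s hs)) y
      have e : (((s : ℂ)⁻¹) • ((expOp R (σ * s) - 1) ∘L CFC.sqrt R)) (CFC.sqrt R y)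
          - (-(σ • (1 : H →L[ℂ] H))) (CFC.sqrt R y)
          = ((s : ℂ)⁻¹) • (((expOp R (σ * s) - 1) ∘L CFC.sqrt R ∘L CFC.sqrt R
            + (σ * s) • CFC.sqrt R : H →L[ℂ] H) y) := by
        simp only [add_apply, smul_apply, neg_apply, ContinuousLinearMap.comp_apply, smul_add,
          smul_smul, one_apply_eq_self, sub_neg_eq_add]
        rw [mul_comm σ, inv_mul_cancel_left₀ hsc]
      rw [norm_norm, e, norm_smul, norm_inv, Complex.norm_real, Real.norm_of_nonneg hs0.le,
        inv_mul_le_iff₀ hs0]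
      refine b.trans (le_of_eq ?_)
      rw [norm_mul, Complex.norm_real, Real.norm_of_nonneg hs0.le]
      ring
  constructor
  · intro h
    -- Applying R^{1/2} to the assumed limit, and commuting it past the semigroup, gives R^{1/2}z =
    -- σ y; hence y is in the range of R^{1/2}.
    have h2 := ((CFC.sqrt R : H →L[ℂ] H).continuous.tendsto _).comp h
    have h3 := hlim y
    have heq : (CFC.sqrt R : H →L[ℂ] H) (-z) = -(σ • y) := by
      refine tendsto_nhds_unique h2 (h3.congr' ?_)
      filter_upwards [self_mem_nhdsWithin] with s hs
      simp only [Function.comp_apply, map_smul, map_sub]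
      rw [expOp_sqrt_comm h0 h1 (hre s hs)]
    refine ⟨σ⁻¹ • z, ?_, by rw [smul_smul, mul_inv_cancel₀ hσ0, one_smul]⟩
    rw [map_neg, neg_inj] at heq
    rw [map_smul, heq, smul_smul, inv_mul_cancel₀ hσ0, one_smul]
  · rintro ⟨x, rfl, rfl⟩
    exact hlim x

end Semigroup

/-! ### Sectors in which finitely many rays stay in the right half-plane -/

/-- Rotating σᵢ by less than θ keeps it in the right half-plane as soon as cos θ Re σᵢ > sin θ |Im
σᵢ|, which holds for small θ and finitely many i. -/
theorem exists_angle {n : Type*} [Finite n] {σ : n → ℂ} (hσ : ∀ i, 0 < (σ i).re) :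
    ∃ θ : ℝ, 0 < θ ∧ θ ≤ Real.pi / 2 ∧ ∀ z ∈ sector θ, ∀ i, 0 < (σ i * z).re := by
  have h1 : ∀ i, ∀ᶠ θ : ℝ in 𝓝[>] 0, 0 < Real.cos θ * (σ i).re - Real.sin θ * |(σ i).im| := by
    intro i
    have hc : Continuous fun θ : ℝ => Real.cos θ * (σ i).re - Real.sin θ * |(σ i).im| := by fun_prop
    refine nhdsWithin_le_nhds ((hc.tendsto 0).eventually (Ioi_mem_nhds ?_))
    simpa using hσ i
  have h2 : ∀ᶠ θ : ℝ in 𝓝[>] 0, θ ∈ Set.Ioo 0 (Real.pi / 2) := Ioo_mem_nhdsGT (by positivity)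
  obtain ⟨θ, hθ1, hθ2⟩ := ((eventually_all.2 h1).and h2).exists
  refine ⟨θ, hθ2.1, hθ2.2.le, fun z hz i => ?_⟩
  obtain ⟨hz0, hz1⟩ := hz
  have hn : 0 < ‖z‖ := norm_pos_iff.2 hz0
  have hcos : Real.cos θ < Real.cos z.arg := by
    rw [← Real.cos_abs z.arg]
    exact Real.cos_lt_cos_of_nonneg_of_le_pi_div_two (abs_nonneg _) hθ2.2.le hz1
  have hsin : |Real.sin z.arg| ≤ Real.sin θ := by
    rw [Real.abs_sin_eq_sin_abs_of_abs_le_pi (Complex.abs_arg_le_pi z)]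
    exact Real.sin_le_sin_of_le_of_le_pi_div_two (by linarith [abs_nonneg z.arg, Real.pi_pos])
      hθ2.2.le hz1.le
  have hre : z.re = ‖z‖ * Real.cos z.arg := (Complex.norm_mul_cos_arg z).symm
  have him : z.im = ‖z‖ * Real.sin z.arg := (Complex.norm_mul_sin_arg z).symm
  rw [Complex.mul_re, hre, him]
  have h3 : (σ i).im * Real.sin z.arg ≤ |(σ i).im| * Real.sin θ := by
    refine (le_abs_self _).trans ?_
    rw [abs_mul]
    exact mul_le_mul_of_nonneg_left hsin (abs_nonneg _)
  have h4 : Real.cos θ * (σ i).re < Real.cos z.arg * (σ i).re := mul_lt_mul_of_pos_right hcos (hσ i)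
  have h5 := hθ1 i
  have h6 : 0 < (σ i).re * Real.cos z.arg - (σ i).im * Real.sin z.arg := by linarith
  calc 0 < ‖z‖ * ((σ i).re * Real.cos z.arg - (σ i).im * Real.sin z.arg) := mul_pos hn h6
    _ = _ := by ring

/-! ### Matrices acting on powers of a space -/

section MatrixAction

variable {n : Type} [Fintype n] [DecidableEq n] {H : Type} [NormedAddCommGroup H]
  [InnerProductSpace ℂ H]

/-- The action of a complex matrix on `H^n`. -/
noncomputable def matAct (M : Matrix n n ℂ) : (n → H) →L[ℂ] (n → H) :=
  ∑ i, ∑ j, M i j • (ContinuousLinearMap.single ℂ (fun _ : n => H) i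
    ∘L ContinuousLinearMap.proj (φ := fun _ : n => H) j)

/-- The operator on `H^n` given by a diagonal matrix of operators. -/
noncomputable def diagAct (A : n → H →L[ℂ] H) : (n → H) →L[ℂ] (n → H) :=
  ∑ i, ContinuousLinearMap.single ℂ (fun _ : n => H) i ∘L A i
    ∘L ContinuousLinearMap.proj (φ := fun _ : n => H) i

theorem matAct_apply (M : Matrix n n ℂ) (x : n → H) (i : n) :
    matAct M x i = ∑ j, M i j • x j := by
  simp [matAct, sum_apply, Finset.sum_apply, Pi.single_apply]

theorem diagAct_apply (A : n → H →L[ℂ] H) (x : n → H) (i : n) : diagAct A x i = A i (x i) := by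
  simp [diagAct, sum_apply, Finset.sum_apply, Pi.single_apply]

theorem matAct_mul (M M' : Matrix n n ℂ) :
    (matAct (M * M') : (n → H) →L[ℂ] (n → H)) = matAct M ∘L matAct M' := by
  ext x i
  simp only [ContinuousLinearMap.comp_apply, matAct_apply, Matrix.mul_apply, Finset.sum_smul,
    Finset.smul_sum, smul_smul]
  exact Finset.sum_comm

theorem matAct_one : (matAct (1 : Matrix n n ℂ) : (n → H) →L[ℂ] (n → H)) = 1 := by
  ext x i
  simp [matAct_apply, Matrix.one_apply]

theorem matAct_diagonal (σ : n → ℂ) (x : n → H) (i : n) :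
    matAct (Matrix.diagonal σ) x i = σ i • x i := by
  simp [matAct_apply, Matrix.diagonal_apply]

theorem continuous_matAct :
    Continuous (matAct : Matrix n n ℂ → ((n → H) →L[ℂ] (n → H))) := by
  unfold matAct
  refine continuous_finsetSum _ fun i _ => continuous_finsetSum _ fun j _ => ?_
  exact (continuous_id.matrix_elem i j).smul continuous_const

theorem continuous_norm_matAct_sub (M₀ : Matrix n n ℂ) :
    Continuous fun M : Matrix n n ℂ => ‖(matAct M - matAct M₀ : (n → H) →L[ℂ] (n → H))‖ :=
  Continuous.norm (E := (n → H) →L[ℂ] (n → H)) (continuous_matAct.sub continuous_const)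

theorem continuous_norm_matAct :
    Continuous fun M : Matrix n n ℂ => ‖(matAct M : (n → H) →L[ℂ] (n → H))‖ :=
  Continuous.norm (E := (n → H) →L[ℂ] (n → H)) continuous_matAct

theorem diagAct_sub (A B : n → H →L[ℂ] H) : diagAct A - diagAct B = diagAct (fun i => A i - B i) := by
  ext x i
  simp [diagAct_apply]

theorem norm_diagAct_le {A : n → H →L[ℂ] H} {c : ℝ} (hc : 0 ≤ c) (h : ∀ i, ‖A i‖ ≤ c) :
    ‖diagAct A‖ ≤ c := by
  refine ContinuousLinearMap.opNorm_le_bound _ hc fun x => ?_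
  refine (pi_norm_le_iff_of_nonneg (by positivity)).2 fun i => ?_
  rw [diagAct_apply]
  exact (ContinuousLinearMap.le_of_opNorm_le _ (h i) _).trans
    (mul_le_mul_of_nonneg_left (norm_le_pi_norm x i) hc)

variable [CompleteSpace H]

/-- The semigroup generated by `-N R^{-1/2}` on `H^n`, where `N = Ψ diag(σ) Φ` with `Ψ = Φ⁻¹`. -/
noncomputable def matSemigroup (R : H →L[ℂ] H) (Φ Ψ : Matrix n n ℂ) (σ : n → ℂ) (z : ℂ) :
    (n → H) →L[ℂ] (n → H) :=
  matAct Ψ ∘L diagAct (fun i => expOp R (σ i * z)) ∘L matAct Φ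

/-- An invertible matrix acts as an isomorphism. -/
noncomputable def matEquiv (H : Type) [NormedAddCommGroup H] [InnerProductSpace ℂ H]
    {Φ Ψ : Matrix n n ℂ} (h1 : Ψ * Φ = 1) (h2 : Φ * Ψ = 1) :
    (n → H) ≃L[ℂ] (n → H) :=
  ContinuousLinearEquiv.equivOfInverse (matAct Φ) (matAct Ψ)
    (fun x => by
      have := DFunLike.congr_fun ((matAct_mul Ψ Φ).symm.trans (by rw [h1, matAct_one])) x
      exact this)
    (fun x => by
      have := DFunLike.congr_fun ((matAct_mul Φ Ψ).symm.trans (by rw [h2, matAct_one])) x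
      exact this)

variable {R : H →L[ℂ] H} (h0 : 0 ≤ R) (h1 : R ≤ 1) (hR : ∀ x, R x = 0 → x = 0)
include h0 h1 hR

theorem isBoundedHolomorphicSemigroup_diagAct {σ : n → ℂ} {θ : ℝ} (hθ0 : 0 < θ)
    (hθ1 : θ ≤ Real.pi / 2) (hθ : ∀ z ∈ sector θ, ∀ i, 0 < (σ i * z).re) :
    IsBoundedHolomorphicSemigroup θ 1 fun z => diagAct fun i => expOp R (σ i * z) where
  angle_pos := hθ0
  angle_le := hθ1
  differentiableOn := by
    unfold diagAct
    refine DifferentiableOn.fun_sum fun i _ => ?_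
    refine (differentiableOn_const _).clm_comp (DifferentiableOn.clm_comp ?_
      (differentiableOn_const _))
    intro z hz
    have h := (hasDerivAt_expOp h0 h1 (hθ z hz i)).differentiableAt
    exact (h.comp z (differentiableAt_id.const_mul (σ i))).differentiableWithinAt
  add z hz w hw := by
    ext x i
    simp only [ContinuousLinearMap.comp_apply, diagAct_apply]
    rw [mul_add, expOp_add h0 h1 (hθ z hz i) (hθ w hw i)]
    rfl
  tendsto x := by
    rw [tendsto_pi_nhds]
    intro i
    simp only [diagAct_apply]
    refine (tendsto_expOp h0 h1 hR (x i)).comp (tendsto_nhdsWithin_iff.2 ⟨?_, ?_⟩)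
    · have : Continuous fun z : ℂ => σ i * z := by fun_prop
      simpa using (this.tendsto 0).mono_left (nhdsWithin_le_nhds (s := sector θ))
    · filter_upwards [self_mem_nhdsWithin] with z hz using hθ z hz i
  norm_le z hz := norm_diagAct_le zero_le_one fun i => norm_expOp_le h0 h1 (hθ z hz i).le

theorem isGeneratedByNeg_diagAct {σ : n → ℂ} (hσ : ∀ i, 0 < (σ i).re) :
    IsGeneratedByNeg (fun s : ℝ≥0 => diagAct fun i => expOp R (σ i * s))
      fun y z => ∀ i, ∃ x, CFC.sqrt R x = y i ∧ z i = σ i • x := by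
  intro y z
  rw [tendsto_pi_nhds]
  refine forall_congr' fun i => ?_
  rw [← tendsto_expOp_sub_iff h0 h1 hR (hσ i)]
  simp only [Pi.smul_apply, Pi.sub_apply, diagAct_apply, Pi.neg_apply]

theorem exists_isBoundedHolomorphicSemigroup_matSemigroup {Φ Ψ : Matrix n n ℂ} {σ : n → ℂ}
    (hσ : ∀ i, 0 < (σ i).re) (hΨΦ : Ψ * Φ = 1) :
    ∃ θ : ℝ, IsBoundedHolomorphicSemigroup θ
      (‖(matAct Ψ : (n → H) →L[ℂ] (n → H))‖ * (1 * ‖(matAct Φ : (n → H) →L[ℂ] (n → H))‖))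
      (matSemigroup R Φ Ψ σ) := by
  obtain ⟨θ, hθ0, hθ1, hθ⟩ := exists_angle hσ
  exact ⟨θ, (isBoundedHolomorphicSemigroup_diagAct h0 h1 hR hθ0 hθ1 hθ).conj
    (matEquiv H hΨΦ (mul_eq_one_comm.1 hΨΦ))⟩

/-- The rows of Φ are left eigenvectors of N. Scalar matrices commute with R^{1/2} acting on each
component, so conjugation by Φ turns diag(σ) R^{-1/2} into N R^{-1/2}; with y = R^{1/2}x this is z =
N x. -/
theorem isGeneratedByNeg_matSemigroup {Φ Ψ N : Matrix n n ℂ} {σ : n → ℂ}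
    (hσ : ∀ i, 0 < (σ i).re) (hΨΦ : Ψ * Φ = 1) (hN : Φ * N = Matrix.diagonal σ * Φ) :
    IsGeneratedByNeg (fun s : ℝ≥0 => matSemigroup R Φ Ψ σ s)
      fun y z => ∃ x : n → H, (∀ i, CFC.sqrt R (x i) = y i) ∧ z = matAct N x := by
  have hΦΨ := mul_eq_one_comm.1 hΨΦ
  have h := isGeneratedByNeg_conj (matEquiv H hΨΦ hΦΨ) (isGeneratedByNeg_diagAct h0 h1 hR hσ)
  have hmm : ∀ (A B : Matrix n n ℂ) (x : n → H), matAct A (matAct B x) = matAct (A * B) x :=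
    fun A B x => by rw [matAct_mul]; rfl
  have hm1 : ∀ x : n → H, matAct (1 : Matrix n n ℂ) x = x := fun x => by rw [matAct_one]; rfl
  have hsq : ∀ (A : Matrix n n ℂ) (x : n → H) (i : n),
      CFC.sqrt R (matAct A x i) = matAct A (fun j => CFC.sqrt R (x j)) i := fun A x i => by
    simp only [matAct_apply, map_sum, map_smul]
  intro y z
  refine Iff.trans ?_ (h y z)
  show (∃ x : n → H, (∀ i, CFC.sqrt R (x i) = y i) ∧ z = matAct N x) ↔
    ∀ i, ∃ x, CFC.sqrt R x = matAct Φ y i ∧ matAct Φ z i = σ i • x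
  constructor
  · rintro ⟨x, hx, rfl⟩ i
    refine ⟨matAct Φ x i, ?_, ?_⟩
    · rw [hsq, funext hx]
    · rw [hmm, hN, ← hmm, matAct_diagonal]
  · intro hx
    choose x hx1 hx2 using hx
    refine ⟨matAct Ψ x, fun i => ?_, ?_⟩
    · rw [hsq, funext hx1, hmm, hΨΦ, hm1]
    · have h3 : matAct Φ z = matAct (Matrix.diagonal σ) x := by
        ext i
        rw [hx2, matAct_diagonal]
      rw [← hm1 z, ← hΨΦ, ← hmm, h3, hmm, hmm]
      have : Ψ * Matrix.diagonal σ = N * Ψ := by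
        calc Ψ * Matrix.diagonal σ = Ψ * (Matrix.diagonal σ * Φ) * Ψ := by
              rw [mul_assoc, mul_assoc, hΦΨ, mul_one]
          _ = N * Ψ := by rw [← hN, ← mul_assoc, hΨΦ, one_mul]
      rw [this]

-- The estimate is uniform over all s > 0: in `norm_expOp_sub_le` the lower bound on the real parts
-- is sm and the distance is s|σ - σ₀|, so s cancels.
omit hR in
theorem eventually_norm_matSemigroup_sub_le {ι : Type*} {l : Filter ι} {Φ Ψ : ι → Matrix n n ℂ}
    {σ : ι → n → ℂ} {Φ₀ Ψ₀ : Matrix n n ℂ} {σ₀ : n → ℂ} (hΦ : Tendsto Φ l (𝓝 Φ₀))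
    (hΨ : Tendsto Ψ l (𝓝 Ψ₀)) (hσ : Tendsto σ l (𝓝 σ₀)) (hσ₀ : ∀ i, 0 < (σ₀ i).re) {ε : ℝ}
    (hε : 0 < ε) :
    ∀ᶠ b in l, ∀ s : ℝ, 0 < s →
      ‖matSemigroup R (Φ b) (Ψ b) (σ b) s - matSemigroup R Φ₀ Ψ₀ σ₀ s‖ ≤ ε := by
  have key : ∀ {Θ : ι → Matrix n n ℂ} {Θ₀ : Matrix n n ℂ}, Tendsto Θ l (𝓝 Θ₀) →
      Tendsto (fun b => ‖(matAct (Θ b) : (n → H) →L[ℂ] (n → H))‖) l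
        (𝓝 ‖(matAct Θ₀ : (n → H) →L[ℂ] (n → H))‖) ∧
      Tendsto (fun b => ‖(matAct (Θ b) : (n → H) →L[ℂ] (n → H)) - matAct Θ₀‖) l (𝓝 0) := by
    intro Θ Θ₀ hΘ
    refine ⟨((continuous_norm_matAct (n := n) (H := H)).tendsto Θ₀).comp hΘ, ?_⟩
    have := ((continuous_norm_matAct_sub (n := n) (H := H) Θ₀).tendsto Θ₀).comp hΘ
    rwa [sub_self, ContinuousLinearMap.opNorm_zero] at this
  obtain ⟨hΦ1, hΦ2⟩ := key hΦ
  obtain ⟨hΨ1, hΨ2⟩ := key hΨ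
  -- A common lower bound for the real parts of σ₀, strict so that it persists for nearby σ.
  obtain ⟨m, hm, hm0⟩ : ∃ m : ℝ, (∀ i, m < (σ₀ i).re) ∧ m ∈ Set.Ioo (0 : ℝ) 1 :=
    ((eventually_all.2 fun i => nhdsWithin_le_nhds (Iio_mem_nhds (hσ₀ i))).and
      (Ioo_mem_nhdsGT one_pos)).exists
  have hσm : ∀ᶠ b in l, ∀ i, m < (σ b i).re := eventually_all.2 fun i =>
    (((Complex.continuous_re.comp (continuous_apply i)).tendsto σ₀).comp hσ).eventually
      (Ioi_mem_nhds (hm i))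
  let B : ι → ℝ := fun b =>
    ‖(matAct (Ψ b) : (n → H) →L[ℂ] (n → H))‖
        * (m⁻¹ * ‖σ b - σ₀‖ * ‖(matAct (Φ b) : (n → H) →L[ℂ] (n → H))‖)
      + ‖(matAct (Ψ b) : (n → H) →L[ℂ] (n → H)) - matAct Ψ₀‖
        * (1 * ‖(matAct (Φ b) : (n → H) →L[ℂ] (n → H))‖)
      + ‖(matAct Ψ₀ : (n → H) →L[ℂ] (n → H))‖
        * (1 * ‖(matAct (Φ b) : (n → H) →L[ℂ] (n → H)) - matAct Φ₀‖)
  have hB : Tendsto B l (𝓝 0) := by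
    have h1 := hΨ1.mul (((tendsto_iff_norm_sub_tendsto_zero.1 hσ).const_mul m⁻¹).mul hΦ1)
    have h2 := hΨ2.mul (hΦ1.const_mul 1)
    have h3 := (hΦ2.const_mul 1).const_mul ‖(matAct Ψ₀ : (n → H) →L[ℂ] (n → H))‖
    have h4 := (h1.add h2).add h3
    simp only [mul_zero, zero_mul, add_zero] at h4
    exact h4
  filter_upwards [hσm, hB.eventually (Iio_mem_nhds hε)] with b hb hBb s hs
  refine le_trans ?_ (le_of_lt hBb)
  have hcomp : ∀ {A B C : (n → H) →L[ℂ] (n → H)} {α : ℝ}, ‖B‖ ≤ α →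
      ‖A ∘L B ∘L C‖ ≤ ‖A‖ * (α * ‖C‖) := fun hB =>
    (ContinuousLinearMap.opNorm_comp_le _ _).trans (mul_le_mul_of_nonneg_left
      ((ContinuousLinearMap.opNorm_comp_le _ _).trans
        (mul_le_mul_of_nonneg_right hB (norm_nonneg _))) (norm_nonneg _))
  have hre : ∀ w : ℂ, m < w.re → s * m ≤ (w * (s : ℂ)).re := fun w hw => by
    rw [Complex.re_mul_ofReal, mul_comm]
    exact mul_le_mul_of_nonneg_right hw.le hs.le
  have hD : ‖diagAct (fun i => expOp R (σ b i * s)) - diagAct (fun i => expOp R (σ₀ i * s))‖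
      ≤ m⁻¹ * ‖σ b - σ₀‖ := by
    have hm1 : 0 ≤ m⁻¹ := inv_nonneg.2 hm0.1.le
    rw [diagAct_sub]
    refine norm_diagAct_le (by positivity) fun i => ?_
    refine (norm_expOp_sub_le h0 h1 (mul_pos hs hm0.1) (hre _ (hb i)) (hre _ (hm i))).trans ?_
    rw [← sub_mul, norm_mul, Complex.norm_real, Real.norm_of_nonneg hs.le, mul_inv]
    have h2 : ‖σ b i - σ₀ i‖ ≤ ‖σ b - σ₀‖ := norm_le_pi_norm (σ b - σ₀) i
    calc s⁻¹ * m⁻¹ * (‖σ b i - σ₀ i‖ * s) = m⁻¹ * ‖σ b i - σ₀ i‖ * (s⁻¹ * s) := by ring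
      _ ≤ m⁻¹ * ‖σ b - σ₀‖ := by
        rw [inv_mul_cancel₀ hs.ne', mul_one]
        gcongr
  have hD0 : ‖diagAct (fun i => expOp R (σ₀ i * s))‖ ≤ 1 :=
    norm_diagAct_le zero_le_one fun i =>
      norm_expOp_le h0 h1 ((mul_pos hs hm0.1).le.trans (hre _ (hm i)))
  have split : matSemigroup R (Φ b) (Ψ b) (σ b) s - matSemigroup R Φ₀ Ψ₀ σ₀ s
      = matAct (Ψ b) ∘L (diagAct (fun i => expOp R (σ b i * s))
          - diagAct (fun i => expOp R (σ₀ i * s))) ∘L matAct (Φ b)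
        + (matAct (Ψ b) - matAct Ψ₀) ∘L diagAct (fun i => expOp R (σ₀ i * s)) ∘L matAct (Φ b)
        + matAct Ψ₀ ∘L diagAct (fun i => expOp R (σ₀ i * s)) ∘L (matAct (Φ b) - matAct Φ₀) := by
    simp only [matSemigroup, ContinuousLinearMap.sub_comp, ContinuousLinearMap.comp_sub]
    abel
  rw [split]
  refine (norm_add₃_le (E := (n → H) →L[ℂ] (n → H))).trans ?_
  exact add_le_add (add_le_add (hcomp hD) (hcomp hD0)) (hcomp hD0)

end MatrixAction

/-! ### The Sobolev inequality and multiplication operators -/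

/-- Fatou's lemma along an a.e. convergent subsequence of L²-convergent functions. It lets Sobolev
bounds be checked on dense sets only. -/
theorem isClosed_eLpNorm_le {α E : Type*} [MeasurableSpace α] {μ : Measure α}
    [NormedAddCommGroup E] [NormedSpace ℂ E] (L : E →L[ℂ] Lp ℂ 2 μ) (p : ℝ≥0∞) (C : ℝ≥0) :
    IsClosed {e : E | eLpNorm (L e) p μ ≤ C * ‖e‖ₑ} := by
  refine IsSeqClosed.isClosed fun e e₀ he hlim => ?_
  have h1 : Tendsto (fun k => L (e k)) atTop (𝓝 (L e₀)) := (L.continuous.tendsto e₀).comp hlim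
  obtain ⟨k, hk, hae⟩ := (tendstoInMeasure_of_tendsto_Lp h1).exists_seq_tendsto_ae
  refine (Lp.eLpNorm_lim_le_liminf_eLpNorm (fun n => Lp.aestronglyMeasurable (L (e (k n)))) _
    hae).trans ?_
  have h2 : Tendsto (fun n => (C : ℝ≥0∞) * ‖e (k n)‖ₑ) atTop (𝓝 (C * ‖e₀‖ₑ)) :=
    ENNReal.Tendsto.const_mul ((continuous_enorm.tendsto e₀).comp (hlim.comp hk.tendsto_atTop))
      (Or.inr ENNReal.coe_ne_top)
  rw [← h2.liminf_eq]
  exact liminf_le_liminf (Eventually.of_forall fun n => he (k n))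

/-- Hölder's inequality with 1/p + 1/q = 1/2. -/
theorem exists_mul_operator {α E : Type*} [MeasurableSpace α] {μ : Measure α}
    [NormedAddCommGroup E] [NormedSpace ℂ E] (L : E →L[ℂ] Lp ℂ 2 μ) {p q : ℝ≥0∞}
    [ENNReal.HolderTriple p q 2] {C : ℝ≥0} (hL : ∀ e, eLpNorm (L e) q μ ≤ C * ‖e‖ₑ) {g : α → ℂ}
    (hg : MemLp g p μ) :
    ∃ m : E →L[ℂ] Lp ℂ 2 μ, ∀ e, (m e : α → ℂ) =ᵐ[μ] fun x => g x * L e x := by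
  have hbound : ∀ e : E, eLpNorm (fun x => g x * L e x) 2 μ ≤ eLpNorm g p μ * (C * ‖e‖ₑ) :=
    fun e => by
      have h : eLpNorm (g • (L e : α → ℂ)) 2 μ ≤ eLpNorm g p μ * eLpNorm (L e) q μ :=
        eLpNorm_smul_le_mul_eLpNorm (Lp.aestronglyMeasurable (L e)) hg.1
      exact h.trans (mul_le_mul_right (hL e) _)
  have hfin : ∀ e : E, eLpNorm g p μ * (C * ‖e‖ₑ) < ⊤ := fun e =>
    ENNReal.mul_lt_top hg.2 (ENNReal.mul_lt_top ENNReal.coe_lt_top (enorm_lt_top (x := e)))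
  have hmem : ∀ e, MemLp (fun x => g x * L e x) 2 μ := fun e =>
    ⟨hg.1.mul (Lp.aestronglyMeasurable (L e)), (hbound e).trans_lt (hfin e)⟩
  let ml : E →ₗ[ℂ] Lp ℂ 2 μ :=
    { toFun := fun e => (hmem e).toLp
      map_add' := fun e e' => by
        rw [← MemLp.toLp_add]
        refine MemLp.toLp_congr _ _ ?_
        rw [map_add]
        filter_upwards [Lp.coeFn_add (L e) (L e')] with x hx
        rw [hx, Pi.add_apply, Pi.add_apply, mul_add]
      map_smul' := fun c e => by
        rw [RingHom.id_apply, ← MemLp.toLp_const_smul]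
        refine MemLp.toLp_congr _ _ ?_
        rw [map_smul]
        filter_upwards [Lp.coeFn_smul c (L e)] with x hx
        rw [hx, Pi.smul_apply, Pi.smul_apply, smul_eq_mul, smul_eq_mul]
        ring }
  refine ⟨ml.mkContinuous ((eLpNorm g p μ).toReal * C) fun e => ?_, fun e => (hmem e).coeFn_toLp⟩
  show ‖(hmem e).toLp‖ ≤ _
  rw [Lp.norm_toLp]
  refine (ENNReal.toReal_mono (hfin e).ne (hbound e)).trans (le_of_eq ?_)
  rw [ENNReal.toReal_mul, ENNReal.toReal_mul, ENNReal.coe_toReal, toReal_enorm, mul_assoc]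

/-- Passes from the partial derivatives, which define the H¹-norm, to the operator norm of the
differential in the Gagliardo–Nirenberg–Sobolev inequality. -/
theorem norm_le_sum_norm_single {N : ℕ} {F : Type*} [NormedAddCommGroup F] [NormedSpace ℝ F]
    (L : EuclideanSpace ℝ (Fin N) →L[ℝ] F) :
    ‖L‖ ≤ ∑ i, ‖L (EuclideanSpace.single i 1)‖ := by
  refine ContinuousLinearMap.opNorm_le_bound _ (by positivity) fun x => ?_
  have hx : x = ∑ i, x i • EuclideanSpace.single i (1 : ℝ) := by
    ext j
    simp [Pi.single_apply]
  conv_lhs => rw [hx, map_sum]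
  rw [Finset.sum_mul]
  refine (norm_sum_le _ _).trans (Finset.sum_le_sum fun i _ => ?_)
  rw [map_smul, norm_smul, mul_comm]
  exact mul_le_mul_of_nonneg_left (PiLp.norm_apply_le x i) (norm_nonneg _)

/-! ### The square root of the resolvent and the form domain -/

section FormResolvent

variable {H K : Type} [NormedAddCommGroup H] [InnerProductSpace ℂ H] [CompleteSpace H]
  [NormedAddCommGroup K] [InnerProductSpace ℂ K] (V : Submodule ℂ (WithLp 2 (H × K)))
  [CompleteSpace V]

/-- The operator `R^{1/2}`, with `R = (I + A)⁻¹`. -/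
noncomputable def sqrtResolvent : H →L[ℂ] H := CFC.sqrt (formResolvent V)

theorem formResolvent_injective (hd : ∀ x : H, (∀ w ∈ V, ⟪w.fst, x⟫_ℂ = 0) → x = 0) (x : H)
    (hx : formResolvent V x = 0) : x = 0 := by
  set J := formEmbedding V with hJ
  have hin : ∀ w, ⟪w, J.adjoint x⟫_ℂ = ⟪J w, x⟫_ℂ := fun w => J.adjoint_inner_right w x
  have hQ : J.adjoint x = 0 := by
    have hx' : J (J.adjoint x) = 0 := hx
    rw [← inner_self_eq_zero (𝕜 := ℂ), hin, hx', inner_zero_left]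
  refine hd x fun w hw => ?_
  have := hin ⟨w, hw⟩
  rw [hQ, inner_zero_right] at this
  exact this.symm

theorem sqrtResolvent_sqrtResolvent (y : H) :
    sqrtResolvent V (sqrtResolvent V y) = formResolvent V y :=
  (sqrt_relations (formResolvent_nonneg_le_one V).1 (formResolvent_nonneg_le_one V).2).1 y

theorem inner_sqrtResolvent_left (x y : H) :
    ⟪sqrtResolvent V x, y⟫_ℂ = ⟪x, sqrtResolvent V y⟫_ℂ :=
  ((ContinuousLinearMap.nonneg_iff_isPositive _).1
    (CFC.sqrt_nonneg (formResolvent V))).isSymmetric x y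

theorem inner_formResolvent_left (y : H) :
    ⟪formResolvent V y, y⟫_ℂ = ⟪(formEmbedding V).adjoint y, (formEmbedding V).adjoint y⟫_ℂ :=
  ((formEmbedding V).adjoint_inner_right _ _).symm

/-- The element is J*y: its image is J J*y = R y and ‖J*y‖² = ⟪R y, y⟫ = ‖R^{1/2}y‖². On the dense
set of vectors x = R^{1/2}y, it says that R^{1/2} maps isometrically into the form domain. -/
theorem exists_mem_norm_eq_norm_sqrtResolvent (y : H) :
    ∃ w ∈ V, w.fst = sqrtResolvent V (sqrtResolvent V y) ∧ ‖w‖ = ‖sqrtResolvent V y‖ := by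
  rw [sqrtResolvent_sqrtResolvent]
  refine ⟨((formEmbedding V).adjoint y : V), ((formEmbedding V).adjoint y).2, rfl, ?_⟩
  have h := inner_sqrtResolvent_left V (sqrtResolvent V y) y
  rw [sqrtResolvent_sqrtResolvent, inner_formResolvent_left] at h
  have h2 := congrArg RCLike.re h
  rw [inner_self_eq_norm_sq (𝕜 := ℂ) (E := H)] at h2
  have h3 := (inner_self_eq_norm_sq (𝕜 := ℂ) (E := V) ((formEmbedding V).adjoint y)).symm.trans h2
  exact (sq_eq_sq₀ (norm_nonneg ((formEmbedding V).adjoint y)) (norm_nonneg _)).1 h3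

theorem denseRange_sqrtResolvent (hd : ∀ x : H, (∀ w ∈ V, ⟪w.fst, x⟫_ℂ = 0) → x = 0) :
    DenseRange (sqrtResolvent V) :=
  denseRange_sqrt (formResolvent_nonneg_le_one V).1 (formResolvent_nonneg_le_one V).2
    (formResolvent_injective V hd)

end FormResolvent

/-! ### The critical Sobolev embedding and the potential f'(u*) -/

section Sobolev

variable {N : ℕ} {Ω : Set (EuclideanSpace ℝ (Fin N))}

theorem eLpNorm_fderiv_le_of_mem_testGradients
    {w : WithLp 2 (X Ω × PiLp 2 (fun _ : Fin N => X Ω))}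
    {φ : EuclideanSpace ℝ (Fin N) → ℂ} (hφ : ContDiff ℝ ∞ φ) (hsub : tsupport φ ⊆ Ω)
    (hw : ∀ i, (w.snd i : EuclideanSpace ℝ (Fin N) → ℂ) =ᵐ[volume.restrict Ω]
      fun x => fderiv ℝ φ x (EuclideanSpace.single i 1)) :
    eLpNorm (fderiv ℝ φ) 2 volume ≤ N * ‖w‖ₑ := by
  have hc : Continuous (fderiv ℝ φ) := hφ.continuous_fderiv (by simp)
  have hci : ∀ i : Fin N, Continuous fun x => fderiv ℝ φ x (EuclideanSpace.single i 1) :=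
    fun i => hc.clm_apply continuous_const
  have hi : ∀ i : Fin N,
      eLpNorm (fun x => ‖fderiv ℝ φ x (EuclideanSpace.single i 1)‖) 2 volume ≤ ‖w‖ₑ := fun i => by
    have hs : Function.support (fun x => fderiv ℝ φ x (EuclideanSpace.single i 1)) ⊆ Ω := by
      intro x hx
      refine hsub (support_fderiv_subset ℝ (f := φ) ?_)
      intro h0
      exact hx (by simp [h0])
    rw [eLpNorm_norm, ← eLpNorm_restrict_eq_of_support_subset hs, ← eLpNorm_congr_ae (hw i),
      ← Lp.enorm_def]
    have h1 : ‖w.snd i‖ ≤ ‖w.snd‖ := PiLp.norm_apply_le w.snd i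
    have h2 : ‖w.snd‖ ≤ ‖w‖ := by
      refine le_of_sq_le_sq ?_ (norm_nonneg _)
      rw [WithLp.prod_norm_sq_eq_of_L2 w]
      linarith [sq_nonneg ‖w.fst‖]
    rw [enorm_le_iff_norm_le]
    exact h1.trans h2
  calc eLpNorm (fderiv ℝ φ) 2 volume
      ≤ eLpNorm (∑ i : Fin N, fun x => ‖fderiv ℝ φ x (EuclideanSpace.single i 1)‖) 2 volume := by
        refine eLpNorm_mono_real fun x => ?_
        rw [Finset.sum_apply]
        exact norm_le_sum_norm_single _
    _ ≤ ∑ i : Fin N, eLpNorm (fun x => ‖fderiv ℝ φ x (EuclideanSpace.single i 1)‖) 2 volume :=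
        eLpNorm_sum_le (fun i _ => (hci i).norm.aestronglyMeasurable) (by norm_num)
    _ ≤ ∑ _i : Fin N, ‖w‖ₑ := Finset.sum_le_sum fun i _ => hi i
    _ = N * ‖w‖ₑ := by simp

/-- The critical Sobolev exponent `2N/(N-2)`. -/
noncomputable def sobolevExponent (N : ℕ) : ℝ≥0 := (2 * N / ((N : ℝ) - 2)).toNNReal

theorem coe_sobolevExponent (hN : 3 ≤ N) : (sobolevExponent N : ℝ) = 2 * N / ((N : ℝ) - 2) := by
  have : (3 : ℝ) ≤ N := by exact_mod_cast hN
  exact Real.coe_toNNReal _ (div_nonneg (by positivity) (by linarith))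

/-- Gagliardo–Nirenberg–Sobolev for test functions; the inequality is a closed condition, so it
passes to H¹₀. -/
theorem exists_eLpNorm_le_of_mem_H10 (hN : 3 ≤ N) :
    ∃ C : ℝ≥0, ∀ w ∈ H10 Ω, eLpNorm w.fst (sobolevExponent N) (volume.restrict Ω) ≤ C * ‖w‖ₑ := by
  have hN' : (3 : ℝ) ≤ N := by exact_mod_cast hN
  set C₀ : ℝ≥0 := eLpNormLESNormFDerivOfEqInnerConst
    (volume : Measure (EuclideanSpace ℝ (Fin N))) ((2 : ℝ≥0) : ℝ)
  refine ⟨C₀ * N, fun w hw => ?_⟩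
  have hcl := isClosed_eLpNorm_le (WithLp.fstL 2 ℂ (X Ω) (PiLp 2 (fun _ : Fin N => X Ω)))
    (sobolevExponent N) (C₀ * N)
  refine closure_minimal ?_ hcl hw
  rintro v ⟨φ, h1, h2, h3, h4, h5⟩
  show eLpNorm v.fst _ _ ≤ _
  rw [eLpNorm_congr_ae h4]
  have hfr : Module.finrank ℝ (EuclideanSpace ℝ (Fin N)) = N := finrank_euclideanSpace_fin
  have hgns := eLpNorm_le_eLpNorm_fderiv_of_eq_inner
    (volume : Measure (EuclideanSpace ℝ (Fin N))) (h1.of_le (by simp)) h2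
    (p := 2) (p' := sobolevExponent N) one_le_two (by rw [hfr]; omega)
    (by
      rw [coe_sobolevExponent hN, hfr, inv_div]
      have : (N : ℝ) ≠ 0 := by positivity
      push_cast
      field_simp)
  calc eLpNorm φ (sobolevExponent N) (volume.restrict Ω)
      ≤ eLpNorm φ (sobolevExponent N) volume := eLpNorm_mono_measure _ Measure.restrict_le_self
    _ ≤ C₀ * eLpNorm (fderiv ℝ φ) 2 volume := hgns
    _ ≤ C₀ * (N * ‖v‖ₑ) := mul_le_mul_right
        (eLpNorm_fderiv_le_of_mem_testGradients h1 h3 h5) _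
    _ = ((C₀ * N : ℝ≥0) : ℝ≥0∞) * ‖v‖ₑ := by push_cast; rw [mul_assoc]

/-- On the dense range of R^{1/2} the value R^{1/2}x is the function of an element of H¹₀ with norm
‖x‖, so the Sobolev bound applies and extends by closedness. -/
theorem exists_eLpNorm_sqrtResolvent_le (hN : 3 ≤ N) (hΩ : IsOpen Ω) :
    ∃ C : ℝ≥0, ∀ x : X Ω, eLpNorm (sqrtResolvent (H10 Ω) x) (sobolevExponent N)
      (volume.restrict Ω) ≤ C * ‖x‖ₑ := by
  obtain ⟨C, hC⟩ := exists_eLpNorm_le_of_mem_H10 (Ω := Ω) hN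
  refine ⟨C, fun x => ?_⟩
  have hcl := isClosed_eLpNorm_le (sqrtResolvent (H10 Ω)) (sobolevExponent N) C
  refine closure_minimal ?_ hcl
    (denseRange_sqrtResolvent (H10 Ω) (eq_zero_of_orthogonal_H10 hΩ) x)
  rintro _ ⟨y, rfl⟩
  obtain ⟨w, hw, hw1, hw2⟩ := exists_mem_norm_eq_norm_sqrtResolvent (H10 Ω) y
  have h := hC w hw
  rw [hw1] at h
  refine h.trans (le_of_eq ?_)
  rw [← ofReal_norm, ← ofReal_norm, hw2]

/-- The potential `f'(u*)` belongs to `L^N`. -/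
theorem memLp_deriv_comp (hN : 3 ≤ N) (hΩ : Bornology.IsBounded Ω) {f : ℝ → ℝ} {c ρ : ℝ}
    (hc : 0 < c) (hρ₀ : ((N : ℝ) - 1) / ((N : ℝ) - 2) ≤ ρ) (hρ₁ : ρ < (N : ℝ) / ((N : ℝ) - 2))
    (hf : ContDiff ℝ 1 f) (hg : ∀ s, |deriv f s| ≤ c * (1 + |s| ^ (ρ - 1))) {u : X Ω}
    (hu : MemLp u (sobolevExponent N) (volume.restrict Ω)) :
    MemLp (fun x => ((deriv f (u x).re : ℝ) : ℂ)) N (volume.restrict Ω) := by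
  have hN' : (3 : ℝ) ≤ N := by exact_mod_cast hN
  have hfinite : IsFiniteMeasure ((volume : Measure (EuclideanSpace ℝ (Fin N))).restrict Ω) :=
    ⟨by rw [Measure.restrict_apply_univ]; exact hΩ.measure_lt_top⟩
  have hq : ((sobolevExponent N : ℝ≥0∞) / N).toReal = 2 / ((N : ℝ) - 2) := by
    rw [ENNReal.toReal_div, ENNReal.coe_toReal, coe_sobolevExponent hN, ENNReal.toReal_natCast]
    have : (N : ℝ) - 2 ≠ 0 := by linarith
    field_simp
  have hs0 : (sobolevExponent N : ℝ≥0∞) ≠ 0 := by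
    rw [ENNReal.coe_ne_zero, ← NNReal.coe_ne_zero, coe_sobolevExponent hN]
    exact (div_pos (by linarith) (by linarith)).ne'
  -- If u ∈ L^q with q = 2N/(N-2), then |u|^{q/N} = |u|^{2/(N-2)} belongs to L^N.
  have h1 := hu.norm_rpow_div ((sobolevExponent N : ℝ≥0∞) / N)
  rw [hq, ENNReal.div_div_cancel hs0 ENNReal.coe_ne_top] at h1
  -- The constant 2 collects the 1 in the growth condition and the bound for |u|^{ρ-1} where |u| ≤
  -- 1; constants are in L^N as Ω has finite measure.
  have h2 : MemLp (fun x => c * (2 + ‖u x‖ ^ (2 / ((N : ℝ) - 2)))) N (volume.restrict Ω) :=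
    ((memLp_const (2 : ℝ)).add h1).const_mul c
  refine h2.mono' ?_ (Eventually.of_forall fun x => ?_)
  · have hcont : Continuous fun z : ℂ => ((deriv f z.re : ℝ) : ℂ) :=
      Complex.continuous_ofReal.comp ((hf.continuous_deriv le_rfl).comp Complex.continuous_re)
    exact hcont.comp_aestronglyMeasurable (Lp.aestronglyMeasurable u)
  · rw [Complex.norm_real, Real.norm_eq_abs]
    refine (hg _).trans (mul_le_mul_of_nonneg_left ?_ hc.le)
    have hρ1 : 0 ≤ ρ - 1 := by
      have : 1 ≤ ((N : ℝ) - 1) / ((N : ℝ) - 2) := by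
        rw [le_div_iff₀ (by linarith)]; linarith
      linarith
    have hρ2 : ρ - 1 ≤ 2 / ((N : ℝ) - 2) := by
      have : (N : ℝ) / ((N : ℝ) - 2) = 1 + 2 / ((N : ℝ) - 2) := by
        have : (N : ℝ) - 2 ≠ 0 := by linarith
        field_simp
        ring
      linarith
    have h3 : |(u x).re| ^ (ρ - 1) ≤ ‖u x‖ ^ (ρ - 1) :=
      Real.rpow_le_rpow (abs_nonneg _) (Complex.abs_re_le_norm _) hρ1
    have h4 : ‖u x‖ ^ (ρ - 1) ≤ 1 + ‖u x‖ ^ (2 / ((N : ℝ) - 2)) := by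
      have hpos : 0 ≤ ‖u x‖ ^ (2 / ((N : ℝ) - 2)) := Real.rpow_nonneg (norm_nonneg _) _
      rcases le_total ‖u x‖ 1 with h | h
      · have := Real.rpow_le_one (norm_nonneg (u x)) h hρ1
        linarith
      · have := Real.rpow_le_rpow_of_exponent_le h hρ2
        linarith
    linarith

/-- Multiplication by `f'(u*)` is bounded from `X^{1/2}` to `X`. -/
theorem exists_mul_deriv_operator (hN : 3 ≤ N) (hΩo : IsOpen Ω) (hΩ : Bornology.IsBounded Ω)
    {f : ℝ → ℝ} {c ρ : ℝ} (hc : 0 < c) (hρ₀ : ((N : ℝ) - 1) / ((N : ℝ) - 2) ≤ ρ)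
    (hρ₁ : ρ < (N : ℝ) / ((N : ℝ) - 2)) (hf : ContDiff ℝ 1 f)
    (hg : ∀ s, |deriv f s| ≤ c * (1 + |s| ^ (ρ - 1))) {u h : X Ω} (hu : (u, h) ∈ laplacian Ω) :
    ∃ m : X Ω →L[ℂ] X Ω, ∀ x, (m x : EuclideanSpace ℝ (Fin N) → ℂ) =ᵐ[volume.restrict Ω]
      fun y => ((deriv f (u y).re : ℝ) : ℂ) * sqrtResolvent (H10 Ω) x y := by
  have hN' : (3 : ℝ) ≤ N := by exact_mod_cast hN
  obtain ⟨C₁, hC₁⟩ := exists_eLpNorm_le_of_mem_H10 (Ω := Ω) hN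
  obtain ⟨C, hC⟩ := exists_eLpNorm_sqrtResolvent_le hN hΩo
  obtain ⟨w, hw, hwu, -⟩ := hu
  have hum : MemLp u (sobolevExponent N) (volume.restrict Ω) := by
    refine ⟨Lp.aestronglyMeasurable u, ?_⟩
    have h1 := hC₁ w hw
    have hwu' : w.fst = u := hwu
    rw [hwu'] at h1
    exact h1.trans_lt (ENNReal.mul_lt_top ENNReal.coe_lt_top enorm_lt_top)
  have hg' := memLp_deriv_comp hN hΩ hc hρ₀ hρ₁ hf hg hum
  -- The exponents match exactly: 1/N + (N-2)/(2N) = 1/2.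
  have hH : ENNReal.HolderTriple (N : ℝ≥0∞) (sobolevExponent N) 2 := by
    refine ⟨?_⟩
    have hs : 0 < (sobolevExponent N : ℝ) := by
      rw [coe_sobolevExponent hN]; exact div_pos (by linarith) (by linarith)
    rw [← ENNReal.coe_natCast, ← ENNReal.coe_inv (by positivity),
      ← ENNReal.coe_inv (NNReal.coe_pos.1 hs).ne', ← ENNReal.coe_ofNat,
      ← ENNReal.coe_inv (by norm_num), ← ENNReal.coe_add, ENNReal.coe_inj, ← NNReal.coe_inj]
    push_cast
    rw [coe_sobolevExponent hN]
    have h2 : (N : ℝ) - 2 ≠ 0 := by linarith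
    have h3 : (N : ℝ) ≠ 0 := by positivity
    field_simp
    ring
  exact exists_mul_operator (sqrtResolvent (H10 Ω)) hC hg'

end Sobolev

/-! ### The principal part of the linearized operator -/

/-- A root of `σ² - (η - ib) σ + 1`. -/
noncomputable def charRoot (η b : ℝ) : ℂ :=
  (((η : ℂ) - Complex.I * b) + (((η : ℂ) - Complex.I * b) ^ 2 - 4) ^ (2⁻¹ : ℂ)) / 2

/-- The other root of `σ² - (η - ib) σ + 1`. -/
noncomputable def charRoot' (η b : ℝ) : ℂ :=
  (((η : ℂ) - Complex.I * b) - (((η : ℂ) - Complex.I * b) ^ 2 - 4) ^ (2⁻¹ : ℂ)) / 2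

theorem charRoot_add (η b : ℝ) : charRoot η b + charRoot' η b = η - Complex.I * b := by
  unfold charRoot charRoot'
  ring

theorem charRoot_mul (η b : ℝ) : charRoot η b * charRoot' η b = 1 := by
  have h : ((((η : ℂ) - Complex.I * b) ^ 2 - 4) ^ (2⁻¹ : ℂ)) ^ 2
      = ((η : ℂ) - Complex.I * b) ^ 2 - 4 := by
    have := Complex.cpow_nat_inv_pow (((η : ℂ) - Complex.I * b) ^ 2 - 4) (n := 2) (by norm_num)
    exact_mod_cast this
  unfold charRoot charRoot'
  linear_combination (-1 / 4 : ℂ) * h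

/-- Its imaginary part is -2ηb ≠ 0. This keeps the roots distinct and the principal square root
continuous in b. -/
theorem discriminant_mem_slitPlane {η b : ℝ} (hη : 0 < η) (hb : b ≠ 0) :
    ((η : ℂ) - Complex.I * b) ^ 2 - 4 ∈ Complex.slitPlane := by
  refine Or.inr ?_
  have : (((η : ℂ) - Complex.I * b) ^ 2 - 4).im = -(2 * η * b) := by
    simp [sq]
    ring
  rw [this, neg_ne_zero]
  positivity

theorem charRoot_ne {η b : ℝ} (hη : 0 < η) (hb : b ≠ 0) : charRoot η b - charRoot' η b ≠ 0 := by
  have h : charRoot η b - charRoot' η b = (((η : ℂ) - Complex.I * b) ^ 2 - 4) ^ (2⁻¹ : ℂ) := by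
    unfold charRoot charRoot'
    ring
  rw [h, Ne, Complex.cpow_eq_zero_iff]
  exact fun h0 => Complex.slitPlane_ne_zero (discriminant_mem_slitPlane hη hb) h0.1

/-- The real parts of z and z⁻¹ have the same sign, which is therefore the sign of the real part of
their sum. -/
theorem re_pos_of_mul_eq_one {z w : ℂ} (h : z * w = 1) (hs : 0 < (z + w).re) : 0 < z.re := by
  have hz : z ≠ 0 := left_ne_zero_of_mul_eq_one h
  have hw : w = z⁻¹ := eq_inv_of_mul_eq_one_right h
  have hn : 0 < Complex.normSq z := Complex.normSq_pos.2 hz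
  rw [hw, Complex.add_re, Complex.inv_re] at hs
  by_contra hneg
  have := div_nonpos_of_nonpos_of_nonneg (not_lt.1 hneg) hn.le
  linarith [not_lt.1 hneg]

theorem charRoot_re_pos {η : ℝ} (hη : 0 < η) (b : ℝ) : 0 < (charRoot η b).re :=
  re_pos_of_mul_eq_one (charRoot_mul η b) (by rw [charRoot_add]; simpa using hη)

theorem charRoot'_re_pos {η : ℝ} (hη : 0 < η) (b : ℝ) : 0 < (charRoot' η b).re :=
  re_pos_of_mul_eq_one ((mul_comm _ _).trans (charRoot_mul η b))
    (by rw [add_comm, charRoot_add]; simpa using hη)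

theorem continuousAt_discriminant {η b : ℝ} (hη : 0 < η) (hb : b ≠ 0) :
    ContinuousAt (fun b : ℝ => (((η : ℂ) - Complex.I * b) ^ 2 - 4) ^ (2⁻¹ : ℂ)) b :=
  ContinuousAt.cpow (by fun_prop) continuousAt_const (discriminant_mem_slitPlane hη hb)

theorem continuousAt_charRoot {η b : ℝ} (hη : 0 < η) (hb : b ≠ 0) :
    ContinuousAt (charRoot η) b := by
  have := continuousAt_discriminant hη hb
  unfold charRoot
  fun_prop

theorem continuousAt_charRoot' {η b : ℝ} (hη : 0 < η) (hb : b ≠ 0) :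
    ContinuousAt (charRoot' η) b := by
  have := continuousAt_discriminant hη hb
  unfold charRoot'
  fun_prop

/-- The matrix of the principal part. -/
noncomputable def principalMatrix (η b : ℝ) : Matrix (Fin 4) (Fin 4) ℂ :=
  !![0, -1, 0, 0; 1, η, 0, b; 0, 0, 0, -1; 0, -b, 1, η]

/-- The left eigenvectors of the principal matrix. -/
noncomputable def principalLeft (η b : ℝ) : Matrix (Fin 4) (Fin 4) ℂ :=
  !![charRoot η b, 1, Complex.I * charRoot η b, Complex.I;
    charRoot' η b, 1, Complex.I * charRoot' η b, Complex.I;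
    charRoot η (-b), 1, -(Complex.I * charRoot η (-b)), -Complex.I;
    charRoot' η (-b), 1, -(Complex.I * charRoot' η (-b)), -Complex.I]

/-- The inverse of `principalLeft`. -/
noncomputable def principalRight (η b : ℝ) : Matrix (Fin 4) (Fin 4) ℂ :=
  let α := charRoot η b
  let β := charRoot' η b
  let γ := charRoot η (-b)
  let δ := charRoot' η (-b)
  let d := (α - β)⁻¹ / 2
  let e := (γ - δ)⁻¹ / 2
  !![d, -d, e, -e;
    -(β * d), α * d, -(δ * e), γ * e;
    -(Complex.I * d), Complex.I * d, Complex.I * e, -(Complex.I * e);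
    Complex.I * (β * d), -(Complex.I * (α * d)), -(Complex.I * (δ * e)), Complex.I * (γ * e)]

/-- The eigenvalues of the principal matrix. -/
noncomputable def principalEigenvalue (η b : ℝ) : Fin 4 → ℂ :=
  ![charRoot' η b, charRoot η b, charRoot' η (-b), charRoot η (-b)]

theorem principalEigenvalue_re_pos {η : ℝ} (hη : 0 < η) (b : ℝ) (i : Fin 4) :
    0 < (principalEigenvalue η b i).re := by
  fin_cases i
  exacts [charRoot'_re_pos hη b, charRoot_re_pos hη b, charRoot'_re_pos hη (-b),
    charRoot_re_pos hη (-b)]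

/-- The first two rows pair v with v + iz, the last two with v - iz, which changes b to -b. The row
built on a root α has as eigenvalue the other root β, since η - ib - α = β and αβ = 1; hence the
roots are interchanged in `principalEigenvalue`. -/
theorem principalLeft_mul (η b : ℝ) : principalLeft η b * principalMatrix η b
    = Matrix.diagonal (principalEigenvalue η b) * principalLeft η b := by
  have s1 := charRoot_add η b
  have m1 := charRoot_mul η b
  have s2 := charRoot_add η (-b)
  have m2 := charRoot_mul η (-b)
  push_cast at s2
  have hI : Complex.I ^ 2 = -1 := Complex.I_sq
  ext i j
  rw [Matrix.diagonal_mul]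
  fin_cases i <;> fin_cases j <;>
    simp [principalLeft, principalMatrix, principalEigenvalue, Matrix.mul_apply,
      Fin.sum_univ_four] <;> grind

theorem principalLeft_mul_principalRight {η b : ℝ} (hη : 0 < η) (hb : b ≠ 0) :
    principalLeft η b * principalRight η b = 1 := by
  have d1 := charRoot_ne hη hb
  have d2 := charRoot_ne hη (neg_ne_zero.2 hb)
  have hI : Complex.I ^ 2 = -1 := Complex.I_sq
  ext i j
  fin_cases i <;> fin_cases j <;>
    simp [principalLeft, principalRight, Matrix.mul_apply, Fin.sum_univ_four] <;> grind

theorem principalRight_mul_principalLeft {η b : ℝ} (hη : 0 < η) (hb : b ≠ 0) :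
    principalRight η b * principalLeft η b = 1 :=
  mul_eq_one_comm.1 (principalLeft_mul_principalRight hη hb)

theorem continuousAt_principalEigenvalue {η b : ℝ} (hη : 0 < η) (hb : b ≠ 0) :
    ContinuousAt (principalEigenvalue η) b := by
  have h1 := continuousAt_charRoot hη hb
  have h2 := continuousAt_charRoot' hη hb
  have h3 : ContinuousAt (fun b => charRoot η (-b)) b :=
    ContinuousAt.comp (f := fun b : ℝ => -b) (continuousAt_charRoot hη (neg_ne_zero.2 hb))
      continuousAt_neg
  have h4 : ContinuousAt (fun b => charRoot' η (-b)) b :=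
    ContinuousAt.comp (f := fun b : ℝ => -b) (continuousAt_charRoot' hη (neg_ne_zero.2 hb))
      continuousAt_neg
  refine continuousAt_pi.2 fun i => ?_
  fin_cases i
  exacts [h2, h1, h4, h3]

theorem continuousAt_principalLeft {η b : ℝ} (hη : 0 < η) (hb : b ≠ 0) :
    ContinuousAt (principalLeft η) b := by
  have h1 := continuousAt_charRoot hη hb
  have h2 := continuousAt_charRoot' hη hb
  have h3 : ContinuousAt (fun b => charRoot η (-b)) b :=
    ContinuousAt.comp (f := fun b : ℝ => -b) (continuousAt_charRoot hη (neg_ne_zero.2 hb))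
      continuousAt_neg
  have h4 : ContinuousAt (fun b => charRoot' η (-b)) b :=
    ContinuousAt.comp (f := fun b : ℝ => -b) (continuousAt_charRoot' hη (neg_ne_zero.2 hb))
      continuousAt_neg
  refine continuousAt_pi.2 fun i => continuousAt_pi.2 fun j => ?_
  fin_cases i <;> fin_cases j <;> simp [principalLeft] <;> fun_prop

theorem continuousAt_principalRight {η b : ℝ} (hη : 0 < η) (hb : b ≠ 0) :
    ContinuousAt (principalRight η) b := by
  have h1 := continuousAt_charRoot hη hb
  have h2 := continuousAt_charRoot' hη hb
  have h3 : ContinuousAt (fun b => charRoot η (-b)) b :=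
    ContinuousAt.comp (f := fun b : ℝ => -b) (continuousAt_charRoot hη (neg_ne_zero.2 hb))
      continuousAt_neg
  have h4 : ContinuousAt (fun b => charRoot' η (-b)) b :=
    ContinuousAt.comp (f := fun b : ℝ => -b) (continuousAt_charRoot' hη (neg_ne_zero.2 hb))
      continuousAt_neg
  have h5 := (h1.sub h2).inv₀ (charRoot_ne hη hb)
  have h6 := (h3.sub h4).inv₀ (charRoot_ne hη (neg_ne_zero.2 hb))
  have h7 : ContinuousAt (fun b => (charRoot η b - charRoot' η b)⁻¹ / 2) b := h5.div_const 2
  have h8 : ContinuousAt (fun b => (charRoot η (-b) - charRoot' η (-b))⁻¹ / 2) b := h6.div_const 2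
  clear h5 h6
  refine continuousAt_pi.2 fun i => continuousAt_pi.2 fun j => ?_
  fin_cases i <;> fin_cases j <;> simp [principalRight] <;> fun_prop

/-! ### Conjugation of analytic semigroups -/

theorem IsAnalyticSemigroup.conj {Y Z : Type} [NormedAddCommGroup Y] [NormedSpace ℂ Y]
    [NormedAddCommGroup Z] [NormedSpace ℂ Z] (e : Y ≃L[ℂ] Z) {T : ℝ≥0 → Z →L[ℂ] Z}
    (hT : IsAnalyticSemigroup T) :
    IsAnalyticSemigroup fun s => (e.symm : Z →L[ℂ] Y) ∘L T s ∘L (e : Y →L[ℂ] Z) where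
  zero := by
    ext y
    simp [hT.zero]
  add s t := by
    ext y
    simp [hT.add]
  strong y := by
    have h := (e.symm.continuous.tendsto (e y)).comp (hT.strong (e y))
    rw [e.symm_apply_apply] at h
    exact h
  analytic := by
    obtain ⟨θ, h0, h1, S, hS, hd, hadd, hlim⟩ := hT.analytic
    refine ⟨θ, h0, h1, fun z => (e.symm : Z →L[ℂ] Y) ∘L S z ∘L (e : Y →L[ℂ] Z), ?_, ?_, ?_, ?_⟩
    · intro s hs
      simp only [hS s hs]
    · exact (differentiableOn_const _).clm_comp (hd.clm_comp (differentiableOn_const _))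
    · intro z hz w hw
      ext y
      simp [hadd z hz w hw]
    · intro y
      have h := (e.symm.continuous.tendsto (e y)).comp (hlim (e y))
      rw [e.symm_apply_apply] at h
      exact h

section FormOperator

variable {H K : Type} [NormedAddCommGroup H] [InnerProductSpace ℂ H] [CompleteSpace H]
  [NormedAddCommGroup K] [InnerProductSpace ℂ K] (V : Submodule ℂ (WithLp 2 (H × K)))
  [CompleteSpace V]

/-! ### The domain of the square root of a form operator -/

/-- The bounded operator `D = (I - (I - R)^{1/2}) R^{-1/2}`. -/
noncomputable def sqrtDefect : H →L[ℂ] H :=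
  opFun (formResolvent V) fun r => (√r : ℂ) / (1 + (√(1 - r) : ℂ))

/-- Rationalizing, 1 - √(1 - r) = √r · √r/(1 + √(1 - r)), and the last quotient is continuous on all
of [0, 1]. -/
theorem sqrt_one_sub_formResolvent_apply (x : H) :
    CFC.sqrt (1 - formResolvent V) x = x - sqrtDefect V (sqrtResolvent V x) := by
  obtain ⟨h0, h1⟩ := formResolvent_nonneg_le_one V
  have hne : ∀ r : ℝ, (1 + (√(1 - r) : ℂ)) ≠ 0 := fun r => by
    have h : 0 < 1 + √(1 - r) := by positivity
    exact_mod_cast h.ne'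
  have c1 : ContinuousOn (fun r : ℝ => (√r : ℂ)) (Set.Icc 0 1) := by fun_prop
  have c2 : ContinuousOn (fun r : ℝ => (√r : ℂ) / (1 + (√(1 - r) : ℂ))) (Set.Icc 0 1) :=
    c1.div (by fun_prop) fun r _ => hne r
  have c4 : ContinuousOn (fun r : ℝ => (√r : ℂ) / (1 + (√(1 - r) : ℂ)) * (√r : ℂ)) (Set.Icc 0 1) :=
    c2.mul c1
  have e : opFun (formResolvent V) (fun r => (√(1 - r) : ℂ)) = 1 - sqrtDefect V ∘L
      opFun (formResolvent V) (fun r => (√r : ℂ)) := by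
    rw [sqrtDefect, ← opFun_mul h0 h1 c2 c1, ← opFun_one h0,
      ← opFun_sub h0 h1 continuousOn_const c4]
    refine opFun_congr h0 h1 fun r hr => ?_
    have s1 : (√r : ℂ) * √r = r := by exact_mod_cast Real.mul_self_sqrt hr.1
    have s2 : (√(1 - r) : ℂ) * √(1 - r) = 1 - r := by
      exact_mod_cast Real.mul_self_sqrt (sub_nonneg.2 hr.2)
    have := hne r
    field_simp
    linear_combination s2 + s1
  rw [opFun_sqrt_one_sub h0 h1, opFun_sqrt h0] at e
  exact DFunLike.congr_fun e x

/-- With x = R^{-1/2}v this reads A^{1/2}v = R^{-1/2}v - Dv: up to a bounded operator A^{1/2} is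
R^{-1/2}, the only unbounded operator left in the sequel. -/
theorem mem_sqrtFormOperator_iff {v w : H} : WithLp.toLp 2 (v, w) ∈ sqrtFormOperator V ↔
    ∃ x, sqrtResolvent V x = v ∧ w = x - sqrtDefect V v := by
  refine mem_sqrtGraph.trans (exists_congr fun x => ?_)
  rw [sqrt_one_sub_formResolvent_apply]
  constructor
  · rintro ⟨h1, h2⟩
    have h1' : sqrtResolvent V x = v := h1
    rw [h1'] at h2
    exact ⟨h1', h2.symm⟩
  · rintro ⟨h1, h2⟩
    rw [h1]
    exact ⟨h1, h2.symm⟩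

theorem norm_sqrt_apply_sq {R : H →L[ℂ] H} (h0 : 0 ≤ R) (x : H) :
    ‖CFC.sqrt R x‖ ^ 2 = RCLike.re ⟪R x, x⟫_ℂ := by
  have hs : ⟪CFC.sqrt R (CFC.sqrt R x), x⟫_ℂ = ⟪CFC.sqrt R x, CFC.sqrt R x⟫_ℂ :=
    ((ContinuousLinearMap.nonneg_iff_isPositive _).1 (CFC.sqrt_nonneg R)).isSymmetric _ _
  have hsq : CFC.sqrt R (CFC.sqrt R x) = R x :=
    congrArg (fun T : H →L[ℂ] H => T x) (CFC.sqrt_mul_sqrt_self R h0)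
  rw [← inner_self_eq_norm_sq (𝕜 := ℂ), ← hs, hsq]

/-- Both squares are quadratic forms, ⟪R x, x⟫ and ⟪(I - R)x, x⟫. The left side is the squared graph
norm of R^{1/2}x. -/
theorem norm_sqrt_sq_add {R : H →L[ℂ] H} (h0 : 0 ≤ R) (h1 : R ≤ 1) (x : H) :
    ‖CFC.sqrt R x‖ ^ 2 + ‖CFC.sqrt (1 - R) x‖ ^ 2 = ‖x‖ ^ 2 := by
  have h : (1 - R) x = x - R x := rfl
  rw [norm_sqrt_apply_sq h0, norm_sqrt_apply_sq (sub_nonneg.2 h1), h, inner_sub_left, map_sub,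
    add_sub_cancel, inner_self_eq_norm_sq]

/-- The isometry `R^{1/2}` of `H` onto `D(A^{1/2})` with its graph norm. -/
noncomputable def sqrtResolventIsometry : H →ₗᵢ[ℂ] sqrtFormOperator V where
  toLinearMap := LinearMap.rangeRestrict ((WithLp.linearEquiv 2 ℂ (H × H)).symm.toLinearMap ∘ₗ
    ((CFC.sqrt (formResolvent V)).toLinearMap.prod
      (CFC.sqrt (1 - formResolvent V)).toLinearMap))
  norm_map' x := by
    refine (sq_eq_sq₀ (norm_nonneg _) (norm_nonneg _)).1 ?_
    refine Eq.trans (WithLp.prod_norm_sq_eq_of_L2 _) ?_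
    exact norm_sqrt_sq_add (formResolvent_nonneg_le_one V).1 (formResolvent_nonneg_le_one V).2 x

/-- `D(A^{1/2})` with its graph norm is isometric to `H`, by means of `R^{-1/2}`. -/
noncomputable def sqrtFormEquiv : sqrtFormOperator V ≃L[ℂ] H :=
  (LinearIsometryEquiv.ofSurjective (sqrtResolventIsometry V)
    (LinearMap.surjective_rangeRestrict _)).symm.toContinuousLinearEquiv

theorem fst_sqrtFormEquiv_symm (x : H) : ((sqrtFormEquiv V).symm x).1.fst = sqrtResolvent V x :=
  rfl

theorem fst_eq_sqrtResolvent (p : sqrtFormOperator V) :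
    p.1.fst = sqrtResolvent V (sqrtFormEquiv V p) := by
  rw [← fst_sqrtFormEquiv_symm, ContinuousLinearEquiv.symm_apply_apply]

variable {V}

/-- The phase space is isomorphic to `H⁴`. -/
noncomputable def phaseEquiv {G : Type} [NormedAddCommGroup G] [NormedSpace ℂ G]
    (g : G ≃L[ℂ] H) : (G × H × G × H) ≃L[ℂ] (Fin 4 → H) where
  toFun W := ![g W.1, W.2.1, g W.2.2.1, W.2.2.2]
  invFun ξ := (g.symm (ξ 0), ξ 1, g.symm (ξ 2), ξ 3)
  left_inv W := by simp
  right_inv ξ := by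
    ext i
    fin_cases i <;> simp
  map_add' W W' := by
    ext i
    fin_cases i <;> simp
  map_smul' c W := by
    ext i
    fin_cases i <;> simp
  continuous_toFun := by
    refine continuous_pi fun i => ?_
    fin_cases i <;> simp <;> fun_prop
  continuous_invFun := by fun_prop

/-! ### The perturbation -/

variable (V)

/-- The bounded part of the linearized operator that does not depend on the coupling. -/
noncomputable def fixedPerturbation (m : H →L[ℂ] H) (η : ℝ) : (Fin 4 → H) →L[ℂ] (Fin 4 → H) :=
  ContinuousLinearMap.pi ![0,
    m ∘L ContinuousLinearMap.proj 0 + (η : ℂ) • sqrtDefect V ∘L ContinuousLinearMap.proj 1, 0,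
    sqrtResolvent V ∘L ContinuousLinearMap.proj 2
      + (η : ℂ) • sqrtDefect V ∘L ContinuousLinearMap.proj 3]

/-- The bounded part of the coupling. -/
noncomputable def couplingPerturbation : (Fin 4 → H) →L[ℂ] (Fin 4 → H) :=
  ContinuousLinearMap.pi ![0, sqrtDefect V ∘L ContinuousLinearMap.proj 3, 0,
    -(sqrtDefect V ∘L ContinuousLinearMap.proj 1)]

/-- The bounded part of the linearized operator. -/
noncomputable def perturbation (m : H →L[ℂ] H) (η b : ℝ) : (Fin 4 → H) →L[ℂ] (Fin 4 → H) :=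
  fixedPerturbation V m η + (b : ℂ) • couplingPerturbation V

theorem continuous_perturbation (m : H →L[ℂ] H) (η : ℝ) : Continuous (perturbation V m η) := by
  unfold perturbation
  fun_prop

theorem perturbation_apply (m : H →L[ℂ] H) (η b : ℝ) (ξ : Fin 4 → H) :
    perturbation V m η b ξ = ![0,
      m (ξ 0) + (η : ℂ) • sqrtDefect V (ξ 1) + (b : ℂ) • sqrtDefect V (ξ 3), 0,
      sqrtResolvent V (ξ 2) + (η : ℂ) • sqrtDefect V (ξ 3) - (b : ℂ) • sqrtDefect V (ξ 1)] := by
  ext i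
  fin_cases i <;>
    simp [perturbation, fixedPerturbation, couplingPerturbation, sub_eq_add_neg]

/-- The semigroup generated by the negative of the linearized operator, on `H⁴`. -/
noncomputable def phaseSemigroup (m : H →L[ℂ] H) (η b : ℝ) : ℂ → (Fin 4 → H) →L[ℂ] (Fin 4 → H) :=
  dysonSeries (matSemigroup (formResolvent V) (principalLeft η b) (principalRight η b)
    (principalEigenvalue η b)) (perturbation V m η b)

variable (hd : ∀ x : H, (∀ w ∈ V, ⟪w.fst, x⟫_ℂ = 0) → x = 0) (m : H →L[ℂ] H) {η b : ℝ}
  (hη : 0 < η) (hb : b ≠ 0)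
include hd hη hb

theorem isAnalyticSemigroup_phaseSemigroup :
    IsAnalyticSemigroup (realSemigroup (phaseSemigroup V m η b)) := by
  obtain ⟨h0, h1⟩ := formResolvent_nonneg_le_one V
  obtain ⟨θ, hT⟩ := exists_isBoundedHolomorphicSemigroup_matSemigroup h0 h1
    (formResolvent_injective V hd) (principalEigenvalue_re_pos hη b)
    (principalRight_mul_principalLeft hη hb)
  exact isAnalyticSemigroup_realSemigroup hT.angle_pos hT.angle_le
    (differentiableOn_dysonSeries hT _) (fun z hz w hw => dysonSeries_add hT _ hz hw)
    (tendsto_dysonSeries hT _)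

theorem isGeneratedByNeg_phaseSemigroup :
    IsGeneratedByNeg (realSemigroup (phaseSemigroup V m η b)) fun y z =>
      ∃ x : Fin 4 → H, (∀ i, sqrtResolvent V (x i) = y i) ∧
        z + perturbation V m η b y = matAct (principalMatrix η b) x := by
  obtain ⟨h0, h1⟩ := formResolvent_nonneg_le_one V
  have hR := formResolvent_injective V hd
  have hΨΦ := principalRight_mul_principalLeft hη hb
  obtain ⟨θ, hT⟩ := exists_isBoundedHolomorphicSemigroup_matSemigroup h0 h1 hR
    (principalEigenvalue_re_pos hη b) hΨΦ
  exact isGeneratedByNeg_realSemigroup (isGeneratedByNeg_dysonSeries hT _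
    (isGeneratedByNeg_matSemigroup h0 h1 hR (principalEigenvalue_re_pos hη b) hΨΦ
      (principalLeft_mul η b)))

end FormOperator

theorem IsBoundedHolomorphicSemigroup.mono {Y : Type*} [NormedAddCommGroup Y] [NormedSpace ℂ Y]
    {θ M M' : ℝ} {T : ℂ → Y →L[ℂ] Y} (hT : IsBoundedHolomorphicSemigroup θ M T) (h : M ≤ M') :
    IsBoundedHolomorphicSemigroup θ M' T :=
  { hT with norm_le := fun z hz => (hT.norm_le z hz).trans h }

/-! ### The linearized operator on H⁴ and its dependence on the coupling -/

section FormOperator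

variable {H K : Type} [NormedAddCommGroup H] [InnerProductSpace ℂ H] [CompleteSpace H]
  [NormedAddCommGroup K] [InnerProductSpace ℂ K] (V : Submodule ℂ (WithLp 2 (H × K)))
  [CompleteSpace V]

theorem sqrtResolvent_injective (hd : ∀ x : H, (∀ w ∈ V, ⟪w.fst, x⟫_ℂ = 0) → x = 0) :
    Function.Injective (sqrtResolvent V) :=
  sqrt_injective (formResolvent_nonneg_le_one V).1 (formResolvent_nonneg_le_one V).2
    (formResolvent_injective V hd)

/-- The relation R(u + h) = u loses one factor R^{1/2} by injectivity: (I + A)u = R^{-1/2}ξ, where ξ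
= R^{-1/2}u is the coordinate of u. -/
theorem fst_mem_formOperator_iff (hd : ∀ x : H, (∀ w ∈ V, ⟪w.fst, x⟫_ℂ = 0) → x = 0)
    (p : sqrtFormOperator V) (h : H) :
    (p.1.fst, h) ∈ formOperator V ↔ sqrtResolvent V (p.1.fst + h) = sqrtFormEquiv V p := by
  rw [mem_formOperator_iff, ← sqrtResolvent_sqrtResolvent]
  conv_lhs =>
    rhs
    rw [fst_eq_sqrtResolvent]
  exact (sqrtResolvent_injective V hd).eq_iff

/-- The linearized operator in the coordinates of `H⁴`. -/
theorem linearization_iff (hd : ∀ x : H, (∀ w ∈ V, ⟪w.fst, x⟫_ℂ = 0) → x = 0) (m : H →L[ℂ] H)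
    (η b : ℝ) (p₁ p₂ q₁ q₂ : sqrtFormOperator V) (v z y₁ y₃ : H) :
    (∃ Au Bv Aw Bz : H, (p₁.1.fst, Au) ∈ formOperator V ∧
      WithLp.toLp 2 (v, Bv) ∈ sqrtFormOperator V ∧ (p₂.1.fst, Aw) ∈ formOperator V ∧
      WithLp.toLp 2 (z, Bz) ∈ sqrtFormOperator V ∧ q₁.1.fst = -v ∧
      y₁ = Au + p₁.1.fst - m (sqrtFormEquiv V p₁) + (η : ℂ) • Bv + (b : ℂ) • Bz ∧
      q₂.1.fst = -z ∧ y₃ = -((b : ℂ) • Bv) + Aw + (η : ℂ) • Bz) ↔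
    ∃ x : Fin 4 → H, (∀ i, sqrtResolvent V (x i)
        = (![sqrtFormEquiv V p₁, v, sqrtFormEquiv V p₂, z] : Fin 4 → H) i) ∧
      ![sqrtFormEquiv V q₁, y₁, sqrtFormEquiv V q₂, y₃]
        + perturbation V m η b ![sqrtFormEquiv V p₁, v, sqrtFormEquiv V p₂, z]
        = matAct (principalMatrix η b) x := by
  have hinj := sqrtResolvent_injective V hd
  have hmat : ∀ x : Fin 4 → H, matAct (principalMatrix η b) x
      = ![-x 1, x 0 + (η : ℂ) • x 1 + (b : ℂ) • x 3, -x 3,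
        -((b : ℂ) • x 1) + x 2 + (η : ℂ) • x 3] := fun x => by
    ext i
    rw [matAct_apply, Fin.sum_univ_four]
    fin_cases i <;> simp [principalMatrix]
  have hneg : ∀ (q : sqrtFormOperator V) (x : H),
      q.1.fst = -sqrtResolvent V x ↔ sqrtFormEquiv V q = -x := fun q x => by
    rw [fst_eq_sqrtResolvent, ← map_neg, hinj.eq_iff]
  simp only [fst_mem_formOperator_iff V hd, mem_sqrtFormOperator_iff, hmat, perturbation_apply]
  constructor
  · rintro ⟨Au, _, Aw, _, h1, ⟨x₁, rfl, rfl⟩, h2, ⟨x₃, rfl, rfl⟩, h3, rfl, h4, rfl⟩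
    rw [hneg] at h3 h4
    -- These are R^{-1/2} of the four coordinates: (I + A)u, R^{-1/2}v, (I + A)w and R^{-1/2}z.
    refine ⟨![p₁.1.fst + Au, x₁, p₂.1.fst + Aw, x₃], fun i => ?_, ?_⟩
    · fin_cases i <;> simp [h1, h2]
    · ext i
      fin_cases i
      · simp [h3]
      · simp [smul_sub]
        abel
      · simp [h4]
      · simp [smul_sub, ← fst_eq_sqrtResolvent]
        abel
  · rintro ⟨x, hx, he⟩
    have x0 : sqrtResolvent V (x 0) = sqrtFormEquiv V p₁ := hx 0
    have x1 : sqrtResolvent V (x 1) = v := hx 1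
    have x2 : sqrtResolvent V (x 2) = sqrtFormEquiv V p₂ := hx 2
    have x3 : sqrtResolvent V (x 3) = z := hx 3
    have e0 := congrFun he 0
    have e1 := congrFun he 1
    have e2 := congrFun he 2
    have e3 := congrFun he 3
    simp at e0 e1 e2 e3
    rw [← fst_eq_sqrtResolvent] at e3
    refine ⟨x 0 - p₁.1.fst, x 1 - sqrtDefect V v, x 2 - p₂.1.fst, x 3 - sqrtDefect V z,
      by rw [add_sub_cancel, x0], ⟨x 1, x1, rfl⟩, by rw [add_sub_cancel, x2], ⟨x 3, x3, rfl⟩,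
      ?_, ?_, ?_, ?_⟩
    · rw [← x1, hneg, e0]
    · rw [eq_sub_of_add_eq e1]
      simp only [smul_sub, Complex.coe_smul]
      abel
    · rw [← x3, hneg, e2]
    · rw [eq_sub_of_add_eq e3]
      simp only [smul_sub, Complex.coe_smul]
      abel

/-- The semigroups depend continuously, in the operator norm, on the coupling. -/
theorem eventually_norm_phaseSemigroup_sub_le
    (hd : ∀ x : H, (∀ w ∈ V, ⟪w.fst, x⟫_ℂ = 0) → x = 0) (m : H →L[ℂ] H) {η : ℝ} (hη : 0 < η)
    {ι : Type*} {l : Filter ι} {b : ι → ℝ} {b₀ : ℝ} (hb₀ : b₀ ≠ 0) (hb : Tendsto b l (𝓝 b₀))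
    {τ ε : ℝ} (hτ : 0 ≤ τ) (hε : 0 < ε) :
    ∀ᶠ i in l, ∀ s ∈ Set.Ioc (0 : ℝ) τ,
      ‖phaseSemigroup V m η (b i) s - phaseSemigroup V m η b₀ s‖ ≤ ε := by
  obtain ⟨h0, h1⟩ := formResolvent_nonneg_le_one V
  have hR := formResolvent_injective V hd
  have hΦ := (continuousAt_principalLeft hη hb₀).tendsto.comp hb
  have hΨ := (continuousAt_principalRight hη hb₀).tendsto.comp hb
  have hσ := (continuousAt_principalEigenvalue hη hb₀).tendsto.comp hb
  have hσ₀ := principalEigenvalue_re_pos hη b₀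
  have hP : Tendsto (fun i => perturbation V m η (b i)) l (𝓝 (perturbation V m η b₀)) :=
    ((continuous_perturbation V m η).tendsto b₀).comp hb
  let B : ℝ → ℝ := fun b => ‖(matAct (principalRight η b) : (Fin 4 → H) →L[ℂ] (Fin 4 → H))‖
    * (1 * ‖(matAct (principalLeft η b) : (Fin 4 → H) →L[ℂ] (Fin 4 → H))‖)
  have hB : Tendsto (fun i => B (b i)) l (𝓝 (B b₀)) :=
    ((continuous_norm_matAct.tendsto _).comp hΨ).mul
      (((continuous_norm_matAct.tendsto _).comp hΦ).const_mul 1)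
  have hPn : Tendsto (fun i => ‖perturbation V m η (b i)‖) l (𝓝 ‖perturbation V m η b₀‖) :=
    Tendsto.norm (E := (Fin 4 → H) →L[ℂ] (Fin 4 → H)) hP
  -- M and p bound the unperturbed semigroups and the perturbations for b₀ and for all nearby
  -- couplings; the added 1 leaves room for the latter.
  set M : ℝ := B b₀ + 1 with hM
  set p : ℝ := ‖perturbation V m η b₀‖ + 1 with hp
  have hM0 : 0 ≤ M := add_nonneg (by positivity) zero_le_one
  have hp0 : 0 ≤ p := by positivity
  set E : ℝ := Real.exp (M * p * τ) with hE
  have hEpos : 0 < E := Real.exp_pos _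
  -- The estimate of `norm_dysonSeries_sub_dysonSeries_le` is linear in κ and at most κc on (0, τ],
  -- so κ = ε/c is the required closeness.
  set c : ℝ := (1 + τ * (p * (M * E) + M * (M * E))) * E with hc
  have hcpos : 0 < c := by positivity
  have hκ : 0 < ε / c := div_pos hε hcpos
  have hPsub : Tendsto (fun i => ‖perturbation V m η (b i) - perturbation V m η b₀‖) l (𝓝 0) := by
    have h := Tendsto.norm (E := (Fin 4 → H) →L[ℂ] (Fin 4 → H)) (hP.sub_const
      (perturbation V m η b₀))
    rwa [sub_self, ContinuousLinearMap.opNorm_zero] at h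
  filter_upwards [hB.eventually (gt_mem_nhds (lt_add_one _)),
    hPn.eventually (gt_mem_nhds (lt_add_one _)), hPsub.eventually (gt_mem_nhds hκ),
    hb.eventually_ne hb₀,
    eventually_norm_matSemigroup_sub_le h0 h1 hΦ hΨ hσ hσ₀ hκ] with i i1 i2 i3 i4 i5 s hs
  obtain ⟨θ, hT⟩ := exists_isBoundedHolomorphicSemigroup_matSemigroup h0 h1 hR
    (principalEigenvalue_re_pos hη (b i)) (principalRight_mul_principalLeft hη i4)
  obtain ⟨θ₀, hT₀⟩ := exists_isBoundedHolomorphicSemigroup_matSemigroup h0 h1 hR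
    hσ₀ (principalRight_mul_principalLeft hη hb₀)
  have key := norm_dysonSeries_sub_dysonSeries_le (hT.mono i1.le) (perturbation V m η (b i))
    (hT₀.mono (lt_add_one _).le) (perturbation V m η b₀) i2.le (lt_add_one _).le
    (fun r hr => i5 r hr.1) i3.le hs
  refine key.trans ?_
  have hexp : Real.exp (M * p * s) ≤ E :=
    Real.exp_le_exp.2 (mul_le_mul_of_nonneg_left hs.2 (by positivity))
  calc (ε / c + τ * (ε / c * (p * (M * E)) + M * (ε / c * (M * E)))) * Real.exp (M * p * s)
      ≤ (ε / c + τ * (ε / c * (p * (M * E)) + M * (ε / c * (M * E)))) * E :=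
        mul_le_mul_of_nonneg_left hexp (by positivity)
    _ = ε / c * c := by rw [hc]; ring
    _ = ε := div_mul_cancel₀ _ hcpos.ne'

end FormOperator

/-! ### The linearized operator on `Y₀` -/

section PhaseSpace

variable {N : ℕ} {Ω : Set (EuclideanSpace ℝ (Fin N))}

/-- The phase space `Y₀` is isomorphic to `X⁴`. -/
noncomputable def phaseSpaceEquiv (Ω : Set (EuclideanSpace ℝ (Fin N))) :
    Y0 Ω ≃L[ℂ] (Fin 4 → X Ω) :=
  phaseEquiv (sqrtFormEquiv (H10 Ω))

theorem phaseSpaceEquiv_apply (W : Y0 Ω) : phaseSpaceEquiv Ω W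
    = ![sqrtFormEquiv (H10 Ω) W.1, W.2.1, sqrtFormEquiv (H10 Ω) W.2.2.1, W.2.2.2] := rfl

theorem completeSpace_Y0 : CompleteSpace (Y0 Ω) :=
  (completeSpace_congr (e := (phaseSpaceEquiv Ω).toEquiv)
    (phaseSpaceEquiv Ω).isUniformEmbedding).2 inferInstance

/-- The operator `m` is multiplication by `f'(u)` from `X^{1/2}` to `X`. -/
def IsMulDeriv (Ω : Set (EuclideanSpace ℝ (Fin N))) (f : ℝ → ℝ) (u : X Ω)
    (m : X Ω →L[ℂ] X Ω) : Prop :=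
  ∀ x, (m x : EuclideanSpace ℝ (Fin N) → ℂ) =ᵐ[volume.restrict Ω]
    fun y => ((deriv f (u y).re : ℝ) : ℂ) * sqrtResolvent (H10 Ω) x y

variable {f : ℝ → ℝ} {u : X Ω} {m : X Ω →L[ℂ] X Ω}

theorem IsMulDeriv.apply_sqrtFormEquiv (hm : IsMulDeriv Ω f u m) (p : sqrtFormOperator (H10 Ω)) :
    (m (sqrtFormEquiv (H10 Ω) p) : EuclideanSpace ℝ (Fin N) → ℂ) =ᵐ[volume.restrict Ω]
      fun y => ((deriv f (u y).re : ℝ) : ℂ) * p.1.fst y := by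
  rw [fst_eq_sqrtResolvent]
  exact hm _

theorem linearized_iff (hΩ : IsOpen Ω) (hm : IsMulDeriv Ω f u m) (η b : ℝ) (W Z : Y0 Ω) :
    linearized Ω f η u b W Z ↔ ∃ x : Fin 4 → X Ω,
      (∀ i, sqrtResolvent (H10 Ω) (x i) = phaseSpaceEquiv Ω W i) ∧
      phaseSpaceEquiv Ω Z + perturbation (H10 Ω) m η b (phaseSpaceEquiv Ω W)
        = matAct (principalMatrix η b) x := by
  have h := linearization_iff (H10 Ω) (eq_zero_of_orthogonal_H10 hΩ) m η b W.1 W.2.2.1 Z.1 Z.2.2.1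
    W.2.1 W.2.2.2 Z.2.1 Z.2.2.2
  rw [phaseSpaceEquiv_apply, phaseSpaceEquiv_apply, ← h]
  have hmW := hm.apply_sqrtFormEquiv W.1
  constructor
  · rintro ⟨Au, Bv, Aw, Bz, m', h1, h2, h3, h4, h5, h6⟩
    have hm' : m' = m (sqrtFormEquiv (H10 Ω) W.1) := Lp.ext (by
      filter_upwards [h5, hmW] with y e1 e2
      rw [e1, e2])
    rw [hm'] at h6
    exact ⟨Au, Bv, Aw, Bz, h1, h2, h3, h4, h6⟩
  · rintro ⟨Au, Bv, Aw, Bz, h1, h2, h3, h4, h6⟩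
    exact ⟨Au, Bv, Aw, Bz, _, h1, h2, h3, h4, hmW, h6⟩

/-- Multiplication by f'(u*) is bounded from X^{1/2} to X and does not shrink the domain. The first
and third components of the image, -v and -z, must be in X^{1/2}, which is what v, z ∈ D(A^{1/2})
provides. -/
theorem exists_linearized_iff (hm : IsMulDeriv Ω f u m) (η b : ℝ) (W : Y0 Ω) :
    (∃ Z, linearized Ω f η u b W Z) ↔ W ∈ Y1 Ω := by
  constructor
  · rintro ⟨Z, Au, Bv, Aw, Bz, m', h1, h2, h3, h4, -⟩
    exact ⟨⟨Au, h1⟩, ⟨_, h2, rfl⟩, ⟨Aw, h3⟩, ⟨_, h4, rfl⟩⟩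
  · rintro ⟨⟨Au, h1⟩, ⟨p, hp, hpv⟩, ⟨Aw, h3⟩, ⟨q, hq, hqz⟩⟩
    have hmW := hm.apply_sqrtFormEquiv W.1
    have hp' : WithLp.toLp 2 (W.2.1, p.snd) ∈ XHalf Ω := by rw [← hpv]; exact hp
    have hq' : WithLp.toLp 2 (W.2.2.2, q.snd) ∈ XHalf Ω := by rw [← hqz]; exact hq
    refine ⟨(-⟨_, hp'⟩, _, -⟨_, hq'⟩, _), Au, p.snd, Aw, q.snd, _, h1, hp', h3, hq', hmW, rfl, rfl,
      rfl, rfl⟩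

/-- The semigroup generated by `-Ã`. -/
noncomputable def linearizedSemigroup (Ω : Set (EuclideanSpace ℝ (Fin N))) (m : X Ω →L[ℂ] X Ω)
    (η b : ℝ) (s : ℝ≥0) : Y0 Ω →L[ℂ] Y0 Ω :=
  ((phaseSpaceEquiv Ω).symm : (Fin 4 → X Ω) →L[ℂ] Y0 Ω) ∘L
    realSemigroup (phaseSemigroup (H10 Ω) m η b) s ∘L (phaseSpaceEquiv Ω : Y0 Ω →L[ℂ] (Fin 4 → X Ω))

theorem isAnalyticSemigroup_linearizedSemigroup (hΩ : IsOpen Ω) (m : X Ω →L[ℂ] X Ω) {η b : ℝ}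
    (hη : 0 < η) (hb : b ≠ 0) : IsAnalyticSemigroup (linearizedSemigroup Ω m η b) :=
  (isAnalyticSemigroup_phaseSemigroup (H10 Ω) (eq_zero_of_orthogonal_H10 hΩ) m hη hb).conj
    (phaseSpaceEquiv Ω)

theorem isGeneratedByNeg_linearizedSemigroup (hΩ : IsOpen Ω) (hm : IsMulDeriv Ω f u m) {η b : ℝ}
    (hη : 0 < η) (hb : b ≠ 0) :
    IsGeneratedByNeg (linearizedSemigroup Ω m η b) (linearized Ω f η u b) := fun W Z =>
  (linearized_iff hΩ hm η b W Z).trans (isGeneratedByNeg_conj (phaseSpaceEquiv Ω)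
    (isGeneratedByNeg_phaseSemigroup (H10 Ω) (eq_zero_of_orthogonal_H10 hΩ) m hη hb) W Z)

theorem eventually_norm_linearizedSemigroup_sub_lt (hΩ : IsOpen Ω) (m : X Ω →L[ℂ] X Ω) {η : ℝ}
    (hη : 0 < η) {ι : Type*} {l : Filter ι} {b : ι → ℝ} {b₀ : ℝ} (hb₀ : b₀ ≠ 0)
    (hb : Tendsto b l (𝓝 b₀)) (τ : ℝ≥0) {δ : ℝ} (hδ : 0 < δ) :
    ∀ᶠ i in l, ∀ s ≤ τ, ‖linearizedSemigroup Ω m η (b i) s - linearizedSemigroup Ω m η b₀ s‖ < δ := by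
  set A : (Fin 4 → X Ω) →L[ℂ] Y0 Ω := ((phaseSpaceEquiv Ω).symm : (Fin 4 → X Ω) →L[ℂ] Y0 Ω)
  set B : Y0 Ω →L[ℂ] (Fin 4 → X Ω) := (phaseSpaceEquiv Ω : Y0 Ω →L[ℂ] (Fin 4 → X Ω))
  have hc : 0 < ‖A‖ * ‖B‖ + 1 := by positivity
  filter_upwards [eventually_norm_phaseSemigroup_sub_le (H10 Ω) (eq_zero_of_orthogonal_H10 hΩ) m hη
    hb₀ hb τ.2 (div_pos hδ hc)] with i hi s hs
  -- At time 0 both semigroups are the identity; the estimate on the sector concerns positive times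
  -- only.
  rcases eq_or_ne s 0 with rfl | h0
  · have h : linearizedSemigroup Ω m η (b i) 0 - linearizedSemigroup Ω m η b₀ 0 = 0 := by
      simp only [linearizedSemigroup, realSemigroup_zero, sub_self]
    rw [h, ContinuousLinearMap.opNorm_zero]
    exact hδ
  · have hs0 : 0 < s := pos_iff_ne_zero.2 h0
    have hle := hi s ⟨hs0, hs⟩
    set P := phaseSemigroup (H10 Ω) m η (b i) (s : ℝ)
    set Q := phaseSemigroup (H10 Ω) m η b₀ (s : ℝ)
    have h : linearizedSemigroup Ω m η (b i) s - linearizedSemigroup Ω m η b₀ s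
        = A ∘L (P - Q) ∘L B := by
      rw [linearizedSemigroup, linearizedSemigroup, realSemigroup_of_pos _ hs0,
        realSemigroup_of_pos _ hs0, ContinuousLinearMap.sub_comp, ContinuousLinearMap.comp_sub]
    rw [h]
    calc ‖A ∘L (P - Q) ∘L B‖ ≤ ‖A‖ * (‖P - Q‖ * ‖B‖) :=
          (ContinuousLinearMap.opNorm_comp_le _ _).trans
            (mul_le_mul_of_nonneg_left (ContinuousLinearMap.opNorm_comp_le _ _) (norm_nonneg _))
      _ ≤ ‖A‖ * (δ / (‖A‖ * ‖B‖ + 1) * ‖B‖) := by gcongr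
      _ = δ * (‖A‖ * ‖B‖ / (‖A‖ * ‖B‖ + 1)) := by ring
      _ < δ * 1 := by
          refine mul_lt_mul_of_pos_left ?_ hδ
          rw [div_lt_one hc]
          exact lt_add_one _
      _ = δ := mul_one δ

end PhaseSpace

/-- An `L^∞`-bound for a continuous function holds everywhere. -/
theorem enorm_le_eLpNorm_top {g : ℝ → ℝ} (hg : Continuous g) (t : ℝ) :
    ‖g t‖ₑ ≤ eLpNorm g ⊤ volume := by
  have hcl : IsClosed {t | ‖g t‖ₑ ≤ eLpNorm g ⊤ volume} := isClosed_le hg.enorm continuous_const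
  have hd : Dense {t | ‖g t‖ₑ ≤ eLpNorm g ⊤ volume} :=
    Measure.dense_of_ae (ae_le_eLpNormEssSup (f := g))
  have h : t ∈ closure {t | ‖g t‖ₑ ≤ eLpNorm g ⊤ volume} := hd t
  rwa [hcl.closure_eq] at h

theorem tendsto_of_tendsto_eLpNorm_top {ι : Type*} {l : Filter ι} {g : ι → ℝ → ℝ} {g₀ : ℝ → ℝ}
    (hg : ∀ᶠ i in l, Continuous (g i)) (hg₀ : Continuous g₀)
    (h : Tendsto (fun i => eLpNorm (fun t => g i t - g₀ t) ⊤ volume) l (𝓝 0)) (t : ℝ) :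
    Tendsto (fun i => g i t) l (𝓝 (g₀ t)) := by
  rw [tendsto_iff_edist_tendsto_0]
  refine tendsto_of_tendsto_of_tendsto_of_le_of_le' tendsto_const_nhds h
    (Eventually.of_forall fun _ => zero_le) ?_
  filter_upwards [hg] with i hi
  rw [edist_eq_enorm_sub]
  exact enorm_le_eLpNorm_top (hi.sub hg₀) t

end KGZ

/-! ### The main theorem -/

theorem mainTheorem6 {N : ℕ} (hN : 3 ≤ N)
    {Ω : Set (EuclideanSpace ℝ (Fin N))} (hΩ : KGZ.IsBoundedSmoothDomain Ω)
    {η : ℝ} (hη : 0 < η)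
    -- the coupling coefficients `a ε t`, for `ε ∈ [0, 1]`
    {a : ℝ → ℝ → ℝ} {α₀ α₁ b₀ C β : ℝ}
    (hα₀ : 0 < α₀) (hb₀ : 0 < b₀) (hC : 0 < C) (hβ₀ : 0 < β) (hβ₁ : β ≤ 1)
    (ha_smooth : ∀ ε ∈ Set.Icc (0 : ℝ) 1, ContDiff ℝ 1 (a ε))
    (ha_bound : ∀ ε ∈ Set.Icc (0 : ℝ) 1, ∀ t, α₀ ≤ a ε t ∧ a ε t ≤ α₁)
    (ha_deriv : ∀ ε ∈ Set.Icc (0 : ℝ) 1, ∀ t, |deriv (a ε) t| ≤ b₀)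
    (ha_holder : ∀ ε ∈ Set.Icc (0 : ℝ) 1, ∀ t s, |a ε t - a ε s| ≤ C * |t - s| ^ β)
    (ha_lim : Tendsto (fun ε => eLpNorm (fun t => a ε t - a 0 t) ∞ volume) (𝓝[>] 0) (𝓝 0))
    -- the nonlinearity `f`
    {f : ℝ → ℝ} {c ρ : ℝ} (hc : 0 < c)
    (hρ₀ : ((N : ℝ) - 1) / ((N : ℝ) - 2) ≤ ρ) (hρ₁ : ρ < (N : ℝ) / ((N : ℝ) - 2))
    (hf_smooth : ContDiff ℝ 1 f)
    (hf_diss : limsup (fun s : ℝ => ((f s / s : ℝ) : EReal)) (cocompact ℝ) ≤ 0)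
    (hf_growth : ∀ s, |deriv f s| ≤ c * (1 + |s| ^ (ρ - 1)))
    -- the equilibrium
    {ustar : KGZ.X Ω} (hu : KGZ.IsEquilibrium Ω f ustar)
    (t : ℝ) :
    -- the operators `Ã_ε(t)` have domain `Y₁`, and `-Ã_ε(t)` generates an analytic semigroup
    (∀ ε ∈ Set.Icc (0 : ℝ) 1,
      (∀ W : KGZ.Y0 Ω, (∃ Z, KGZ.linearized Ω f η ustar (a ε t) W Z) ↔ W ∈ KGZ.Y1 Ω) ∧
      ∃ T : ℝ≥0 → KGZ.Y0 Ω →L[ℂ] KGZ.Y0 Ω, KGZ.IsAnalyticSemigroup T ∧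
        KGZ.IsGeneratedByNeg T (KGZ.linearized Ω f η ustar (a ε t))) ∧
    -- the semigroups generated by `-Ã_ε(t)` converge in `L(Y₀)`, uniformly on compact sets
    ∀ S : ℝ → ℝ≥0 → KGZ.Y0 Ω →L[ℂ] KGZ.Y0 Ω,
      (∀ ε ∈ Set.Icc (0 : ℝ) 1, KGZ.IsC0Semigroup (S ε) ∧
        KGZ.IsGeneratedByNeg (S ε) (KGZ.linearized Ω f η ustar (a ε t))) →
      ∀ K : Set ℝ≥0, IsCompact K →
        ∀ δ > 0, ∀ᶠ ε in 𝓝[>] (0 : ℝ), ∀ s ∈ K, ‖S ε s - S 0 s‖ < δ := by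
  obtain ⟨-, h, huh, -⟩ := hu
  obtain ⟨m, hm⟩ := KGZ.exists_mul_deriv_operator hN hΩ.isOpen hΩ.isBounded hc hρ₀ hρ₁ hf_smooth
    hf_growth huh
  have hm' : KGZ.IsMulDeriv Ω f ustar m := hm
  have hb : ∀ ε ∈ Set.Icc (0 : ℝ) 1, a ε t ≠ 0 := fun ε hε =>
    (hα₀.trans_le (ha_bound ε hε t).1).ne'
  have hS := fun ε hε =>
    KGZ.isAnalyticSemigroup_linearizedSemigroup hΩ.isOpen m hη (hb ε hε)
  have hG := fun ε hε =>
    KGZ.isGeneratedByNeg_linearizedSemigroup hΩ.isOpen hm' hη (hb ε hε)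
  refine ⟨fun ε hε => ⟨fun W => KGZ.exists_linearized_iff hm' η (a ε t) W, _, hS ε hε, hG ε hε⟩,
    fun S hSG K hK δ hδ => ?_⟩
  have : CompleteSpace (KGZ.Y0 Ω) := KGZ.completeSpace_Y0
  -- The generator determines the semigroup, so an arbitrary family S is the constructed one.
  -- Completeness of Y₀ enters through the uniform boundedness principle.
  have heq : ∀ ε ∈ Set.Icc (0 : ℝ) 1, S ε = KGZ.linearizedSemigroup Ω m η (a ε t) := fun ε hε =>
    (hSG ε hε).1.eq_of_isGeneratedByNeg (hS ε hε) (hSG ε hε).2 (hG ε hε)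
  have h0 : (0 : ℝ) ∈ Set.Icc (0 : ℝ) 1 := ⟨le_rfl, zero_le_one⟩
  have hIcc : ∀ᶠ ε in 𝓝[>] (0 : ℝ), ε ∈ Set.Icc (0 : ℝ) 1 :=
    by
    filter_upwards [Ioc_mem_nhdsGT zero_lt_one] with ε hε
    exact ⟨hε.1.le, hε.2⟩
  -- For continuous functions the L^∞-norm controls every value, so the coefficients converge at the
  -- fixed time t.
  have hlim : Tendsto (fun ε => a ε t) (𝓝[>] 0) (𝓝 (a 0 t)) :=
    KGZ.tendsto_of_tendsto_eLpNorm_top (hIcc.mono fun ε hε => (ha_smooth ε hε).continuous)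
      (ha_smooth 0 h0).continuous ha_lim t
  obtain ⟨τ, hτ⟩ := hK.bddAbove
  filter_upwards [hIcc, KGZ.eventually_norm_linearizedSemigroup_sub_lt hΩ.isOpen m hη (hb 0 h0)
    hlim τ hδ] with ε hε hlt s hs
  rw [heq ε hε, heq 0 h0]
  exact hlt s (hτ hs)
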